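/- **Conventions.** For a number field $K$ let $\mathbb Z_K$ be its ring of integers, $U_K=\mathbb Z_K^\times$, and $I_K$ its idele group. For a finite place $v$ (a maximal ideal of $\mathbb Z_K$) let $K_v$ be the completion, $\mathcal U_v$ the group of units of $K_v$ and $\mathcal M_v$ the maximal ideal of the valuation ring of $K_v$. An *idele class character* of $K$ is a continuous homomorphism $\chi$ from $I_K$ to the unit circle that is trivial on $K^\times$; $\chi_v$ denotes its restriction to $K_v^\times$. It is *quadratic* if it has order exactly $2$. It is *ramified* at a finite place $v$ if $\chi_v$ is nontrivial on $\mathcal U_v$; then $n(\chi_v)$ is the smallest $n\ge 1$ such that $\chi_v$ is trivial on $1+\mathcal M_v^n$, and the *conductor* of $\chi$ is the ideal $\mathfrak f_\chi=\prod_v v^{n(\chi_v)}$, the product over the finite places $v$ at which $\chi$ is ramified. For $K$ quadratic, $\chi$ is *from base change* if $\chi=\nu\circ N_{K/\mathbb Q}$ for some idele class character $\nu$ of $\mathbb Q$, where $N_{K/\mathbb Q}:I_K\to I_{\mathbb Q}$ is the idele norm. **Proposition.** Let $K=\mathbb Q(\sqrt{-d})$ with $d>0$ a squarefree integer, and let $c$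 be the nontrivial automorphism of $K$. (1) The class number of $K$ is odd and $U_K$ is $\{\pm1\}$ or is generated by a primitive sixth root of unity if and only if $d=2$ or $d$ is a prime with $d\equiv 3 \pmod 4$. Assume from now on that the equivalent conditions in (1) hold. Then exactly one prime number ramifies in $K$, and moreover: (2) Let $v$ be the place of $K$ above an odd prime $p$ which is inert in $K$. There is a unique quadratic idele class character $\eta$ of $K$ with $\mathfrak f_\eta=v$. (3) Let $v$ and $v^c$ be the two places of $K$ above a prime $p$ which splits in $K$. There is a unique quadratic idele class character $\eta$ of $K$ with $\mathfrak f_\eta=vv^c$ if $p$ is odd, and with $\mathfrak f_\eta=(vv^c)^2$ if $p=2$. If $p=2$, there are moreover exactly two quadratic idele class characters $\eta$ of $K$ with $\mathfrak f_\eta=(vv^c)^3$, and they are determined by the restriction of $\eta_v$ to $\mathcal U_v$. (4) Let $v$ be a place of $K$ above $2$, where $2$ is inert or ramified in $K$. There is a unique quadratic idele class character $\eta$ of $K$ with $\mathfrak f_\eta=v^2$. If $2$ is inert in $K$, there are exactly two quadratic idele class characters $\eta$ of $K$ with $\mathfrak f_\eta=v^3$. (5) Let $K=\mathbb Q(\sqrt{-2})$,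 let $v$ be the place above $2$, and let $\pi=\sqrt{-2}$. There is no quadratic idele class character of $K$ with conductor $v^4$. There are exactly two quadratic idele class characters $\eta$ of $K$ with $\mathfrak f_\eta=v^5$; both satisfy $\eta_v(1+\pi^3)=1$ and $\eta_v(1+\pi^4)=-1$, and for each sign $\pm$ exactly one of them satisfies $\eta_v(1+\pi)=\pm1$. They differ by the quadratic idele class character of $K$ of conductor $v^2$ from (4). (6) Let $d$ be a prime with $d\equiv3\pmod 4$ and let $v$ be the place of $K$ above $d$. There is no quadratic idele class character of $K$ for which $v$ is the only finite place at which it is ramified. All the characters $\eta$ in (2)–(4) are from base change; neither of the two characters of conductor $v^5$ in (5) is. -/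

import Mathlib

open NumberField IsDedekindDomain HeightOneSpectrum

noncomputable section

namespace QuadIdele

section Ideles

variable (K : Type*) [Field K] [NumberField K]

/-- The finite places of `K`, as the maximal ideals of its ring of integers. -/
abbrev FinPlace : Type _ := HeightOneSpectrum (𝓞 K)

/-- The idele group `I_K`, with the topology of the unit group of the adele ring. -/
abbrev Ideles : Type _ := (AdeleRing (𝓞 K) K)ˣ

/-- The diagonal embedding `Kˣ → I_K`. -/
def principalIdele : Kˣ →* Ideles K :=
  Units.map (algebraMap K (AdeleRing (𝓞 K) K)).toMonoidHom

/-- The group of idele class characters of `K`: continuous homomorphisms from `I_K` to the unit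
circle which are trivial on `Kˣ`. -/
def ideleClassCharacters : Subgroup (Ideles K →ₜ* Circle) where
  carrier := {χ | ∀ x : Kˣ, χ (principalIdele K x) = 1}
  one_mem' _ := rfl
  mul_mem' {a b} ha hb x := by
    change a _ * b _ = 1
    rw [ha x, hb x, one_mul]
  inv_mem' {a} ha x := by
    change (a _)⁻¹ = 1
    rw [ha x, inv_one]

variable {K}

open scoped Classical in
/-- The finite adele with component `x` at `v` and `1` at every other place. -/
def localFiniteAdele (v : FinPlace K) : v.adicCompletion K →* FiniteAdeleRing (𝓞 K) K where
  toFun x := RestrictedProduct.mulSingle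
    (fun w : FinPlace K => w.adicCompletionIntegers K) v x
  map_one' := RestrictedProduct.mulSingle_one _ _
  map_mul' x y := RestrictedProduct.mulSingle_mul _ _ x y

/-- The embedding `K_vˣ → I_K` at a finite place `v`. -/
def localIdele (v : FinPlace K) : (v.adicCompletion K)ˣ →* Ideles K :=
  Units.map ((MonoidHom.inr (InfiniteAdeleRing K) (FiniteAdeleRing (𝓞 K) K)).comp
    (localFiniteAdele v))

/-- The local component `χ_v` of an idele class character at a finite place `v`. -/
def localComponent (χ : ideleClassCharacters K) (v : FinPlace K) :
    (v.adicCompletion K)ˣ →* Circle :=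
  (χ : Ideles K →ₜ* Circle).toMonoidHom.comp (localIdele v)

/-- The unit filtration of `K_v`: the group of units `U_v` for `n = 0`, and `1 + M_v ^ n` for
`n ≥ 1`. -/
def unitFiltration (v : FinPlace K) (n : ℕ) : Set (v.adicCompletion K)ˣ :=
  {u | Valued.v (u : v.adicCompletion K) = 1 ∧
    Valued.v ((u : v.adicCompletion K) - 1) ≤ WithZero.exp (-(n : ℤ))}

/-- `χ` is ramified at `v` if `χ_v` is nontrivial on `U_v`. -/
def IsRamifiedAt (χ : ideleClassCharacters K) (v : FinPlace K) : Prop :=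
  ∃ u ∈ unitFiltration v 0, localComponent χ v u ≠ 1

/-- The nonzero ideal `f` is the conductor of `χ`: at every finite place `v`, its order at `v` is
the least `n` such that `χ_v` is trivial on the `n`-th step of the unit filtration. -/
def HasConductor (χ : ideleClassCharacters K) (f : Ideal (𝓞 K)) : Prop :=
  f ≠ ⊥ ∧ ∀ v : FinPlace K,
    IsLeast {n : ℕ | ∀ u ∈ unitFiltration v n, localComponent χ v u = 1}
      (multiplicity v.asIdeal f)

variable (K) in
/-- The quadratic (that is, of exact order two) idele class characters of conductor `f`. -/
def quadraticOfConductor (f : Ideal (𝓞 K)) : Set (ideleClassCharacters K) :=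
  {η | orderOf η = 2 ∧ HasConductor η f}

open scoped Classical in
/-- The value `χ_v(a)` for `a` in `Kˣ`, as a complex number (and `0` for `a = 0`). -/
def localValue (χ : ideleClassCharacters K) (v : FinPlace K) (a : K) : ℂ :=
  if h : algebraMap K (v.adicCompletion K) a = 0 then 0
  else (localComponent χ v (Units.mk0 _ h) : ℂ)

end Ideles

section Norm

variable (K L : Type*) [Field K] [NumberField K] [Field L] [NumberField L] [Algebra K L]

/-- The continuous extension `K_v → L_w` of `K → L`, for a finite place `w` of `L` above `v`. -/
def completionMap (v : FinPlace K) (w : FinPlace L) [w.asIdeal.LiesOver v.asIdeal] :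
    v.adicCompletion K →+* w.adicCompletion L :=
  ((adicCompletion.equiv L w).symm.toRingHom.comp
    (UniformSpace.Completion.mapRingHom
      (algebraMap (WithVal (v.valuation K)) (WithVal (w.valuation L)))
      (uniformContinuous_algebraMap_liesOver K L v w).continuous)).comp
    (adicCompletion.equiv K v).toRingHom

theorem continuous_completionMap (v : FinPlace K) (w : FinPlace L)
    [w.asIdeal.LiesOver v.asIdeal] : Continuous (completionMap K L v w) :=
  (adicCompletion.continuous_ofCompletion L w).comp <|
    UniformSpace.Completion.continuous_map.comp (adicCompletion.continuous_toCompletion K v)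

theorem completionMap_coe (v : FinPlace K) (w : FinPlace L)
    [w.asIdeal.LiesOver v.asIdeal] (x : K) :
    completionMap K L v w (algebraMap K _ x) = algebraMap L _ (algebraMap K L x) := by
  apply adicCompletion.ext
  change UniformSpace.Completion.mapRingHom _ _ 
    ((WithVal.equiv (v.valuation K)).symm x : (v.valuation K).Completion) = _
  rw [UniformSpace.Completion.mapRingHom_coe]
  rfl

/-- `L_w` as an algebra over `K_v`. -/
abbrev completionAlgebra (v : FinPlace K) (w : FinPlace L) [w.asIdeal.LiesOver v.asIdeal] :
    Algebra (v.adicCompletion K) (w.adicCompletion L) :=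
  (completionMap K L v w).toAlgebra

/-- The local norm `L_w → K_v` at a finite place `w` of `L` above `v`. -/
def localNorm (v : FinPlace K) (w : FinPlace L) [w.asIdeal.LiesOver v.asIdeal] :
    w.adicCompletion L →* v.adicCompletion K :=
  letI := completionAlgebra K L v w
  Algebra.norm (v.adicCompletion K)

/-- The norm of a finite extension of a complete field preserves integrality. -/
theorem norm_le_one_of_norm_le_one {F E : Type*} [NontriviallyNormedField F] [CompleteSpace F] [NormedField E]
    [Algebra F E] [ContinuousSMul F E] [Module.Finite F E] (x : E) (hx : ‖x‖ ≤ 1) :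
    ‖Algebra.norm F x‖ ≤ 1 := by
  classical
  have hcont : Continuous (fun y : E => Algebra.norm F y) := by
    have h : (fun y : E => Algebra.norm F y) = fun y =>
        (Algebra.leftMulMatrix (Module.finBasis F E) y).det :=
      funext fun y => Algebra.norm_eq_matrix_det _ y
    rw [h]
    refine Continuous.matrix_det ?_
    exact LinearMap.continuous_of_finiteDimensional
      (Algebra.leftMulMatrix (Module.finBasis F E)).toLinearMap
  have h0 : ∀ᶠ y in nhds (0 : E), ‖Algebra.norm F y‖ < 1 := by
    have h := hcont.norm.tendsto 0
    simp only [Algebra.norm_zero, norm_zero] at h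
    exact h.eventually_lt_const one_pos
  obtain ⟨ε, hε, hball⟩ := Metric.eventually_nhds_iff.1 h0
  have ha : ∀ᶠ a in nhdsWithin (0 : F) {0}ᶜ, ‖algebraMap F E a‖ < ε := by
    have hc : Continuous (algebraMap F E) := continuous_algebraMap F E
    have h := hc.norm.tendsto 0
    simp only [map_zero, norm_zero] at h
    exact (h.eventually_lt_const hε).filter_mono nhdsWithin_le_nhds
  obtain ⟨a, ha, ha0⟩ := (ha.and eventually_mem_nhdsWithin).exists
  have ha0 : a ≠ 0 := ha0
  set n := Module.finrank F E
  have hb : ∀ y : E, ‖y‖ ≤ 1 → ‖Algebra.norm F y‖ ≤ (‖a‖ ^ n)⁻¹ := by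
    intro y hy
    have h1 := hball (y := algebraMap F E a * y) (by
      rw [dist_zero_right, norm_mul]
      exact (mul_le_of_le_one_right (norm_nonneg _) hy).trans_lt ha)
    rw [map_mul, Algebra.norm_algebraMap, norm_mul, norm_pow] at h1
    have hp : 0 < ‖a‖ ^ n := pow_pos (norm_pos_iff.2 ha0) n
    rw [← one_div, le_div_iff₀' hp]
    exact h1.le
  by_contra hlt
  obtain ⟨m, hm⟩ := pow_unbounded_of_one_lt (‖a‖ ^ n)⁻¹ (not_le.1 hlt)
  have := hb (x ^ m) (by rw [norm_pow]; exact pow_le_one₀ (norm_nonneg _) hx)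
  rw [map_pow, norm_pow] at this
  exact absurd hm (not_lt.2 this)

open scoped Valued in
theorem localNorm_mem_integers (v : FinPlace K) (w : FinPlace L)
    [w.asIdeal.LiesOver v.asIdeal] (x : w.adicCompletion L)
    (hx : x ∈ w.adicCompletionIntegers L) :
    localNorm K L v w x ∈ v.adicCompletionIntegers K := by
  let := completionAlgebra K L v w
  have : ContinuousSMul (v.adicCompletion K) (w.adicCompletion L) :=
    ⟨((continuous_completionMap K L v w).comp continuous_fst).mul continuous_snd⟩
  have : IsScalarTower K (v.adicCompletion K) (w.adicCompletion L) := by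
    refine .of_algebraMap_eq fun y => ?_
    rw [RingHom.algebraMap_toAlgebra, completionMap_coe]
    exact IsScalarTower.algebraMap_apply K L _ y
  have : Module.Finite (v.adicCompletion K) (w.adicCompletion L) := inferInstance
  rw [mem_adicCompletionIntegers] at hx ⊢
  exact Valued.toNormedField.norm_le_one_iff.1
    (norm_le_one_of_norm_le_one x (Valued.toNormedField.norm_le_one_iff.2 hx))

/-- The finite places of `L` above `v`. -/
abbrev PlacesAbove (v : FinPlace K) : Type _ :=
  {w : FinPlace L // w.asIdeal.LiesOver v.asIdeal}

instance (v : FinPlace K) : Finite (PlacesAbove K L v) := by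
  have : Finite (v.asIdeal.primesOver (𝓞 L)) :=
    Algebra.QuasiFinite.finite_primesOver v.asIdeal
  exact Finite.of_injective
    (fun w : PlacesAbove K L v =>
      (⟨w.1.asIdeal, w.1.isPrime, w.2⟩ : v.asIdeal.primesOver (𝓞 L)))
    fun w w' h => Subtype.ext (HeightOneSpectrum.ext (congrArg Subtype.val h))

instance (v : FinPlace K) : Fintype (PlacesAbove K L v) := Fintype.ofFinite _

/-- The norm of finite adeles: its component at `v` is the product of the local norms from `L_w`
to `K_v` over the places `w` above `v`. -/
def finiteAdeleNorm : FiniteAdeleRing (𝓞 L) L →* FiniteAdeleRing (𝓞 K) K where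
  toFun x := ⟨fun v => ∏ w : PlacesAbove K L v, haveI := w.2; localNorm K L v w.1 (x w.1), by
    have hx := x.2
    rw [Filter.eventually_cofinite] at hx ⊢
    refine (hx.biUnion (t := fun w => {v : FinPlace K | w.asIdeal.LiesOver v.asIdeal})
      fun w _ => Set.Subsingleton.finite ?_).subset ?_
    · intro v hv v' hv'
      exact HeightOneSpectrum.ext (hv.over.trans hv'.over.symm)
    · intro v hv
      by_contra h
      refine hv (prod_mem fun w _ => ?_)
      have := w.2
      refine localNorm_mem_integers K L v w.1 _ ?_
      by_contra hw
      exact h (Set.mem_biUnion (x := w.1) hw w.2)⟩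
  map_one' := by
    refine FiniteAdeleRing.ext K fun v => ?_
    exact Finset.prod_eq_one fun (w : PlacesAbove K L v) _ =>
      have := w.2; map_one (localNorm K L v w.1)
  map_mul' x y := by
    refine FiniteAdeleRing.ext K fun v => ?_
    exact (Finset.prod_congr rfl fun (w : PlacesAbove K L v) _ =>
      have := w.2; map_mul (localNorm K L v w.1) (x w.1) (y w.1)).trans Finset.prod_mul_distrib

open scoped NumberField.LiesOver in
open scoped Classical in
/-- The norm of infinite adeles: its component at `v` is the product of the local norms from `L_w`
to `K_v` over the infinite places `w` above `v`. -/
def infiniteAdeleNorm : InfiniteAdeleRing L →* InfiniteAdeleRing K where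
  toFun x := fun v => ∏ w : {w : InfinitePlace L // w.LiesOver v},
    haveI := w.2; Algebra.norm v.Completion (x w.1)
  map_one' := by
    funext v
    exact Finset.prod_eq_one fun w _ => map_one _
  map_mul' x y := by
    funext v
    exact (Finset.prod_congr rfl fun w _ => map_mul _ _ _).trans Finset.prod_mul_distrib

/-- The norm `N_{L/K} : I_L → I_K` on ideles. -/
def ideleNorm : Ideles L →* Ideles K :=
  Units.map ((infiniteAdeleNorm K L).prodMap (finiteAdeleNorm K L))

end Norm

/-- `η` is from base change: `η = ν ∘ N_{K/ℚ}` for an idele class character `ν` of `ℚ`. -/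
def IsBaseChange {K : Type*} [Field K] [NumberField K] (η : ideleClassCharacters K) : Prop :=
  ∃ ν : ideleClassCharacters ℚ, ∀ x : Ideles K,
    (η : Ideles K →ₜ* Circle) x = (ν : Ideles ℚ →ₜ* Circle) (ideleNorm ℚ K x)

section Decomposition

variable {K : Type*} [Field K] [NumberField K]

/-- The finite place `v` of `K` lies above the rational prime `p`. -/
def LiesAbove (p : ℕ) (v : FinPlace K) : Prop := (p : 𝓞 K) ∈ v.asIdeal

/-- `p` is inert, and `v` is the place above it. -/
def IsInert (p : ℕ) (v : FinPlace K) : Prop := v.asIdeal = Ideal.span {(p : 𝓞 K)}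

/-- `v` lies above `p` and is ramified over `ℚ`. -/
def IsRamified (p : ℕ) (v : FinPlace K) : Prop := v.asIdeal ^ 2 ∣ Ideal.span {(p : 𝓞 K)}

variable (K) in
/-- The class number of `K` is odd, and its unit group is `{±1}` or is generated by a primitive
sixth root of unity. -/
def OddClassNumberSmallUnits : Prop :=
  Odd (classNumber K) ∧
    ((∀ u : (𝓞 K)ˣ, u = 1 ∨ u = -1) ∨
      ∃ ζ : (𝓞 K)ˣ, IsPrimitiveRoot ζ 6 ∧ Subgroup.zpowers ζ = ⊤)

end Decomposition

end QuadIdele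

end

/-! Let U be the group of ideles that are units at every finite place and h the class number. For
every idele x the power x ^ h lies in Kˣ · U. If h is odd, a character χ with values ±1 that is
trivial on Kˣ satisfies χ(x) = χ(x ^ h), so it is determined by its restriction to U
(`character_eq_one`). Conversely, a ±1-valued character ψ of U, continuous and trivial on the global
units, extends by x ↦ ψ(a⁻¹ x ^ h); two choices of a differ by a global unit
(`exists_ideleClassCharacter`). Ideles at the complex place are squares, so infinity contributes
nothing over K. What remains is to find quadratic characters of the local unit groups, subject to
the relation that the product of the local values at −1 is 1 (`prod_localValue_unit`).

Uniqueness is proved by descending the unit filtration. At an odd place of conductor exponent one,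
the local component is the quadratic character of the residue field (`localValue_eq_one_iff`). Above
2 the graded pieces are copies of 𝔽₂ or 𝔽₄. The value at each representative 1 + π ^ i r is forced
by the conductor, by a congruence with a square or with minus a square, or by the relation at −1. A
sign that stays free accounts for a pair of characters.

Existence comes mostly from ℚ. For a quadratic Dirichlet character χ, the map a ↦ χ(N a) kills the
global units, which have norm 1, and the resulting η equals ν ∘ N for the idele class character ν
attached to χ, because both agree on Kˣ and on U (`exists_isBaseChange`). This rests on the global
norm being the product of the local norms (`prod_localNorm`). The quadratic character modulo p and
`ZMod.χ₄`, `ZMod.χ₈`, `ZMod.χ₈'` supply every base change needed.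

In ℚ(√−2), with π = √−2, the identity 1 + π³ = −(1 + π)² excludes conductor v⁴. Conductor v⁵ needs
an explicit character modulo 8, multiplied or not by χ₄ ∘ N. It is not a base change: (1 + π) / (1 −
π) has norm 1, so a base change would be 1 at (1 + π)(1 − π) = 3, whereas −3 ≡ 1 + π⁴ has value −1.
At the place above d ≡ 3 modulo 4, a character ramified only there would be the quadratic character
modulo d, which is −1 at −1 and contradicts the relation.

The class number criterion is genus theory. A ramified prime has principal square, hence is
principal if h is odd, and the norm equation then restricts d. In the other direction, ideals stable
under conjugation are principal when d = 2 or d is a prime congruent to 3 modulo 4. Hilbert 90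
replaces an ideal whose class has order two by a stable ideal in the same class, so h is odd. -/

noncomputable section

/-! ### Components of ideles -/

namespace QuadIdele
variable {K : Type*} [Field K] [NumberField K]

variable (K) in
/-- The ideles which are units at every finite place. -/
def unitIdeles : Subgroup (Ideles K) where
  carrier := {x | ∀ v : FinPlace K, Valued.v ((x : AdeleRing (𝓞 K) K).2 v) = 1}
  one_mem' v := map_one (Valued.v : Valuation (v.adicCompletion K) _)
  mul_mem' {a b} ha hb v := by
    have h : ((a * b : Ideles K) : AdeleRing (𝓞 K) K).2 v = (a : AdeleRing (𝓞 K) K).2 v * (b : AdeleRing (𝓞 K) K).2 v := rfl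
    rw [h, map_mul, ha v, hb v, one_mul]
  inv_mem' {a} ha v := by
    have h : (a : AdeleRing (𝓞 K) K).2 v * ((a⁻¹ : Ideles K) : AdeleRing (𝓞 K) K).2 v = 1 := by
      have := congrArg (fun x : AdeleRing (𝓞 K) K => x.2 v) a.mul_inv
      exact this
    have h2 := congrArg Valued.v h
    rw [map_mul, ha v, one_mul, map_one] at h2
    exact h2

/-- The component of an idele at a finite place. -/
def component (v : FinPlace K) : Ideles K →* (v.adicCompletion K)ˣ where
  toFun x := ⟨(x : AdeleRing (𝓞 K) K).2 v, ((x⁻¹ : Ideles K) : AdeleRing (𝓞 K) K).2 v,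
    congrArg (fun x : AdeleRing (𝓞 K) K => x.2 v) x.mul_inv, congrArg (fun x : AdeleRing (𝓞 K) K => x.2 v) x.inv_mul⟩
  map_one' := rfl
  map_mul' x y := by ext; rfl

theorem coe_component (v : FinPlace K) (x : Ideles K) : (component v x : v.adicCompletion K) = (x : AdeleRing (𝓞 K) K).2 v := rfl

theorem component_localIdele_same (v : FinPlace K) (u : (v.adicCompletion K)ˣ) :
    component v (localIdele v u) = u := by
  classical
  exact Units.ext (RestrictedProduct.mulSingle_eq_same (fun w : FinPlace K => w.adicCompletionIntegers K) v
    (u : v.adicCompletion K))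

theorem component_localIdele_of_ne {v w : FinPlace K} (h : w ≠ v) (u : (v.adicCompletion K)ˣ) :
    component w (localIdele v u) = 1 := by
  classical
  exact Units.ext (RestrictedProduct.mulSingle_eq_of_ne (fun w : FinPlace K => w.adicCompletionIntegers K)
    (u : v.adicCompletion K) h)

theorem localIdele_fst (v : FinPlace K) (u : (v.adicCompletion K)ˣ) :
    (localIdele v u : AdeleRing (𝓞 K) K).1 = 1 := rfl

theorem ideles_ext {x y : Ideles K} (h₁ : (x : AdeleRing (𝓞 K) K).1 = (y : AdeleRing (𝓞 K) K).1)
    (h₂ : ∀ v, component v x = component v y) : x = y := by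
  refine Units.ext (Prod.ext h₁ (FiniteAdeleRing.ext K fun v => ?_))
  exact congrArg Units.val (h₂ v)

theorem component_principalIdele (v : FinPlace K) (a : Kˣ) :
    (component v (principalIdele K a) : v.adicCompletion K) = algebraMap K _ (a : K) := rfl

theorem valued_algebraMap (v : FinPlace K) (a : K) :
    Valued.v (algebraMap K (v.adicCompletion K) a) = v.valuation K a :=
  valuedAdicCompletion_eq_valuation' v a

theorem valued_algebraMap_int (v : FinPlace K) (a : 𝓞 K) :
    Valued.v (algebraMap (𝓞 K) (v.adicCompletion K) a) = v.intValuation a := by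
  rw [IsScalarTower.algebraMap_apply (𝓞 K) K, valued_algebraMap, valuation_of_algebraMap]

theorem valued_algebraMap_int_le (v : FinPlace K) (a : 𝓞 K) (n : ℕ) :
    Valued.v (algebraMap (𝓞 K) (v.adicCompletion K) a) ≤ WithZero.exp (-(n : ℤ)) ↔ a ∈ v.asIdeal ^ n := by
  rw [valued_algebraMap_int, intValuation_le_pow_iff_mem]

/-- The embedding of the unit ideles at infinity. -/
def infiniteIdele : (InfiniteAdeleRing K)ˣ →* Ideles K :=
  Units.map (MonoidHom.inl (InfiniteAdeleRing K) (FiniteAdeleRing (𝓞 K) K))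

/-- The infinite part of an idele. -/
def infinitePart : Ideles K →* (InfiniteAdeleRing K)ˣ :=
  Units.map (MonoidHom.fst (InfiniteAdeleRing K) (FiniteAdeleRing (𝓞 K) K))

/-- The topology is defined by radii in the value group of the restricted valuation. Translating
them to integer exponents makes neighbourhoods comparable with the unit filtration. -/
theorem mem_nhds_adicCompletion {v : FinPlace K} {x : v.adicCompletion K} {s : Set (v.adicCompletion K)} :
    s ∈ nhds x ↔ ∃ n : ℕ, {y | Valued.v (y - x) ≤ WithZero.exp (-(n : ℤ))} ⊆ s := by
  rw [Valued.mem_nhds]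
  have key (y : v.adicCompletion K) (γ) : Valued.v.restrict y < γ ↔
      Valued.v y < MonoidWithZeroHom.ValueGroup₀.embedding γ := by
    rw [← MonoidWithZeroHom.ValueGroup₀.embedding_strictMono.lt_iff_lt, Valuation.embedding_restrict]
  constructor
  · rintro ⟨γ, hγ⟩
    obtain ⟨k, hk⟩ : ∃ k : ℤ, MonoidWithZeroHom.ValueGroup₀.embedding γ.1 = WithZero.exp k := by
      have h0 : MonoidWithZeroHom.ValueGroup₀.embedding γ.1 ≠ 0 := by simp
      exact ⟨_, (WithZero.exp_log h0).symm⟩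
    refine ⟨(1 - k).toNat, fun y hy => hγ ?_⟩
    rw [Set.mem_ofPred_eq, key, hk]
    refine lt_of_le_of_lt hy ?_
    rw [WithZero.exp_lt_exp]
    lia
  · rintro ⟨n, hn⟩
    obtain ⟨z, hz⟩ := valuedAdicCompletion_surjective K v (WithZero.exp (-(n : ℤ)))
    have hz0 : Valued.v.restrict z ≠ 0 := by
      intro h
      have := congrArg MonoidWithZeroHom.ValueGroup₀.embedding h
      rw [Valuation.embedding_restrict, hz, map_zero] at this
      simp at this
    refine ⟨Units.mk0 _ hz0, fun y hy => hn ?_⟩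
    rw [Set.mem_ofPred_eq, Units.val_mk0, key, Valuation.embedding_restrict, hz] at hy
    exact hy.le

instance charZero_adicCompletion (v : FinPlace K) : CharZero (v.adicCompletion K) :=
  charZero_of_injective_algebraMap (algebraMap K (v.adicCompletion K)).injective

theorem valued_inv_sub_one {v : FinPlace K} (u : (v.adicCompletion K)ˣ)
    (hu : Valued.v (u : v.adicCompletion K) = 1) :
    Valued.v (((u⁻¹ : (v.adicCompletion K)ˣ) : v.adicCompletion K) - 1) = Valued.v ((u : v.adicCompletion K) - 1) := by
  have h : ((u⁻¹ : (v.adicCompletion K)ˣ) : v.adicCompletion K) - 1 = -(((u : v.adicCompletion K) - 1) * (u : v.adicCompletion K)⁻¹) := by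
    rw [sub_mul, mul_inv_cancel₀ u.ne_zero, Units.val_inv_eq_inv_val]
    ring
  rw [h, Valuation.map_neg, map_mul, map_inv₀, hu, inv_one, mul_one]

/-- The idele topology constrains both x and x⁻¹. When the components are units, both are at the
same distance from 1, so a single congruence condition controls the two. -/
theorem exists_nhds_one {U : Set (Ideles K)} (hU : U ∈ nhds 1) :
    ∃ (S : Finset (FinPlace K)) (n : ℕ), ∀ x ∈ unitIdeles K, (x : AdeleRing (𝓞 K) K).1 = 1 →
      (∀ v ∈ S, Valued.v ((component v x : v.adicCompletion K) - 1) ≤ WithZero.exp (-(n : ℤ))) → x ∈ U := by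
  classical
  rw [Units.isEmbedding_embedProduct.isInducing.nhds_eq_comap, Filter.mem_comap] at hU
  obtain ⟨V, hV, hVU⟩ := hU
  rw [map_one, Prod.one_eq_mk, nhds_prod_eq, Filter.mem_prod_iff] at hV
  obtain ⟨V₁, hV₁, V₂, hV₂, hV⟩ := hV
  have hV₂' : MulOpposite.op ⁻¹' V₂ ∈ nhds (1 : AdeleRing (𝓞 K) K) :=
    MulOpposite.continuous_op.continuousAt.preimage_mem_nhds hV₂
  have hV₃ := Filter.inter_mem hV₁ hV₂'
  obtain ⟨A, hA, B, hB, hAB⟩ := (mem_nhds_prod_iff (X := InfiniteAdeleRing K) (Y := FiniteAdeleRing (𝓞 K) K)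
    (x := 1) (y := 1)).1 hV₃
  have hop : ∀ v : FinPlace K, IsOpen (v.adicCompletionIntegers K : Set (v.adicCompletion K)) :=
    fun _ ↦ Valued.isOpen_valuationSubring _
  have hcont := (RestrictedProduct.isEmbedding_structureMap (R := fun v : FinPlace K => v.adicCompletion K)
    (A := fun v : FinPlace K => (v.adicCompletionIntegers K : Set (v.adicCompletion K))) (𝓕 := Filter.cofinite)).continuous
  have hB2 := (hcont.continuousAt (x := fun v => ⟨1, one_mem _⟩)).preimage_mem_nhds hB
  rw [nhds_pi, Filter.mem_pi'] at hB2
  obtain ⟨S, t, ht, hSt⟩ := hB2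
  have ht' (v : FinPlace K) : ∃ n : ℕ, ∀ y : v.adicCompletionIntegers K,
      Valued.v ((y : v.adicCompletion K) - 1) ≤ WithZero.exp (-(n : ℤ)) → y ∈ t v := by
    obtain ⟨w, hw, hwt⟩ := mem_nhds_subtype _ _ _ |>.1 (ht v)
    obtain ⟨n, hn⟩ := mem_nhds_adicCompletion.1 hw
    exact ⟨n, fun y hy => hwt (hn hy)⟩
  choose n hn using ht'
  have key (x : Ideles K) (hx : x ∈ unitIdeles K)
      (hxS : ∀ v ∈ S, Valued.v ((component v x : v.adicCompletion K) - 1) ≤ WithZero.exp (-((S.sup n : ℕ) : ℤ))) :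
      (x : AdeleRing (𝓞 K) K).2 ∈ B := by
    refine hSt (a := fun v => ⟨_, (hx v).le⟩) fun v hv => hn v _ ((hxS v hv).trans ?_)
    rw [WithZero.exp_le_exp, neg_le_neg_iff]
    exact_mod_cast Finset.le_sup hv
  refine ⟨S, S.sup n, fun x hx hx1 hxS => hVU (hV ⟨?_, ?_⟩)⟩
  · exact (hAB (a := (x : AdeleRing (𝓞 K) K)) ⟨by rw [hx1]; exact mem_of_mem_nhds hA, key x hx hxS⟩).1
  · refine (hAB (a := ((x⁻¹ : Ideles K) : AdeleRing (𝓞 K) K)) ⟨?_, key x⁻¹ (inv_mem hx) fun v hv => ?_⟩).2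
    · have h : (x : AdeleRing (𝓞 K) K).1 * ((x⁻¹ : Ideles K) : AdeleRing (𝓞 K) K).1 = 1 :=
        congrArg Prod.fst x.mul_inv
      rw [hx1, one_mul] at h
      rw [h]
      exact mem_of_mem_nhds hA
    · exact (valued_inv_sub_one (component v x) (hx v)).le.trans (hxS v hv)

/-- The unit ideles congruent to `1` modulo `M` form a neighbourhood of `1`. -/
theorem unitIdeles_congr_mem_nhds {M : ℕ} (hM : M ≠ 0) :
    {x : Ideles K | x ∈ unitIdeles K ∧ ∀ v, Valued.v ((component v x : v.adicCompletion K) - 1) ≤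
      Valued.v (M : v.adicCompletion K)} ∈ nhds 1 := by
  classical
  have hop : ∀ v : FinPlace K, IsOpen (v.adicCompletionIntegers K : Set (v.adicCompletion K)) :=
    fun _ ↦ Valued.isOpen_valuationSubring _
  have hfin : {v : FinPlace K | ¬ (Valued.v (M : v.adicCompletion K) = 1)}.Finite := by
    have h := HeightOneSpectrum.Support.finite (𝓞 K) ((M : K)⁻¹)
    refine h.subset fun v hv => ?_
    have h1 : Valued.v (M : v.adicCompletion K) ≤ 1 := natCast_mem (v.adicCompletionIntegers K) M
    have h2 : Valued.v (M : v.adicCompletion K) = v.valuation K (M : K) := by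
      rw [← valued_algebraMap v (M : K), map_natCast (algebraMap K (v.adicCompletion K))]
    have h3 := lt_of_le_of_ne h1 hv
    rw [h2] at h3
    change 1 < v.valuation K (M : K)⁻¹
    rw [map_inv₀]
    refine (one_lt_inv₀ (zero_lt_iff.2 ?_)).2 h3
    simpa using hM
  have h1 : {x : FiniteAdeleRing (𝓞 K) K | ∀ v, Valued.v (x v) ≤ 1 ∧ Valued.v (x v - 1) ≤
      Valued.v (M : v.adicCompletion K)} ∈ nhds 1 := by
    have hB := RestrictedProduct.nhds_eq_map_structureMap (R := fun v : FinPlace K => v.adicCompletion K)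
      (A := fun v : FinPlace K => (v.adicCompletionIntegers K : Set (v.adicCompletion K))) hop
      (fun v => (⟨1, one_mem _⟩))
    refine (Filter.mem_of_superset (x := RestrictedProduct.structureMap (fun v : FinPlace K => v.adicCompletion K)
      (fun v : FinPlace K => (v.adicCompletionIntegers K : Set (v.adicCompletion K))) Filter.cofinite ''
        Set.pi hfin.toFinset fun v => {y | Valued.v ((y : v.adicCompletion K) - 1) ≤
          Valued.v (M : v.adicCompletion K)}) (hB ▸ Filter.image_mem_map ?_) ?_ :
      _ ∈ nhds (RestrictedProduct.structureMap (fun v : FinPlace K => v.adicCompletion K)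
      (fun v : FinPlace K => (v.adicCompletionIntegers K : Set (v.adicCompletion K))) Filter.cofinite
        fun v => (⟨1, one_mem _⟩)))
    · refine set_pi_mem_nhds (Finset.finite_toSet _) fun v _ => ?_
      refine mem_nhds_subtype _ _ _ |>.2 ⟨_, mem_nhds_adicCompletion.2 ⟨(-WithZero.log (Valued.v (M : v.adicCompletion K))).toNat,
        Set.Subset.rfl⟩, fun y hy => ?_⟩
      refine (show Valued.v ((y : v.adicCompletion K) - 1) ≤ _ from hy).trans ?_
      rw [← WithZero.le_log_iff_exp_le]
      · lia
      · exact (Valuation.ne_zero_iff _).2 (Nat.cast_ne_zero.2 hM)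
    · rintro _ ⟨y, hy, rfl⟩ v
      refine ⟨(y v).2, ?_⟩
      by_cases hv : v ∈ hfin.toFinset
      · exact hy v hv
      · have hv' : Valued.v (M : v.adicCompletion K) = 1 := by simpa using hv
        rw [hv']
        exact (v.adicCompletionIntegers K).sub_mem (y v).2 (one_mem _)
  have h2 : Filter.Tendsto (fun x : Ideles K => (x : AdeleRing (𝓞 K) K).2) (nhds 1) (nhds 1) :=
    ((continuous_snd (X := InfiniteAdeleRing K) (Y := FiniteAdeleRing (𝓞 K) K)).comp
      (Units.continuous_val (M := AdeleRing (𝓞 K) K))).continuousAt (x := (1 : Ideles K))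
  have h3 : Filter.Tendsto (fun x : Ideles K => ((x⁻¹ : Ideles K) : AdeleRing (𝓞 K) K).2) (nhds 1) (nhds 1) := by
    have := ((continuous_snd (X := InfiniteAdeleRing K) (Y := FiniteAdeleRing (𝓞 K) K)).comp
      (Units.continuous_coe_inv (M := AdeleRing (𝓞 K) K))).continuousAt (x := (1 : Ideles K))
    exact this
  filter_upwards [h2 h1, h3 h1] with x hx hx'
  -- The bound on x⁻¹ turns |x| ≤ 1 into |x| = 1.
  refine ⟨fun v => le_antisymm (hx v).1 ?_, fun v => (hx v).2⟩
  have h := hx' v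
  have h4 : Valued.v ((component v x : v.adicCompletion K)⁻¹) ≤ 1 := by
    rw [← Units.val_inv_eq_inv_val, ← map_inv]
    exact h.1
  rw [map_inv₀] at h4
  exact (inv_le_one₀ (zero_lt_iff.2 ((Valuation.ne_zero_iff _).2 (component v x).ne_zero))).1 h4

end QuadIdele

/-! ### Characters trivial on the unit ideles -/

namespace QuadIdele
variable {K : Type*} [Field K] [NumberField K]

theorem exists_pow_classNumber_eq_span (v : FinPlace K) :
    ∃ a : 𝓞 K, v.asIdeal ^ classNumber K = Ideal.span {a} := by
  have h : ClassGroup.mk0 ⟨v.asIdeal, mem_nonZeroDivisors_of_ne_zero v.ne_bot⟩ ^ classNumber K = 1 :=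
    pow_card_eq_one
  rw [← map_pow, ClassGroup.mk0_eq_one_iff] at h
  obtain ⟨a, ha⟩ := h.principal
  exact ⟨a, ha⟩

theorem intValuation_of_span_eq_pow {v : FinPlace K} {a : 𝓞 K} {n : ℕ} (h : v.asIdeal ^ n = Ideal.span {a}) :
    v.intValuation a = WithZero.exp (-(n : ℤ)) := by
  have ha : a ≠ 0 := by
    rintro rfl
    rw [Ideal.span_singleton_eq_bot.2 rfl] at h
    exact pow_ne_zero n v.ne_bot h
  refine le_antisymm ?_ (not_lt.1 fun hlt => ?_)
  · rw [intValuation_le_pow_iff_mem, h]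
    exact Ideal.mem_span_singleton_self a
  · have h2 : v.intValuation a ≤ WithZero.exp (-((n + 1 : ℕ) : ℤ)) := by
      rw [← WithZero.exp_log (v.intValuation_ne_zero a ha)] at hlt ⊢
      rw [WithZero.exp_lt_exp] at hlt
      rw [WithZero.exp_le_exp]
      push_cast
      lia
    rw [intValuation_le_pow_iff_mem] at h2
    have h3 : v.asIdeal ^ n ≤ v.asIdeal ^ (n + 1) := by
      rw [h]
      exact (Ideal.span_singleton_le_iff_mem _).2 h2
    exact absurd h3 (not_le_of_gt (Ideal.pow_succ_lt_pow v.ne_bot n))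

theorem intValuation_of_span_eq_pow_of_ne {v w : FinPlace K} (hvw : w ≠ v) {a : 𝓞 K} {n : ℕ}
    (h : v.asIdeal ^ n = Ideal.span {a}) : w.intValuation a = 1 := by
  rw [intValuation_eq_one_iff]
  intro haw
  have h1 : v.asIdeal ^ n ≤ w.asIdeal := by
    rw [h]
    exact (Ideal.span_singleton_le_iff_mem _).2 haw
  have h2 := Ideal.IsPrime.le_of_pow_le h1
  exact hvw (HeightOneSpectrum.ext (v.isMaximal.eq_of_le w.isPrime.ne_top h2).symm)

theorem finite_valued_component_ne_one (x : Ideles K) :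
    {v : FinPlace K | Valued.v (component v x : v.adicCompletion K) ≠ 1}.Finite := by
  have h : IsUnit (x : AdeleRing (𝓞 K) K).2 :=
    ⟨⟨_, ((x⁻¹ : Ideles K) : AdeleRing (𝓞 K) K).2, congrArg Prod.snd x.mul_inv, congrArg Prod.snd x.inv_mul⟩, rfl⟩
  exact (FiniteAdeleRing.isUnit_iff.1 h).2

/-- The `h`-th power of an idele is the product of a principal idele and a unit idele, `h` being the
class number. -/
theorem exists_pow_classNumber_mem (x : Ideles K) :
    ∃ a : Kˣ, (principalIdele K a)⁻¹ * x ^ classNumber K ∈ unitIdeles K := by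
  classical
  choose g hg using exists_pow_classNumber_eq_span (K := K)
  have hg0 (v : FinPlace K) : (g v : K) ≠ 0 := by
    intro h
    have h0 : g v = 0 := by exact_mod_cast h
    have := intValuation_of_span_eq_pow (hg v)
    rw [h0, map_zero] at this
    exact WithZero.exp_ne_zero this.symm
  set S := (finite_valued_component_ne_one x).toFinset
  let n (v : FinPlace K) : ℤ := -WithZero.log (Valued.v (component v x : v.adicCompletion K))
  -- `n v` is the order of x at v, while `g v` generates the h-th power of v and is a unit
  -- elsewhere. The product therefore has h times the order of x at every place.
  let a : Kˣ := ∏ v ∈ S, Units.mk0 (g v : K) (hg0 v) ^ n v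
  have hval (w : FinPlace K) : w.valuation K (a : K) =
      Valued.v (component w x : w.adicCompletion K) ^ classNumber K := by
    have h1 : w.valuation K (a : K) = ∏ v ∈ S, w.valuation K (g v : K) ^ n v := by
      simp [a, Units.coe_prod, map_prod, map_zpow₀]
    have h2 (v : FinPlace K) : w.valuation K (g v : K) = w.intValuation (g v) := valuation_of_algebraMap w (g v)
    have h3 : Valued.v (component w x : w.adicCompletion K) ≠ 0 := (Valuation.ne_zero_iff _).2 (component w x).ne_zero
    rw [h1]
    by_cases hw : w ∈ S
    · rw [Finset.prod_eq_single_of_mem w hw, h2, intValuation_of_span_eq_pow (hg w)]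
      · conv_rhs => rw [← WithZero.exp_log h3]
        rw [← WithZero.exp_zsmul, ← WithZero.exp_nsmul]
        congr 1
        simp [n]
        ring
      · intro v _ hv
        rw [h2, intValuation_of_span_eq_pow_of_ne hv.symm (hg v), one_zpow]
    · have h4 : Valued.v (component w x : w.adicCompletion K) = 1 := by
        simpa [S] using hw
      rw [h4, one_pow]
      refine Finset.prod_eq_one fun v hv => ?_
      rw [h2, intValuation_of_span_eq_pow_of_ne (by rintro rfl; exact hw hv) (hg v), one_zpow]
  refine ⟨a, fun w => ?_⟩
  rw [← coe_component, map_mul, map_pow, map_inv, Units.val_mul, map_mul, Units.val_pow_eq_pow_val, map_pow,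
    Units.val_inv_eq_inv_val, map_inv₀, component_principalIdele, valued_algebraMap, hval]
  exact inv_mul_cancel₀ (pow_ne_zero _ ((Valuation.ne_zero_iff _).2 (component w x).ne_zero))

/-- A character of the ideles of order dividing two, trivial on principal ideles and on unit ideles,
is trivial if the class number is odd. -/
theorem character_eq_one (hodd : Odd (classNumber K)) (f : Ideles K →* Circle) (hf : ∀ x, f x ^ 2 = 1)
    (hp : ∀ a, f (principalIdele K a) = 1) (hu : ∀ x ∈ unitIdeles K, f x = 1) (x : Ideles K) : f x = 1 := by
  obtain ⟨a, ha⟩ := exists_pow_classNumber_mem x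
  have h1 := hu _ ha
  rw [map_mul, map_inv, hp, inv_one, one_mul, map_pow] at h1
  -- For h = 2k + 1 the power χ(x) ^ h is χ(x).
  obtain ⟨k, hk⟩ := hodd
  rwa [hk, pow_succ, pow_mul, hf, one_pow, one_mul] at h1

theorem circle_eq_one_or {z : Circle} (hz : z ^ 2 = 1) : z = 1 ∨ z = -1 := by
  have h : (z : ℂ) ^ 2 = 1 := by exact_mod_cast congrArg (Subtype.val) hz
  rw [pow_two] at h
  rcases mul_self_eq_one_iff.1 h with h | h
  · exact Or.inl (Circle.ext h)
  · exact Or.inr (Circle.ext h)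

theorem circle_neg_one_ne_one : (-1 : Circle) ≠ 1 := by
  intro h
  have := congrArg (Subtype.val) h
  norm_num at this

/-- Among the values ±1, being different from −1 is an open condition, so the kernel is open. -/
theorem character_eq_one_mem_nhds (χ : Ideles K →ₜ* Circle) (hχ : ∀ x, χ x ^ 2 = 1) :
    {x | χ x = 1} ∈ nhds 1 := by
  have h : χ ⁻¹' {z : Circle | z ≠ -1} ∈ nhds 1 := by
    refine (map_continuous χ).continuousAt.preimage_mem_nhds (isOpen_ne.mem_nhds ?_)
    rw [map_one]
    exact circle_neg_one_ne_one.symm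
  filter_upwards [h] with x hx
  exact (circle_eq_one_or (hχ x)).resolve_right hx

/-- A quadratic idele class character is trivial on a higher unit group at each finite place. -/
theorem exists_trivial_on_unitFiltration (χ : ideleClassCharacters K) (hχ : ∀ x, χ.1 x ^ 2 = 1) (v : FinPlace K) :
    ∃ n : ℕ, ∀ u ∈ unitFiltration v n, localComponent χ v u = 1 := by
  obtain ⟨S, n, h⟩ := exists_nhds_one (character_eq_one_mem_nhds χ.1 hχ)
  refine ⟨n, fun u hu => h (localIdele v u) (fun w => ?_) rfl fun w _ => ?_⟩
  · rw [← coe_component]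
    by_cases hw : w = v
    · subst hw
      rw [component_localIdele_same]
      exact hu.1
    · rw [component_localIdele_of_ne hw, Units.val_one, map_one]
  · by_cases hw : w = v
    · subst hw
      rw [component_localIdele_same]
      exact hu.2
    · rw [component_localIdele_of_ne hw, Units.val_one, sub_self, map_zero]
      exact zero_le

theorem localIdele_mem_unitIdeles {v : FinPlace K} {u : (v.adicCompletion K)ˣ}
    (hu : Valued.v (u : v.adicCompletion K) = 1) : localIdele v u ∈ unitIdeles K := by
  intro w
  rw [← coe_component]
  by_cases hw : w = v
  · subst hw
    rwa [component_localIdele_same]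
  · rw [component_localIdele_of_ne hw, Units.val_one, map_one]

theorem mem_unitFiltration_zero {v : FinPlace K} {u : (v.adicCompletion K)ˣ} :
    u ∈ unitFiltration v 0 ↔ Valued.v (u : v.adicCompletion K) = 1 := by
  refine ⟨fun h => h.1, fun h => ⟨h, ?_⟩⟩
  rw [Nat.cast_zero, neg_zero, WithZero.exp_zero]
  exact (v.adicCompletionIntegers K).sub_mem (show (u : v.adicCompletion K) ∈ v.adicCompletionIntegers K from h.le) (one_mem _)

/-- A quadratic character which is unramified outside `S` and trivial at infinity is the product of its
local components at `S` on unit ideles. -/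
theorem character_eq_prod (hc : ∀ z : (InfiniteAdeleRing K)ˣ, IsSquare z) (χ : ideleClassCharacters K)
    (hχ : ∀ x, χ.1 x ^ 2 = 1) (S : Finset (FinPlace K))
    (hS : ∀ v ∉ S, ∀ u ∈ unitFiltration v 0, localComponent χ v u = 1) {x : Ideles K} (hx : x ∈ unitIdeles K) :
    χ.1 x = ∏ v ∈ S, localComponent χ v (component v x) := by
  classical
  obtain ⟨T, n, h⟩ := exists_nhds_one (character_eq_one_mem_nhds χ.1 hχ)
  obtain ⟨z, hz⟩ := hc (infinitePart x)
  -- Removing from x its infinite part and its components at `S ∪ T` leaves an idele that is 1 at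
  -- infinity and on `T` and a unit elsewhere. It lies in the neighbourhood of 1 where χ is trivial.
  have hy : (infiniteIdele (infinitePart x))⁻¹ * x * (∏ v ∈ S ∪ T, localIdele v (component v x))⁻¹ ∈ {x | χ.1 x = 1} := by
    have hcomp (w : FinPlace K) : component w ((infiniteIdele (infinitePart x))⁻¹ * x * (∏ v ∈ S ∪ T, localIdele v (component v x))⁻¹) =
        if w ∈ S ∪ T then 1 else component w x := by
      rw [map_mul, map_mul, map_inv, map_inv, map_prod]
      have h1 : component w (infiniteIdele (infinitePart x)) = 1 := rfl
      rw [h1, inv_one, one_mul]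
      by_cases hw : w ∈ S ∪ T
      · rw [Finset.prod_eq_single_of_mem w hw, component_localIdele_same, mul_inv_cancel, if_pos hw]
        exact fun v _ hv => component_localIdele_of_ne hv.symm _
      · rw [Finset.prod_eq_one, inv_one, mul_one, if_neg hw]
        intro v hv
        exact component_localIdele_of_ne (by rintro rfl; exact hw hv) _
    refine h _ ?_ ?_ ?_
    · intro w
      rw [← coe_component, hcomp]
      split_ifs
      · rw [Units.val_one, map_one]
      · exact hx w
    · have h1 : infinitePart ((infiniteIdele (infinitePart x))⁻¹ * x * (∏ v ∈ S ∪ T, localIdele v (component v x))⁻¹) = 1 := by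
        rw [map_mul, map_mul, map_inv, map_inv, map_prod]
        have h1 : infinitePart (infiniteIdele (infinitePart x)) = infinitePart x := rfl
        rw [h1, inv_mul_cancel, one_mul, Finset.prod_eq_one, inv_one]
        exact fun _ _ => rfl
      exact congrArg Units.val h1
    · intro v hv
      rw [hcomp, if_pos (Finset.mem_union_right _ hv), Units.val_one, sub_self, map_zero]
      exact zero_le
  have hy' : χ.1 ((infiniteIdele (infinitePart x))⁻¹ * x * (∏ v ∈ S ∪ T, localIdele v (component v x))⁻¹) = 1 := hy
  -- The infinite part is a square, hence invisible to χ; the places of `T` outside `S` contribute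
  -- 1.
  rw [map_mul, map_mul, map_inv, map_inv, map_prod, hz, map_mul infiniteIdele, map_mul χ.1, ← pow_two, hχ, inv_one, one_mul,
    mul_inv_eq_one] at hy'
  rw [hy', ← Finset.prod_subset (Finset.subset_union_left (s₁ := S) (s₂ := T))]
  · rfl
  · exact fun v _ hv => hS v hv _ (mem_unitFiltration_zero.2 (hx v))

/-- Quadratic idele class characters are determined by their local components at unit groups. -/
theorem ideleClassCharacter_eq_one (hodd : Odd (classNumber K)) (hc : ∀ z : (InfiniteAdeleRing K)ˣ, IsSquare z)
    (χ : ideleClassCharacters K) (hχ : ∀ x, χ.1 x ^ 2 = 1)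
    (h : ∀ v, ∀ u ∈ unitFiltration v 0, localComponent χ v u = 1) : χ = 1 := by
  refine Subtype.ext (ContinuousMonoidHom.ext fun x => ?_)
  refine character_eq_one hodd χ.1.toMonoidHom hχ χ.2 (fun x hx => ?_) x
  exact character_eq_prod hc χ hχ ∅ (fun v _ => h v) hx

end QuadIdele

/-! ### Construction of characters from congruence characters -/

namespace QuadIdele
variable {K : Type*} [Field K] [NumberField K]

/-- K is dense in K_v, and an element of K integral at v is congruent to a global integer modulo
every power of v. -/
theorem exists_int_valued_sub_le {v : FinPlace K} {x : v.adicCompletion K} (hx : Valued.v x ≤ 1) (n : ℕ) :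
    ∃ a : 𝓞 K, Valued.v (x - algebraMap (𝓞 K) _ a) ≤ WithZero.exp (-(n : ℤ)) := by
  have h1 : {y | Valued.v (y - x) ≤ WithZero.exp (-(n : ℤ))} ∈ nhds x := mem_nhds_adicCompletion.2 ⟨n, subset_rfl⟩
  obtain ⟨k, hk⟩ := (denseRange_algebraMap K v).mem_nhds h1
  have hk : Valued.v (algebraMap K _ k - x) ≤ WithZero.exp (-(n : ℤ)) := hk
  have h2 : v.valuation K k ≤ 1 := by
    rw [← valued_algebraMap, ← sub_add_cancel (algebraMap K (v.adicCompletion K) k) x]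
    refine (Valuation.map_add _ _ _).trans (max_le (hk.trans ?_) hx)
    rw [← WithZero.exp_zero, WithZero.exp_le_exp]
    lia
  obtain ⟨a, ha⟩ := exists_valuation_sub_lt_of_integer v h2
    (Units.mk0 (WithZero.exp (-(n : ℤ))) WithZero.exp_ne_zero)
  refine ⟨a, ?_⟩
  rw [← valued_algebraMap, map_sub, ← IsScalarTower.algebraMap_apply (𝓞 K) K] at ha
  have h3 : x - algebraMap (𝓞 K) _ a = -((algebraMap K _ k - x) + (algebraMap (𝓞 K) (v.adicCompletion K) a - algebraMap K _ k)) := by ring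
  rw [h3, Valuation.map_neg]
  exact (Valuation.map_add _ _ _).trans (max_le hk ha.le)

/-- Approximation of local integers at finitely many places by a global integer. -/
theorem exists_int_forall_valued_sub_le (S : Finset (FinPlace K)) (n : ℕ) (x : ∀ v : FinPlace K, v.adicCompletion K)
    (hx : ∀ v ∈ S, Valued.v (x v) ≤ 1) :
    ∃ a : 𝓞 K, ∀ v ∈ S, Valued.v (x v - algebraMap (𝓞 K) _ a) ≤ WithZero.exp (-(n : ℤ)) := by
  choose b hb using fun v : S => exists_int_valued_sub_le (hx v.1 v.2) n
  obtain ⟨a, ha⟩ := IsDedekindDomain.exists_forall_sub_mem_ideal (s := S) (fun v => v.asIdeal) (fun _ => n)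
    (fun v _ => v.prime) (fun v _ w _ hvw h => hvw (HeightOneSpectrum.ext h)) b
  refine ⟨a, fun v hv => ?_⟩
  have h1 := (valued_algebraMap_int_le v _ n).2 (ha v hv)
  have h3 : x v - algebraMap (𝓞 K) _ a = (x v - algebraMap (𝓞 K) _ (b ⟨v, hv⟩)) - (algebraMap (𝓞 K) (v.adicCompletion K) (a - b ⟨v, hv⟩)) := by
    rw [map_sub]
    ring
  rw [h3]
  exact (Valuation.map_sub _ _ _).trans (max_le (hb ⟨v, hv⟩) h1)

theorem finite_valued_natCast_ne_one {M : ℕ} (hM : M ≠ 0) :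
    {v : FinPlace K | ¬ (Valued.v (M : v.adicCompletion K) = 1)}.Finite := by
  have h := HeightOneSpectrum.Support.finite (𝓞 K) ((M : K)⁻¹)
  refine h.subset fun v hv => ?_
  have h1 : Valued.v (M : v.adicCompletion K) ≤ 1 := natCast_mem (v.adicCompletionIntegers K) M
  have h2 : Valued.v (M : v.adicCompletion K) = v.valuation K (M : K) := by
    rw [← valued_algebraMap v (M : K), map_natCast (algebraMap K (v.adicCompletion K))]
  have h3 := lt_of_le_of_ne h1 hv
  rw [h2] at h3
  change 1 < v.valuation K (M : K)⁻¹
  rw [map_inv₀]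
  refine (one_lt_inv₀ (zero_lt_iff.2 ?_)).2 h3
  simpa using hM

theorem valued_natCast_ne_zero (v : FinPlace K) {M : ℕ} (hM : M ≠ 0) : Valued.v (M : v.adicCompletion K) ≠ 0 :=
  (Valuation.ne_zero_iff _).2 (Nat.cast_ne_zero.2 hM)

/-- The idele `x` is congruent to the integer `a` modulo `M`, at every finite place. -/
def CongrMod (M : ℕ) (x : Ideles K) (a : 𝓞 K) : Prop :=
  ∀ v : FinPlace K, Valued.v ((component v x : v.adicCompletion K) - algebraMap (𝓞 K) _ a) ≤
    Valued.v (M : v.adicCompletion K)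

/-- Only finitely many places divide M, and there the components are approximated simultaneously by
one integer. At all other places the condition is mere integrality. -/
theorem exists_congrMod {M : ℕ} (hM : M ≠ 0) {x : Ideles K} (hx : x ∈ unitIdeles K) : ∃ a, CongrMod M x a := by
  set S := (finite_valued_natCast_ne_one (K := K) hM).toFinset
  set n := S.sup fun v => (-WithZero.log (Valued.v (M : v.adicCompletion K))).toNat
  obtain ⟨a, ha⟩ := exists_int_forall_valued_sub_le S n (fun v => component v x) fun v _ => (hx v).le
  refine ⟨a, fun v => ?_⟩
  by_cases hv : v ∈ S
  · refine (ha v hv).trans ?_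
    rw [← WithZero.le_log_iff_exp_le (valued_natCast_ne_zero v hM)]
    have := Finset.le_sup (f := fun v : FinPlace K => (-WithZero.log (Valued.v (M : v.adicCompletion K))).toNat) hv
    lia
  · have hv' : Valued.v (M : v.adicCompletion K) = 1 := by simpa [S] using hv
    rw [hv']
    exact (v.adicCompletionIntegers K).sub_mem (show _ ∈ v.adicCompletionIntegers K from (hx v).le)
      (coe_mem_adicCompletionIntegers v a)

/-- The quotient a / M is integral at every finite place. -/
theorem dvd_of_forall_valued_le {M : ℕ} (hM : M ≠ 0) {a : 𝓞 K}
    (h : ∀ v : FinPlace K, Valued.v (algebraMap (𝓞 K) (v.adicCompletion K) a) ≤ Valued.v (M : v.adicCompletion K)) :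
    (M : 𝓞 K) ∣ a := by
  have hM0 : (M : K) ≠ 0 := Nat.cast_ne_zero.2 hM
  obtain ⟨b, hb⟩ := mem_integers_of_valuation_le_one (R := 𝓞 K) K ((a : K) / M) fun v => by
    have h1 := h v
    rw [IsScalarTower.algebraMap_apply (𝓞 K) K, valued_algebraMap,
      ← map_natCast (algebraMap K (v.adicCompletion K)), valued_algebraMap] at h1
    rw [map_div₀]
    exact div_le_one_of_le₀ h1 zero_le
  refine ⟨b, ?_⟩
  have h2 : (b : K) = (a : K) / M := hb
  apply FaithfulSMul.algebraMap_injective (𝓞 K) K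
  rw [map_mul, map_natCast]
  change (a : K) = M * (b : K)
  rw [h2]
  field_simp

theorem CongrMod.dvd_sub {M : ℕ} (hM : M ≠ 0) {x : Ideles K} {a b : 𝓞 K} (ha : CongrMod M x a) (hb : CongrMod M x b) :
    (M : 𝓞 K) ∣ a - b := by
  refine dvd_of_forall_valued_le hM fun v => ?_
  have h : algebraMap (𝓞 K) (v.adicCompletion K) (a - b) =
      ((component v x : v.adicCompletion K) - algebraMap (𝓞 K) _ b) - ((component v x : v.adicCompletion K) - algebraMap (𝓞 K) _ a) := by
    rw [map_sub]
    ring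
  rw [h]
  exact (Valuation.map_sub _ _ _).trans (max_le (hb v) (ha v))

theorem CongrMod.mul {M : ℕ} {x y : Ideles K} (hx : x ∈ unitIdeles K) {a b : 𝓞 K} (ha : CongrMod M x a)
    (hb : CongrMod M y b) : CongrMod M (x * y) (a * b) := by
  intro v
  have h : ((component v (x * y) : (v.adicCompletion K)ˣ) : v.adicCompletion K) - algebraMap (𝓞 K) _ (a * b) =
      (component v x : v.adicCompletion K) * ((component v y : v.adicCompletion K) - algebraMap (𝓞 K) _ b) +
      ((component v x : v.adicCompletion K) - algebraMap (𝓞 K) _ a) * algebraMap (𝓞 K) _ b := by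
    rw [map_mul, map_mul, Units.val_mul]
    ring
  rw [h]
  refine (Valuation.map_add _ _ _).trans (max_le ?_ ?_)
  · rw [map_mul]
    have h2 : Valued.v (component v x : v.adicCompletion K) = 1 := hx v
    rw [h2, one_mul]
    exact hb v
  · rw [map_mul]
    exact (mul_le_of_le_one_right' (valued_algebraMap_int v b ▸ v.intValuation_le_one b)).trans (ha v)

theorem congrMod_one (M : ℕ) : CongrMod M (1 : Ideles K) 1 := by
  intro v
  rw [map_one, map_one, Units.val_one, sub_self, map_zero]
  exact zero_le

theorem congrMod_principalIdele (M : ℕ) (u : (𝓞 K)ˣ) :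
    CongrMod M (principalIdele K (Units.map (algebraMap (𝓞 K) K) u)) u := by
  intro v
  rw [component_principalIdele, Units.coe_map, MonoidHom.coe_coe, ← IsScalarTower.algebraMap_apply, sub_self, map_zero]
  exact zero_le

/-- The sign of a nonzero integer, as an element of the unit circle. -/
def circleSign (k : ℤ) : Circle := if k = 1 then 1 else -1

theorem circleSign_mul {k l : ℤ} (hk : IsUnit k) (hl : IsUnit l) : circleSign (k * l) = circleSign k * circleSign l := by
  rcases Int.isUnit_iff.1 hk with rfl | rfl <;> rcases Int.isUnit_iff.1 hl with rfl | rfl <;> simp [circleSign]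

theorem circleSign_sq (k : ℤ) : circleSign k ^ 2 = 1 := by
  unfold circleSign
  split_ifs <;> simp

theorem circleSign_one : circleSign 1 = 1 := if_pos rfl

/-- An integer approximating x⁻¹ is an inverse of a modulo M. -/
theorem CongrMod.isUnit_apply {M : ℕ} (hM : M ≠ 0) {κ : 𝓞 K →* ℤ} (hκ : ∀ a b, (M : 𝓞 K) ∣ a - b → κ a = κ b)
    {x : Ideles K} (hx : x ∈ unitIdeles K) {a : 𝓞 K} (ha : CongrMod M x a) : IsUnit (κ a) := by
  obtain ⟨b, hb⟩ := exists_congrMod hM (inv_mem hx)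
  have h := ha.mul hx hb
  rw [mul_inv_cancel] at h
  have h2 := hκ _ _ (h.dvd_sub hM (congrMod_one M))
  rw [map_mul, map_one] at h2
  exact IsUnit.of_mul_eq_one _ h2

theorem exists_unit_of_principalIdele_mem {a : Kˣ} (ha : principalIdele K a ∈ unitIdeles K) :
    ∃ u : (𝓞 K)ˣ, a = Units.map (algebraMap (𝓞 K) K) u := by
  have h (a : Kˣ) (ha : principalIdele K a ∈ unitIdeles K) : ∃ b : 𝓞 K, (b : K) = a :=
    mem_integers_of_valuation_le_one (R := 𝓞 K) K _ fun v => by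
      have := ha v
      rw [← coe_component, component_principalIdele, valued_algebraMap] at this
      exact this.le
  obtain ⟨b, hb⟩ := h a ha
  obtain ⟨c, hc⟩ := h a⁻¹ (by rw [map_inv]; exact inv_mem ha)
  have hbc : b * c = 1 := by
    apply FaithfulSMul.algebraMap_injective (𝓞 K) K
    rw [map_mul, map_one]
    change (b : K) * (c : K) = 1
    rw [hb, hc, Units.mul_inv]
  refine ⟨⟨b, c, hbc, by rw [mul_comm, hbc]⟩, Units.ext hb.symm⟩

/-- Construction of quadratic idele class characters, for odd class number: a character of the integers
modulo `M` and a character at infinity extend if their product is trivial on units. -/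
theorem exists_ideleClassCharacter (hodd : Odd (classNumber K)) {M : ℕ} (hM : M ≠ 0) (κ : 𝓞 K →* ℤ)
    (hκ : ∀ a b, (M : 𝓞 K) ∣ a - b → κ a = κ b) (σ : (InfiniteAdeleRing K)ˣ →* Circle) (hσ : ∀ z, σ z ^ 2 = 1)
    (hσ' : {z | σ z = 1} ∈ nhds 1)
    (hu : ∀ u : (𝓞 K)ˣ, circleSign (κ u) * σ (infinitePart (principalIdele K (Units.map (algebraMap (𝓞 K) K) u))) = 1) :
    ∃ χ : ideleClassCharacters K, (∀ x, χ.1 x ^ 2 = 1) ∧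
      ∀ x ∈ unitIdeles K, ∀ a, CongrMod M x a → χ.1 x = circleSign (κ a) * σ (infinitePart x) := by
  choose a ha using fun x : unitIdeles K => exists_congrMod hM x.2
  let ψ : unitIdeles K →* Circle :=
    { toFun x := circleSign (κ (a x)) * σ (infinitePart x.1)
      map_one' := by
        rw [hκ _ _ ((ha 1).dvd_sub hM (congrMod_one M)), map_one, circleSign_one, one_mul]
        exact map_one _
      map_mul' x y := by
        rw [hκ _ _ ((ha (x * y)).dvd_sub hM ((ha x).mul x.2 (ha y))), map_mul,
          circleSign_mul ((ha x).isUnit_apply hM hκ x.2) ((ha y).isUnit_apply hM hκ y.2), Subgroup.coe_mul, map_mul, map_mul]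
        exact mul_mul_mul_comm _ _ _ _ }
  have hψ (x : unitIdeles K) (b : 𝓞 K) (hb : CongrMod M x.1 b) : ψ x = circleSign (κ b) * σ (infinitePart x.1) := by
    rw [← hκ _ _ ((ha x).dvd_sub hM hb)]
    rfl
  have hψ2 (x : unitIdeles K) : ψ x ^ 2 = 1 := by
    change (circleSign _ * σ _) ^ 2 = 1
    rw [mul_pow, circleSign_sq, hσ, one_mul]
  choose g hg using exists_pow_classNumber_mem (K := K)
  -- Two admissible generators differ by a global unit, on which ψ is trivial by `hu`. Any
  -- convenient b may therefore replace `g x` below.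
  have hwd (x : Ideles K) (b : Kˣ) (hb : (principalIdele K b)⁻¹ * x ^ classNumber K ∈ unitIdeles K) :
      ψ ⟨_, hb⟩ = ψ ⟨_, hg x⟩ := by
    have h1 : principalIdele K (b⁻¹ * g x) ∈ unitIdeles K := by
      have := mul_mem hb (inv_mem (hg x))
      rwa [mul_inv_rev, inv_inv, mul_assoc, mul_inv_cancel_left, ← map_inv, ← map_mul] at this
    obtain ⟨u, hu'⟩ := exists_unit_of_principalIdele_mem h1
    have h2 : ψ ⟨_, h1⟩ = 1 := by
      rw [hψ _ u (by simp only [hu']; exact congrMod_principalIdele M u)]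
      simp only [hu']
      exact hu u
    have h3 : (⟨_, hb⟩ : unitIdeles K) = ⟨_, h1⟩ * ⟨_, hg x⟩ := by
      ext1
      simp [mul_assoc]
    rw [h3, map_mul, h2, one_mul]
  let χ₀ : Ideles K →* Circle :=
    { toFun x := ψ ⟨_, hg x⟩
      map_one' := by
        have h : (principalIdele K 1)⁻¹ * 1 ^ classNumber K ∈ unitIdeles K := by simp
        rw [← hwd 1 1 h]
        convert map_one ψ
        simp
      map_mul' x y := by
        have h : (principalIdele K (g x * g y))⁻¹ * (x * y) ^ classNumber K ∈ unitIdeles K := by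
          convert mul_mem (hg x) (hg y) using 1
          rw [map_mul, mul_pow, mul_inv, mul_mul_mul_comm]
        rw [← hwd _ _ h, ← map_mul]
        congr 1
        ext1
        simp only [Subgroup.coe_mul]
        rw [map_mul, mul_pow, mul_inv, mul_mul_mul_comm] }
  -- On a unit idele the choice b = 1 gives ψ(x) ^ h, which is ψ(x) because h is odd and ψ has
  -- square 1.
  have hχU (x : unitIdeles K) : χ₀ x = ψ x := by
    have h : (principalIdele K 1)⁻¹ * (x : Ideles K) ^ classNumber K ∈ unitIdeles K := by simpa using pow_mem x.2 _
    change ψ _ = _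
    rw [← hwd x 1 h]
    have h2 : (⟨_, h⟩ : unitIdeles K) = x ^ classNumber K := by
      ext1
      simp
    obtain ⟨k, hk⟩ := hodd
    rw [h2, map_pow, hk, pow_succ, pow_mul, hψ2, one_pow, one_mul]
  -- Continuity at 1 suffices. Near 1 an idele is a unit idele congruent to 1 modulo M on which σ is
  -- trivial, so χ₀ is constant there.
  have hcont : Continuous χ₀ := by
    refine continuous_of_continuousAt_one χ₀ ?_
    rw [ContinuousAt, map_one]
    refine Filter.Tendsto.congr' ?_ tendsto_const_nhds
    have h2 : Filter.Tendsto (infinitePart (K := K)) (nhds 1) (nhds 1) := by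
      have := (Continuous.units_map (MonoidHom.fst (InfiniteAdeleRing K) (FiniteAdeleRing (𝓞 K) K)) continuous_fst).continuousAt (x := 1)
      rwa [ContinuousAt, map_one] at this
    filter_upwards [unitIdeles_congr_mem_nhds hM, h2 hσ'] with x hx hx'
    have h3 : σ (infinitePart x) = 1 := hx'
    have h4 := hχU ⟨x, hx.1⟩
    rw [hψ ⟨x, hx.1⟩ 1 (fun v => by rw [map_one]; exact hx.2 v), map_one, circleSign_one, one_mul] at h4
    exact (h4.trans h3).symm
  refine ⟨⟨⟨χ₀, hcont⟩, fun b => ?_⟩, fun x => hψ2 _, fun x hx b hb => (hχU ⟨x, hx⟩).trans (hψ _ b hb)⟩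
  -- For a principal idele b, the choice b ^ h makes the argument of ψ equal to 1.
  have h : (principalIdele K (b ^ classNumber K))⁻¹ * principalIdele K b ^ classNumber K ∈ unitIdeles K := by
    rw [map_pow, inv_mul_cancel]
    exact one_mem _
  change ψ _ = 1
  rw [← hwd _ _ h]
  convert map_one ψ
  simp

end QuadIdele

/-! ### Imaginary quadratic fields -/

namespace QuadIdele

/-- The norm from a quadratic algebra in terms of a basis `1, σ` with `σ ^ 2 = -D`. -/
theorem norm_eq_of_basis {F E : Type*} [Field F] [CommRing E] [Algebra F E] (b : Module.Basis (Fin 2) F E) (h₀ : b 0 = 1)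
    {D : F} (h₁ : b 1 * b 1 = algebraMap F E (-D)) (x y : F) :
    Algebra.norm F (algebraMap F E x + algebraMap F E y * b 1) = x ^ 2 + D * y ^ 2 := by
  have e₀ : (algebraMap F E x + algebraMap F E y * b 1) * b 0 = x • b 0 + y • b 1 := by
    rw [h₀, Algebra.smul_def, Algebra.smul_def]
    ring
  have e₁ : (algebraMap F E x + algebraMap F E y * b 1) * b 1 = (-D * y) • b 0 + x • b 1 := by
    rw [h₀, Algebra.smul_def, Algebra.smul_def, map_mul, add_mul, mul_assoc, h₁]
    ring
  rw [Algebra.norm_eq_matrix_det b, Matrix.det_fin_two]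
  simp only [Algebra.leftMulMatrix_eq_repr_mul, e₀, e₁]
  simp
  ring

/-- `K` is generated over `ℚ` by a square root `s` of `-d`, where `d` is squarefree. -/
structure IsSqrtGenerator {K : Type*} [Field K] [NumberField K] (d : ℕ) (s : K) : Prop where
  squarefree : Squarefree d
  sq : s ^ 2 = -(d : K)
  adjoin : IntermediateField.adjoin ℚ {s} = ⊤

namespace IsSqrtGenerator

variable {K : Type*} [Field K] [NumberField K] {d : ℕ} {s : K} (H : IsSqrtGenerator d s)
include H

theorem pos : 0 < d := Nat.pos_of_ne_zero H.squarefree.ne_zero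

theorem exists_eq (a : K) : ∃ x y : ℚ, a = algebraMap ℚ K x + algebraMap ℚ K y * s := by
  have h : a ∈ IntermediateField.adjoin ℚ {s} := H.adjoin ▸ IntermediateField.mem_top
  rw [← IntermediateField.mem_toSubalgebra, IntermediateField.adjoin_simple_toSubalgebra_of_isAlgebraic
    (Algebra.IsAlgebraic.isAlgebraic s)] at h
  induction h using Algebra.adjoin_induction with
  | mem x hx =>
    rw [Set.mem_singleton_iff] at hx
    exact ⟨0, 1, by simp [hx]⟩
  | algebraMap r => exact ⟨r, 0, by simp⟩
  | add a b _ _ ha hb =>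
    obtain ⟨x, y, rfl⟩ := ha
    obtain ⟨x', y', rfl⟩ := hb
    exact ⟨x + x', y + y', by simp only [map_add]; ring⟩
  | mul a b _ _ ha hb =>
    obtain ⟨x, y, rfl⟩ := ha
    obtain ⟨x', y', rfl⟩ := hb
    refine ⟨x * x' - d * (y * y'), x * y' + x' * y, ?_⟩
    simp only [map_add, map_mul, map_sub, map_natCast]
    linear_combination (algebraMap ℚ K y * algebraMap ℚ K y') * H.sq

/-- Multiplying by the conjugate gives x² + d y² = 0 with d positive. -/
theorem eq_zero {x y : ℚ} (h : algebraMap ℚ K x + algebraMap ℚ K y * s = 0) : x = 0 ∧ y = 0 := by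
  have h1 : algebraMap ℚ K (x ^ 2 + d * y ^ 2) = 0 := by
    simp only [map_add, map_mul, map_pow, map_natCast]
    linear_combination (algebraMap ℚ K x - algebraMap ℚ K y * s) * h + (algebraMap ℚ K y) ^ 2 * H.sq
  rw [map_eq_zero] at h1
  have hd : (0 : ℚ) < d := by exact_mod_cast H.pos
  have hx : x = 0 := by nlinarith [mul_nonneg hd.le (sq_nonneg y), sq_nonneg x]
  refine ⟨hx, ?_⟩
  rw [hx, map_zero, zero_add, mul_eq_zero, map_eq_zero] at h
  refine h.resolve_right ?_
  rintro rfl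
  have := H.sq
  rw [zero_pow two_ne_zero, zero_eq_neg] at this
  exact H.pos.ne' (by exact_mod_cast this)

/-- The basis `1, s` of `K`. -/
def basis : Module.Basis (Fin 2) ℚ K :=
  .mk (v := ![1, s]) (by
    rw [LinearIndependent.pair_iff]
    intro x y h
    rw [Algebra.smul_def, Algebra.smul_def, mul_one] at h
    exact H.eq_zero h) (by
    intro a _
    obtain ⟨x, y, rfl⟩ := H.exists_eq a
    rw [Matrix.range_cons, Matrix.range_cons, Matrix.range_empty, Set.union_empty, Set.singleton_union,
      Submodule.mem_span_pair]
    exact ⟨x, y, by simp [Algebra.smul_def]⟩)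

theorem basis_zero : H.basis 0 = 1 := by simp [basis]

theorem basis_one : H.basis 1 = s := by simp [basis]

theorem norm_eq (x y : ℚ) : Algebra.norm ℚ (algebraMap ℚ K x + algebraMap ℚ K y * s) = x ^ 2 + d * y ^ 2 := by
  have h := norm_eq_of_basis H.basis H.basis_zero (D := d) (by rw [H.basis_one, ← pow_two, H.sq]; simp) x y
  rwa [H.basis_one] at h

theorem exists_conj : ∃ c : K →ₐ[ℚ] K, c s = -s := by
  let f : K →ₗ[ℚ] K := H.basis.constr ℚ ![1, -s]
  have f1 : f 1 = 1 := by
    rw [← H.basis_zero, Module.Basis.constr_basis]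
    simp [H.basis_zero]
  have fs : f s = -s := by
    have : f (H.basis 1) = -s := by
      rw [Module.Basis.constr_basis]
      simp
    rwa [H.basis_one] at this
  have hf (x y : ℚ) : f (algebraMap ℚ K x + algebraMap ℚ K y * s) = algebraMap ℚ K x - algebraMap ℚ K y * s := by
    have e : algebraMap ℚ K x + algebraMap ℚ K y * s = x • (1 : K) + y • s := by simp [Algebra.smul_def]
    rw [e, map_add, map_smul, map_smul, f1, fs]
    simp [Algebra.smul_def, sub_eq_add_neg]
  refine ⟨AlgHom.ofLinearMap f f1 fun a b => ?_, fs⟩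
  obtain ⟨x, y, rfl⟩ := H.exists_eq a
  obtain ⟨x', y', rfl⟩ := H.exists_eq b
  have e : (algebraMap ℚ K x + algebraMap ℚ K y * s) * (algebraMap ℚ K x' + algebraMap ℚ K y' * s) =
      algebraMap ℚ K (x * x' - d * (y * y')) + algebraMap ℚ K (x * y' + x' * y) * s := by
    simp only [map_add, map_mul, map_sub, map_natCast]
    linear_combination (algebraMap ℚ K y * algebraMap ℚ K y') * H.sq
  rw [e, hf, hf, hf]
  simp only [map_add, map_mul, map_sub, map_natCast]
  linear_combination -(algebraMap ℚ K y * algebraMap ℚ K y') * H.sq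

/-- The nontrivial automorphism of `K`. -/
def conj : K ≃ₐ[ℚ] K :=
  AlgEquiv.ofAlgHom H.exists_conj.choose H.exists_conj.choose
    (AlgHom.ext fun a => by
      obtain ⟨x, y, rfl⟩ := H.exists_eq a
      simp [H.exists_conj.choose_spec])
    (AlgHom.ext fun a => by
      obtain ⟨x, y, rfl⟩ := H.exists_eq a
      simp [H.exists_conj.choose_spec])

theorem conj_s : H.conj s = -s := H.exists_conj.choose_spec

theorem conj_eq (x y : ℚ) :
    H.conj (algebraMap ℚ K x + algebraMap ℚ K y * s) = algebraMap ℚ K x - algebraMap ℚ K y * s := by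
  simp [H.conj_s, sub_eq_add_neg]

theorem conj_conj (a : K) : H.conj (H.conj a) = a := by
  obtain ⟨x, y, rfl⟩ := H.exists_eq a
  rw [conj_eq, map_sub, map_mul, H.conj_s]
  simp

theorem mul_conj (a : K) : a * H.conj a = algebraMap ℚ K (Algebra.norm ℚ a) := by
  obtain ⟨x, y, rfl⟩ := H.exists_eq a
  rw [H.norm_eq, H.conj_eq]
  simp only [map_add, map_mul, map_pow, map_natCast]
  linear_combination -(algebraMap ℚ K y) ^ 2 * H.sq

/-- The nontrivial automorphism on integers. -/
def conjInt : 𝓞 K ≃+* 𝓞 K := RingOfIntegers.mapRingEquiv H.conj.toRingEquiv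

theorem coe_conjInt (a : 𝓞 K) : (H.conjInt a : K) = H.conj a := rfl

theorem conjInt_conjInt (a : 𝓞 K) : H.conjInt (H.conjInt a) = a :=
  RingOfIntegers.ext (by rw [coe_conjInt, coe_conjInt, conj_conj])

theorem mul_conjInt (a : 𝓞 K) : a * H.conjInt a = (Algebra.norm ℤ a : ℤ) := by
  apply RingOfIntegers.ext
  change (a : K) * H.conj a = algebraMap (𝓞 K) K _
  rw [mul_conj, ← Algebra.coe_norm_int, map_intCast, map_intCast]

theorem norm_pos {a : K} (ha : a ≠ 0) : 0 < Algebra.norm ℚ a := by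
  obtain ⟨x, y, rfl⟩ := H.exists_eq a
  rw [H.norm_eq]
  have hd : (0 : ℚ) < d := by exact_mod_cast H.pos
  by_cases hy : y = 0
  · have hx : x ≠ 0 := by
      rintro rfl
      simp [hy] at ha
    positivity
  · positivity

/-- A real place would contain a square root of −d < 0. All infinite completions are thus complex
and closed under square roots, so quadratic characters have no archimedean part. -/
theorem isSquare_infinite (z : (InfiniteAdeleRing K)ˣ) : IsSquare z := by
  have hcx (v : InfinitePlace K) : v.IsComplex := by
    rw [← InfinitePlace.not_isReal_iff_isComplex]
    intro hv
    have h1 := congrArg (InfinitePlace.embedding_of_isReal hv) H.sq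
    rw [map_pow, map_neg, map_natCast] at h1
    have hd : (0 : ℝ) < d := by exact_mod_cast H.pos
    nlinarith [sq_nonneg (InfinitePlace.embedding_of_isReal hv s)]
  have h (v : InfinitePlace K) : ∃ y : v.Completion, y * y = (z : InfiniteAdeleRing K) v := by
    let e := InfinitePlace.Completion.ringEquivComplexOfIsComplex (hcx v)
    obtain ⟨y, hy⟩ := IsAlgClosed.exists_pow_nat_eq (e ((z : InfiniteAdeleRing K) v)) two_pos
    refine ⟨e.symm y, e.injective ?_⟩
    rw [map_mul, RingEquiv.apply_symm_apply, ← pow_two, hy]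
  choose y hy using h
  let y' : InfiniteAdeleRing K := y
  have hy' : y' * y' = z := funext hy
  have hu : IsUnit y' := isUnit_of_mul_isUnit_left (hy' ▸ z.isUnit)
  exact ⟨hu.unit, Units.ext hy'.symm⟩

end IsSqrtGenerator

/-- The quotient is rational and integral over ℤ. -/
theorem int_dvd_of_dvd {K : Type*} [Field K] [NumberField K] {m k : ℤ} (h : (m : 𝓞 K) ∣ (k : 𝓞 K)) : m ∣ k := by
  obtain ⟨e, he⟩ := h
  rcases eq_or_ne m 0 with rfl | hm
  · rw [Int.cast_zero, zero_mul, Int.cast_eq_zero] at he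
    rw [he]
  have hm' : (m : ℚ) ≠ 0 := by exact_mod_cast hm
  have h1 : (e : K) = algebraMap ℚ K ((k : ℚ) / m) := by
    have := congrArg (algebraMap (𝓞 K) K) he
    rw [map_intCast, map_mul, map_intCast] at this
    rw [map_div₀, map_intCast, map_intCast, this, mul_div_cancel_left₀]
    exact_mod_cast hm
  have h2 : IsIntegral ℤ ((k : ℚ) / m) := by
    rw [← isIntegral_algebraMap_iff (algebraMap ℚ K).injective, ← h1]
    exact e.2
  obtain ⟨y, hy⟩ := IsIntegrallyClosed.isIntegral_iff.1 h2
  refine ⟨y, ?_⟩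
  rw [eq_div_iff hm'] at hy
  have : (y : ℚ) * m = k := hy
  have h3 : y * m = k := by exact_mod_cast this
  rw [← h3, mul_comm]

/-- N a is a times its conjugate, and conjugation fixes M. Hence a ↦ χ(N a) depends only on a modulo
M. -/
theorem IsSqrtGenerator.dvd_norm_sub {K : Type*} [Field K] [NumberField K] {d : ℕ} {s : K} (H : IsSqrtGenerator d s) {M : ℕ} {a b : 𝓞 K}
    (h : (M : 𝓞 K) ∣ a - b) : (M : ℤ) ∣ Algebra.norm ℤ a - Algebra.norm ℤ b := by
  obtain ⟨e, he⟩ := h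
  apply int_dvd_of_dvd (K := K)
  rw [Int.cast_sub, ← H.mul_conjInt, ← H.mul_conjInt]
  have h2 : H.conjInt a - H.conjInt b = M * H.conjInt e := by
    rw [← map_sub, he, map_mul, map_natCast]
  refine ⟨e * H.conjInt a + b * H.conjInt e, ?_⟩
  push_cast
  linear_combination H.conjInt a * he + b * h2

end QuadIdele

/-! ### Local norms -/

namespace QuadIdele

section Local

variable (K L : Type*) [Field K] [NumberField K] [Field L] [NumberField L] [Algebra K L]
variable (v : FinPlace K) (w : FinPlace L) [w.asIdeal.LiesOver v.asIdeal]

theorem isScalarTower_completion : letI := completionAlgebra K L v w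
    IsScalarTower K (v.adicCompletion K) (w.adicCompletion L) := by
  let := completionAlgebra K L v w
  refine .of_algebraMap_eq fun y => ?_
  rw [RingHom.algebraMap_toAlgebra, completionMap_coe]
  exact IsScalarTower.algebraMap_apply K L _ y

theorem continuousSMul_completion : letI := completionAlgebra K L v w
    ContinuousSMul (v.adicCompletion K) (w.adicCompletion L) := by
  let := completionAlgebra K L v w
  exact ⟨((continuous_completionMap K L v w).comp continuous_fst).mul continuous_snd⟩

open scoped Valued in
theorem finite_completion : letI := completionAlgebra K L v w
    Module.Finite (v.adicCompletion K) (w.adicCompletion L) := by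
  let := completionAlgebra K L v w
  have := continuousSMul_completion K L v w
  have := isScalarTower_completion K L v w
  infer_instance

-- The norm is the determinant of a matrix whose entries are linear, hence continuous, in the
-- element.
open scoped Valued in
theorem continuous_localNorm : Continuous (localNorm K L v w) := by
  classical
  let := completionAlgebra K L v w
  have := continuousSMul_completion K L v w
  have := finite_completion K L v w
  have h : (localNorm K L v w : w.adicCompletion L → v.adicCompletion K) = fun y =>
      (Algebra.leftMulMatrix (Module.finBasis (v.adicCompletion K) (w.adicCompletion L)) y).det :=
    funext fun y => Algebra.norm_eq_matrix_det _ y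
  rw [h]
  refine Continuous.matrix_det ?_
  exact LinearMap.continuous_of_finiteDimensional
    (Algebra.leftMulMatrix (Module.finBasis (v.adicCompletion K) (w.adicCompletion L))).toLinearMap

variable {K L v w}

theorem valued_localNorm_le_one {x : w.adicCompletion L} (hx : Valued.v x ≤ 1) : Valued.v (localNorm K L v w x) ≤ 1 :=
  localNorm_mem_integers K L v w x hx

theorem valued_localNorm_eq_one {x : w.adicCompletion L} (hx : Valued.v x = 1) : Valued.v (localNorm K L v w x) = 1 := by
  have hx0 : x ≠ 0 := by
    rintro rfl
    simp at hx
  have h1 := valued_localNorm_le_one (K := K) (v := v) hx.le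
  have h2 := valued_localNorm_le_one (K := K) (v := v) (x := x⁻¹) (by rw [map_inv₀, hx, inv_one])
  have h3 : Valued.v (localNorm K L v w x) * Valued.v (localNorm K L v w x⁻¹) = 1 := by
    rw [← map_mul, ← map_mul, mul_inv_cancel₀ hx0, map_one, map_one]
  refine le_antisymm h1 ?_
  rw [← h3]
  exact mul_le_of_le_one_right' h2

theorem localNorm_completionMap (x : v.adicCompletion K) : ∃ n, 0 < n ∧ localNorm K L v w (completionMap K L v w x) = x ^ n := by
  let := completionAlgebra K L v w
  have := finite_completion K L v w
  exact ⟨Module.finrank (v.adicCompletion K) (w.adicCompletion L), Module.finrank_pos, Algebra.norm_algebraMap x⟩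

/-- Compatibility of the two valuations is extracted from the norm. If |ι x| ≥ 1, the norm of (ι
x)⁻¹ would be integral, although the norm of ι x is a positive power of x. -/
theorem valued_completionMap_lt_one {x : v.adicCompletion K} (hx : Valued.v x < 1) :
    Valued.v (completionMap K L v w x) < 1 := by
  by_contra! h
  obtain ⟨n, hn, h2⟩ := localNorm_completionMap (w := w) (L := L) x
  have hx0 : completionMap K L v w x ≠ 0 := by
    intro h3
    rw [h3, map_zero] at h
    exact not_le_of_gt zero_lt_one h
  have h3 := valued_localNorm_le_one (K := K) (v := v) (x := (completionMap K L v w x)⁻¹) (by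
    rw [map_inv₀]
    exact inv_le_one_of_one_le₀ h)
  have h4 : localNorm K L v w (completionMap K L v w x) * localNorm K L v w (completionMap K L v w x)⁻¹ = 1 := by
    rw [← map_mul, mul_inv_cancel₀ hx0, map_one]
  have h5 := congrArg Valued.v h4
  rw [map_mul, map_one, h2, map_pow] at h5
  have h6 : Valued.v x ^ n < 1 := pow_lt_one₀ zero_le hx hn.ne'
  have h7 : Valued.v x ^ n * Valued.v (localNorm K L v w (completionMap K L v w x)⁻¹) ≤ Valued.v x ^ n := mul_le_of_le_one_right' h3
  rw [h5] at h7
  exact not_le_of_gt h6 h7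

/-- Some power x ^ m is divisible by the image of a uniformizer π of K_v. Hence N(x) ^ m is an
integral multiple of a positive power of π. -/
theorem valued_localNorm_lt_one {x : w.adicCompletion L} (hx : Valued.v x < 1) : Valued.v (localNorm K L v w x) < 1 := by
  rcases eq_or_ne x 0 with rfl | hx0
  · let := completionAlgebra K L v w
    have := finite_completion K L v w
    have h : localNorm K L v w 0 = 0 := Algebra.norm_zero (R := v.adicCompletion K)
    rw [h, map_zero]
    exact zero_lt_one
  obtain ⟨π, hπ⟩ := valuedAdicCompletion_surjective K v (WithZero.exp (-1 : ℤ))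
  have hπ1 : Valued.v π < 1 := by
    rw [hπ, ← WithZero.exp_zero, WithZero.exp_lt_exp]
    lia
  have hπ0 : π ≠ 0 := by
    rintro rfl
    rw [map_zero] at hπ
    exact WithZero.exp_ne_zero hπ.symm
  obtain ⟨n, hn, h2⟩ := localNorm_completionMap (w := w) (L := L) π
  have hι0 : completionMap K L v w π ≠ 0 := (map_ne_zero _).2 hπ0
  obtain ⟨m, hm⟩ : ∃ m : ℕ, Valued.v x ^ m ≤ Valued.v (completionMap K L v w π) := by
    have hvx : Valued.v x ≠ 0 := (Valuation.ne_zero_iff _).2 hx0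
    have hvι : Valued.v (completionMap K L v w π) ≠ 0 := (Valuation.ne_zero_iff _).2 hι0
    refine ⟨(-WithZero.log (Valued.v (completionMap K L v w π))).toNat, ?_⟩
    rw [← WithZero.exp_log hvx, ← WithZero.exp_zero, WithZero.exp_lt_exp] at hx
    rw [← WithZero.log_le_log (pow_ne_zero _ hvx) hvι, WithZero.log_pow]
    rw [nsmul_eq_mul]
    have h1 : (((-WithZero.log (Valued.v (completionMap K L v w π))).toNat : ℕ) : ℤ) * (WithZero.log (Valued.v x)) ≤
        (((-WithZero.log (Valued.v (completionMap K L v w π))).toNat : ℕ) : ℤ) * (-1) := by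
      refine mul_le_mul_of_nonneg_left (by lia) (by lia)
    refine h1.trans ?_
    lia
  have h3 := valued_localNorm_le_one (K := K) (v := v) (x := x ^ m * (completionMap K L v w π)⁻¹) (by
    rw [map_mul, map_pow, map_inv₀]
    exact mul_inv_le_one_of_le₀ hm zero_le)
  have h4 : localNorm K L v w (x ^ m) = localNorm K L v w (x ^ m * (completionMap K L v w π)⁻¹) * π ^ n := by
    rw [← h2, ← map_mul, inv_mul_cancel_right₀ hι0]
  have h5 := congrArg Valued.v h4
  rw [map_pow, map_pow, map_mul, map_pow] at h5
  have h6 : Valued.v (localNorm K L v w x) ^ m < 1 := by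
    rw [h5]
    exact (mul_le_of_le_one_left' h3).trans_lt (pow_lt_one₀ zero_le hπ1 hn.ne')
  by_contra! h
  exact not_le_of_gt h6 (one_le_pow₀ h)

/-- An integer lying in w₁ but not in w₂ has a non-unit norm at w₁ and a unit norm at w₂. Places
above v can thus be identified by their norm functions on L. -/
theorem exists_localNorm_ne {w₁ w₂ : FinPlace L} [w₁.asIdeal.LiesOver v.asIdeal] [w₂.asIdeal.LiesOver v.asIdeal] (h : w₁ ≠ w₂) :
    ∃ a : L, localNorm K L v w₁ (algebraMap L _ a) ≠ localNorm K L v w₂ (algebraMap L _ a) := by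
  obtain ⟨a, ha₁, ha₂⟩ : ∃ a, a ∈ w₁.asIdeal ∧ a ∉ w₂.asIdeal := by
    by_contra! hle
    exact h (HeightOneSpectrum.ext (w₁.isMaximal.eq_of_le w₂.isPrime.ne_top hle))
  refine ⟨a, fun h2 => ?_⟩
  have h3 := valued_localNorm_lt_one (K := K) (v := v) (w := w₁) (x := algebraMap L _ (a : L)) (by
    rw [valued_algebraMap]
    exact (valuation_lt_one_iff_mem w₁ a).2 ha₁)
  have h4 := valued_localNorm_eq_one (K := K) (v := v) (w := w₂) (x := algebraMap L _ (a : L)) (by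
    rw [valued_algebraMap]
    exact valuation_eq_one_iff_notMem w₂ |>.2 ha₂)
  rw [h2, h4] at h3
  exact lt_irrefl _ h3

end Local

/-! ### Local norms of an imaginary quadratic field, and conjugate places. -/

namespace IsSqrtGenerator

variable {K : Type*} [Field K] [NumberField K] {d : ℕ} {s : K} (H : IsSqrtGenerator d s)
variable (v : FinPlace ℚ) (w : FinPlace K) [w.asIdeal.LiesOver v.asIdeal]
include H

-- The span of 1 and s over ℚ_v is finite-dimensional, hence closed, and contains the dense subfield
-- K.
open scoped Valued in
theorem exists_eq_local (z : w.adicCompletion K) : ∃ x y : v.adicCompletion ℚ,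
    z = completionMap ℚ K v w x + completionMap ℚ K v w y * algebraMap K _ s := by
  let := completionAlgebra ℚ K v w
  have := continuousSMul_completion ℚ K v w
  let S : Submodule (v.adicCompletion ℚ) (w.adicCompletion K) := Submodule.span _ {1, algebraMap K _ s}
  have hfin : FiniteDimensional (v.adicCompletion ℚ) S := FiniteDimensional.span_of_finite _ (Set.toFinite _)
  have hcl : IsClosed (S : Set (w.adicCompletion K)) := S.closed_of_finiteDimensional
  have hd : Dense (S : Set (w.adicCompletion K)) := by
    refine (denseRange_algebraMap K w).mono ?_
    rintro _ ⟨a, rfl⟩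
    obtain ⟨x, y, rfl⟩ := H.exists_eq a
    rw [SetLike.mem_coe, Submodule.mem_span_pair]
    refine ⟨(Rat.cast x : v.adicCompletion ℚ), (Rat.cast y : v.adicCompletion ℚ), ?_⟩
    rw [Algebra.smul_def, Algebra.smul_def, mul_one, RingHom.algebraMap_toAlgebra]
    simp only [map_add, map_mul, map_ratCast, eq_ratCast]
  have hz : z ∈ S := by
    rw [← SetLike.mem_coe, ← hcl.closure_eq, hd.closure_eq]
    exact Set.mem_univ z
  obtain ⟨x, y, h⟩ := Submodule.mem_span_pair.1 hz
  refine ⟨x, y, ?_⟩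
  rw [← h, Algebra.smul_def, Algebra.smul_def, mul_one]
  rfl

/-- Once s comes from ℚ_v, the local extension has degree one and the norm inverts the embedding. -/
theorem localNorm_of_eq {t : v.adicCompletion ℚ} (ht : algebraMap K (w.adicCompletion K) s = completionMap ℚ K v w t) (x y : ℚ) :
    localNorm ℚ K v w (algebraMap K _ (algebraMap ℚ K x + algebraMap ℚ K y * s)) = (Rat.cast x : v.adicCompletion ℚ) + (Rat.cast y : v.adicCompletion ℚ) * t := by
  let := completionAlgebra ℚ K v w
  have hrank : Module.finrank (v.adicCompletion ℚ) (w.adicCompletion K) = 1 := by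
    refine finrank_eq_one (1 : w.adicCompletion K) one_ne_zero fun z => ?_
    obtain ⟨x, y, rfl⟩ := H.exists_eq_local v w z
    refine ⟨x + y * t, ?_⟩
    rw [Algebra.smul_def, mul_one, ht]
    change completionMap ℚ K v w _ = _
    rw [map_add, map_mul]
  have h : algebraMap K (w.adicCompletion K) (algebraMap ℚ K x + algebraMap ℚ K y * s) =
      completionMap ℚ K v w ((Rat.cast x : v.adicCompletion ℚ) + (Rat.cast y : v.adicCompletion ℚ) * t) := by
    simp only [map_add, map_mul, map_ratCast, eq_ratCast, ht]
  rw [h]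
  change Algebra.norm _ (algebraMap _ _ _) = _
  rw [Algebra.norm_algebraMap, hrank, pow_one]

/-- When −d is not a local square, 1 and s stay independent over ℚ_v, so the local norm form is the
global one. -/
theorem localNorm_of_not_isSquare (ht : ∀ t : v.adicCompletion ℚ, t ^ 2 ≠ -(d : v.adicCompletion ℚ)) (a : K) :
    localNorm ℚ K v w (algebraMap K _ a) = (Rat.cast (Algebra.norm ℚ a) : v.adicCompletion ℚ) := by
  let := completionAlgebra ℚ K v w
  have hσ : algebraMap K (w.adicCompletion K) s ^ 2 = -(d : w.adicCompletion K) := by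
    rw [← map_pow, H.sq, map_neg, map_natCast]
  have hli : LinearIndependent (v.adicCompletion ℚ) ![(1 : w.adicCompletion K), algebraMap K _ s] := by
    rw [LinearIndependent.pair_iff]
    intro x y hxy
    have hxy : completionMap ℚ K v w x + completionMap ℚ K v w y * algebraMap K _ s = 0 := by
      rw [Algebra.smul_def, Algebra.smul_def, mul_one] at hxy
      exact hxy
    by_cases hy : y = 0
    · refine ⟨?_, hy⟩
      rw [hy, map_zero, zero_mul, add_zero, map_eq_zero] at hxy
      exact hxy
    · refine absurd ?_ (ht (x / y))
      apply (completionMap ℚ K v w).injective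
      have hy' : completionMap ℚ K v w y ≠ 0 := (map_ne_zero _).2 hy
      rw [map_pow, map_div₀, map_neg, map_natCast, ← hσ, div_pow, div_eq_iff (pow_ne_zero 2 hy')]
      linear_combination (completionMap ℚ K v w x - completionMap ℚ K v w y * algebraMap K _ s) * hxy
  let b : Module.Basis (Fin 2) (v.adicCompletion ℚ) (w.adicCompletion K) := .mk hli (by
    intro z _
    obtain ⟨x, y, rfl⟩ := H.exists_eq_local v w z
    rw [Matrix.range_cons, Matrix.range_cons, Matrix.range_empty, Set.union_empty, Set.singleton_union,
      Submodule.mem_span_pair]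
    exact ⟨x, y, by rw [Algebra.smul_def, Algebra.smul_def, mul_one]; rfl⟩)
  have hb0 : b 0 = 1 := by simp [b]
  have hb1 : b 1 = algebraMap K _ s := by simp [b]
  obtain ⟨x, y, rfl⟩ := H.exists_eq a
  have h := norm_eq_of_basis b hb0 (D := (d : v.adicCompletion ℚ)) (by rw [hb1, ← pow_two, hσ]; simp)
    ((Rat.cast x : v.adicCompletion ℚ)) ((Rat.cast y : v.adicCompletion ℚ))
  rw [H.norm_eq]
  push_cast
  rw [← h, hb1]
  change Algebra.norm _ _ = _
  congr 1
  change _ = completionMap ℚ K v w _ + completionMap ℚ K v w _ * _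
  simp only [map_ratCast, eq_ratCast]

/-- The conjugate of a finite place. -/
def conjPlace (w : FinPlace K) : FinPlace K where
  asIdeal := w.asIdeal.comap H.conjInt
  isPrime := Ideal.comap_isPrime _ _
  ne_bot := by
    obtain ⟨a, ha, ha0⟩ := Submodule.exists_mem_ne_zero_of_ne_bot w.ne_bot
    refine (Submodule.ne_bot_iff _).2 ⟨H.conjInt a, ?_, ?_⟩
    · rw [Ideal.mem_comap, H.conjInt_conjInt]
      exact ha
    · exact (map_ne_zero_iff _ H.conjInt.injective).2 ha0

theorem mem_conjPlace {w : FinPlace K} {a : 𝓞 K} : a ∈ (H.conjPlace w).asIdeal ↔ H.conjInt a ∈ w.asIdeal := Iff.rfl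

instance conjPlace_liesOver : (H.conjPlace w).asIdeal.LiesOver v.asIdeal := by
  constructor
  ext a
  have h : a ∈ v.asIdeal ↔ algebraMap (𝓞 ℚ) (𝓞 K) a ∈ w.asIdeal := by
    rw [Ideal.LiesOver.over (p := v.asIdeal) (P := w.asIdeal)]
    rfl
  rw [h]
  change _ ↔ algebraMap (𝓞 ℚ) (𝓞 K) a ∈ (H.conjPlace w).asIdeal
  rw [mem_conjPlace]
  have h2 : H.conjInt (algebraMap (𝓞 ℚ) (𝓞 K) a) = algebraMap (𝓞 ℚ) (𝓞 K) a := by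
    apply RingOfIntegers.ext
    exact H.conj.commutes _
  rw [h2]

theorem valuation_conj_le_one {w : FinPlace K} (hw : H.conjPlace w = w) {b : K} (hb : w.valuation K b ≤ 1) :
    w.valuation K (H.conj b) ≤ 1 := by
  obtain ⟨n, D, h⟩ := exists_primeCompl_mul_eq_of_integer w b hb
  have h1 : H.conj b * (H.conjInt D.1 : K) = (H.conjInt n : K) := by
    rw [coe_conjInt, coe_conjInt, ← map_mul]
    exact congrArg H.conj h
  have h2 : w.valuation K (H.conjInt D.1 : K) = 1 := by
    refine valuation_eq_one_iff_notMem w |>.2 ?_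
    rw [← mem_conjPlace, hw]
    exact D.2
  have h3 := congrArg (w.valuation K) h1
  rw [map_mul, h2, mul_one] at h3
  rw [h3]
  exact valuation_le_one w (H.conjInt n)

/-- For a rational x close to t, the element b = (s − x) / (s + x) is small at w and its conjugate
is b⁻¹. A place stable under conjugation would make b⁻¹ integral too. -/
theorem conjPlace_ne {t : v.adicCompletion ℚ} (ht2 : t ^ 2 = -(d : v.adicCompletion ℚ))
    (ht : algebraMap K (w.adicCompletion K) s = completionMap ℚ K v w t) : H.conjPlace w ≠ w := by
  intro hw
  have ht0 : t ≠ 0 := by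
    rintro rfl
    rw [zero_pow two_ne_zero, zero_eq_neg] at ht2
    exact H.pos.ne' (by exact_mod_cast ht2)
  -- With this precision t − x is smaller than 2t, so t + x keeps the absolute value of 2t.
  obtain ⟨n, hn⟩ : ∃ n : ℕ, WithZero.exp (-(n : ℤ)) < Valued.v (2 * t) := by
    have h0 : Valued.v (2 * t) ≠ 0 := (Valuation.ne_zero_iff _).2 (mul_ne_zero two_ne_zero ht0)
    refine ⟨(1 - WithZero.log (Valued.v (2 * t))).toNat, ?_⟩
    rw [← WithZero.lt_log_iff_exp_lt h0]
    lia
  obtain ⟨x, hx⟩ := (denseRange_algebraMap ℚ v).mem_nhds (mem_nhds_adicCompletion.2 ⟨n, subset_rfl⟩ :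
    {y | Valued.v (y - t) ≤ WithZero.exp (-(n : ℤ))} ∈ nhds t)
  rw [eq_ratCast] at hx
  have hx1 : Valued.v ((Rat.cast x : v.adicCompletion ℚ) - t) < Valued.v (2 * t) := lt_of_le_of_lt (show Valued.v ((Rat.cast x : v.adicCompletion ℚ) - t) ≤ _ from hx) hn
  have hx2 : Valued.v (t + (Rat.cast x : v.adicCompletion ℚ)) = Valued.v (2 * t) := by
    have : t + (Rat.cast x : v.adicCompletion ℚ) = 2 * t + ((Rat.cast x : v.adicCompletion ℚ) - t) := by ring
    rw [this]
    exact Valuation.map_add_eq_of_lt_left _ hx1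
  have hr : Valued.v ((t - (Rat.cast x : v.adicCompletion ℚ)) / (t + (Rat.cast x : v.adicCompletion ℚ))) < 1 := by
    rw [map_div₀, hx2, Valuation.map_sub_swap, div_lt_one₀]
    · exact hx1
    · exact zero_le.trans_lt hx1
  have hb := valued_completionMap_lt_one (L := K) (w := w) hr
  have hb2 : completionMap ℚ K v w ((t - (Rat.cast x : v.adicCompletion ℚ)) / (t + (Rat.cast x : v.adicCompletion ℚ))) =
      algebraMap K _ ((s - algebraMap ℚ K x) / (s + algebraMap ℚ K x)) := by
    simp only [map_div₀, map_sub, map_add, map_ratCast, eq_ratCast, ht]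
  rw [hb2, valued_algebraMap] at hb
  have hs1 : s - algebraMap ℚ K x ≠ 0 := by
    intro h
    have := (H.eq_zero (x := -x) (y := 1) (by rw [← h, map_neg, map_one]; ring)).2
    exact one_ne_zero this
  have hs2 : s + algebraMap ℚ K x ≠ 0 := by
    intro h
    have := (H.eq_zero (x := x) (y := 1) (by rw [← h, map_one]; ring)).2
    exact one_ne_zero this
  have hc := H.valuation_conj_le_one hw hb.le
  have hc2 : H.conj ((s - algebraMap ℚ K x) / (s + algebraMap ℚ K x)) = ((s - algebraMap ℚ K x) / (s + algebraMap ℚ K x))⁻¹ := by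
    rw [map_div₀, map_sub, map_add, H.conj_s, AlgEquiv.commutes, inv_div]
    have hs3 : -s + algebraMap ℚ K x ≠ 0 := by
      intro h
      exact hs1 (by linear_combination -h)
    field_simp
    ring
  rw [hc2, map_inv₀] at hc
  refine absurd hb (not_lt_of_ge ?_)
  refine (inv_le_one₀ (zero_lt_iff.2 ((Valuation.ne_zero_iff _).2 ?_))).1 hc
  exact div_ne_zero hs1 hs2

end IsSqrtGenerator

end QuadIdele

/-! ### The idele norm -/

namespace QuadIdele

theorem exists_place_liesOver (K : Type*) [Field K] [NumberField K] (v : FinPlace ℚ) :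
    Nonempty (PlacesAbove ℚ K v) := by
  obtain ⟨P, hP, hP2⟩ := (inferInstance : Nonempty (v.asIdeal.primesOver (𝓞 K)))
  exact ⟨⟨⟨P, hP, Ideal.ne_bot_of_mem_primesOver v.ne_bot ⟨hP, hP2⟩⟩, hP2⟩⟩

namespace IsSqrtGenerator

variable {K : Type*} [Field K] [NumberField K] {d : ℕ} {s : K} (H : IsSqrtGenerator d s)
include H

/-- The global norm is the product of the local norms at the places above a finite place of `ℚ`. -/
theorem prod_localNorm (v : FinPlace ℚ) (a : K) :
    ∏ w : PlacesAbove ℚ K v, (haveI := w.2; localNorm ℚ K v w.1 (algebraMap K _ a)) =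
      (Rat.cast (Algebra.norm ℚ a) : v.adicCompletion ℚ) := by
  classical
  obtain ⟨w⟩ := exists_place_liesOver K v
  by_cases hsq : ∃ t : v.adicCompletion ℚ, t ^ 2 = -(d : v.adicCompletion ℚ)
  · obtain ⟨t, ht⟩ := hsq
    have hσ (w : PlacesAbove ℚ K v) : haveI := w.2
        algebraMap K (w.1.adicCompletion K) s = completionMap ℚ K v w.1 t ∨
        algebraMap K (w.1.adicCompletion K) s = completionMap ℚ K v w.1 (-t) := by
      have := w.2
      rw [map_neg, ← sq_eq_sq_iff_eq_or_eq_neg, ← map_pow, ← map_pow, ht, H.sq, map_neg, map_neg, map_natCast, map_natCast]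
    -- The preimage of s in ℚ_v determines the local norm on K, and distinct places have distinct
    -- norms there.
    have huniq (t : v.adicCompletion ℚ) (w w' : PlacesAbove ℚ K v) (hw : haveI := w.2
        algebraMap K (w.1.adicCompletion K) s = completionMap ℚ K v w.1 t) (hw' : haveI := w'.2
        algebraMap K (w'.1.adicCompletion K) s = completionMap ℚ K v w'.1 t) : w = w' := by
      have := w.2
      have := w'.2
      by_contra hne
      obtain ⟨b, hb⟩ := exists_localNorm_ne (K := ℚ) (v := v) (w₁ := w.1) (w₂ := w'.1) (fun h => hne (Subtype.ext h))
      apply hb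
      obtain ⟨x, y, rfl⟩ := H.exists_eq b
      rw [H.localNorm_of_eq v w.1 hw, H.localNorm_of_eq v w'.1 hw']
    obtain ⟨t, ht, htw⟩ : ∃ t : v.adicCompletion ℚ, t ^ 2 = -(d : v.adicCompletion ℚ) ∧
        (haveI := w.2; algebraMap K (w.1.adicCompletion K) s = completionMap ℚ K v w.1 t) ∧
        ∀ w : PlacesAbove ℚ K v, haveI := w.2
        algebraMap K (w.1.adicCompletion K) s = completionMap ℚ K v w.1 t ∨
        algebraMap K (w.1.adicCompletion K) s = completionMap ℚ K v w.1 (-t) := by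
      rcases hσ w with h | h
      · exact ⟨t, ht, h, hσ⟩
      · refine ⟨-t, by rw [neg_sq, ht], h, fun w => ?_⟩
        rw [neg_neg]
        exact (hσ w).symm
    obtain ⟨htw, hσ⟩ := htw
    have := w.2
    have hc := H.conjPlace_liesOver v w.1
    let w' : PlacesAbove ℚ K v := ⟨H.conjPlace w.1, hc⟩
    have hne : w ≠ w' := fun h => H.conjPlace_ne v w.1 ht htw (congrArg Subtype.val h).symm
    have htw' := (hσ w').resolve_left fun h => hne (huniq t w w' htw h)
    -- There are exactly two places: s is t at w and −t at its conjugate. The product of local norms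
    -- is then (x + y t)(x − y t).
    have huniv : (Finset.univ : Finset (PlacesAbove ℚ K v)) = {w, w'} := by
      ext w''
      simp only [Finset.mem_univ, Finset.mem_insert, Finset.mem_singleton, true_iff]
      rcases hσ w'' with h | h
      · exact Or.inl (huniq t _ _ h htw)
      · exact Or.inr (huniq (-t) _ _ h htw')
    rw [huniv, Finset.prod_pair hne]
    obtain ⟨x, y, rfl⟩ := H.exists_eq a
    rw [H.localNorm_of_eq v w.1 htw, H.localNorm_of_eq v w'.1 htw', H.norm_eq]
    push_cast
    linear_combination -(Rat.cast y : v.adicCompletion ℚ) ^ 2 * ht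
  · push Not at hsq
    -- Without a local square root all places above v share the same norm on K, so there is only
    -- one.
    have hsub (w' : PlacesAbove ℚ K v) : w' = w := by
      have := w.2
      have := w'.2
      by_contra hne
      obtain ⟨b, hb⟩ := exists_localNorm_ne (K := ℚ) (v := v) (w₁ := w'.1) (w₂ := w.1) (fun h => hne (Subtype.ext h))
      apply hb
      rw [H.localNorm_of_not_isSquare v w.1 hsq, H.localNorm_of_not_isSquare v w'.1 hsq]
    rw [Fintype.prod_eq_single w fun w' h => absurd (hsub w') h]
    have := w.2
    exact H.localNorm_of_not_isSquare v w.1 hsq a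

end IsSqrtGenerator

variable {K : Type*} [Field K] [NumberField K]

theorem component_ideleNorm (v : FinPlace ℚ) (x : Ideles K) :
    (component v (ideleNorm ℚ K x) : v.adicCompletion ℚ) =
      ∏ w : PlacesAbove ℚ K v, (haveI := w.2; localNorm ℚ K v w.1 (component w.1 x)) := rfl

theorem ideleNorm_mem_unitIdeles {x : Ideles K} (hx : x ∈ unitIdeles K) : ideleNorm ℚ K x ∈ unitIdeles ℚ := by
  intro v
  rw [← coe_component, component_ideleNorm, map_prod]
  refine Finset.prod_eq_one fun w _ => ?_
  have := w.2
  exact valued_localNorm_eq_one (hx w.1)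

theorem isSquare_infinitePart_ideleNorm (hc : ∀ z : (InfiniteAdeleRing K)ˣ, IsSquare z) (x : Ideles K) :
    IsSquare (infinitePart (ideleNorm ℚ K x)) := by
  have h : infinitePart (ideleNorm ℚ K x) = Units.map (infiniteAdeleNorm ℚ K) (infinitePart x) := rfl
  rw [h]
  exact (hc _).map _

theorem isSquare_infinitePart_principalIdele {q : ℚˣ} (hq : 0 < (q : ℚ)) : IsSquare (infinitePart (principalIdele ℚ q)) := by
  have hre (v : InfinitePlace ℚ) : v.IsReal := by
    rw [Subsingleton.elim v Rat.infinitePlace]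
    exact Rat.isReal_infinitePlace
  let z := infinitePart (principalIdele ℚ q)
  have h (v : InfinitePlace ℚ) : ∃ y : v.Completion, y * y = (z : InfiniteAdeleRing ℚ) v := by
    let e := InfinitePlace.Completion.ringEquivRealOfIsReal (hre v)
    have he : e ((z : InfiniteAdeleRing ℚ) v) = ((q : ℚ) : ℝ) := by
      have h : (z : InfiniteAdeleRing ℚ) v = algebraMap ℚ v.Completion q := rfl
      rw [h]
      exact map_ratCast (e.toRingHom.comp (algebraMap ℚ v.Completion)) (q : ℚ)
    refine ⟨e.symm (Real.sqrt (q : ℚ)), e.injective ?_⟩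
    rw [map_mul, RingEquiv.apply_symm_apply, he]
    exact Real.mul_self_sqrt (by exact_mod_cast hq.le)
  choose y hy using h
  let y' : InfiniteAdeleRing ℚ := y
  have hy' : y' * y' = z := funext hy
  have hu : IsUnit y' := isUnit_of_mul_isUnit_left (hy' ▸ z.isUnit)
  exact ⟨hu.unit, Units.ext hy'.symm⟩

namespace IsSqrtGenerator

variable {d : ℕ} {s : K} (H : IsSqrtGenerator d s)
include H

theorem component_ideleNorm_principalIdele (v : FinPlace ℚ) (a : Kˣ) :
    component v (ideleNorm ℚ K (principalIdele K a)) =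
      component v (principalIdele ℚ (Units.map (Algebra.norm ℚ) a)) := by
  refine Units.ext ?_
  rw [component_ideleNorm, component_principalIdele]
  refine (H.prod_localNorm v (a : K)).trans ?_
  exact (eq_ratCast (_ : ℚ →+* v.adicCompletion ℚ) _).symm

/-- A character of the ideles of `ℚ` of order two, trivial on principal ideles, is trivial on norms of
principal ideles of an imaginary quadratic field. -/
theorem character_ideleNorm_principalIdele (ν : Ideles ℚ →* Circle) (hν : ∀ x, ν x ^ 2 = 1)
    (hν' : ∀ q, ν (principalIdele ℚ q) = 1) (a : Kˣ) : ν (ideleNorm ℚ K (principalIdele K a)) = 1 := by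
  set x := ideleNorm ℚ K (principalIdele K a)
  set y := principalIdele ℚ (Units.map (Algebra.norm ℚ) a)
  -- The finite components agree by `prod_localNorm`, so only infinity can differ; the infinite norm
  -- need not be computed.
  have h : x = y * infiniteIdele (infinitePart x * (infinitePart y)⁻¹) := by
    refine ideles_ext ?_ fun v => ?_
    · have h1 : infinitePart x = infinitePart y * (infinitePart x * (infinitePart y)⁻¹) := by
        rw [mul_comm (infinitePart x), mul_inv_cancel_left]
      exact congrArg Units.val h1
    · rw [map_mul]
      have h1 : component v (infiniteIdele (infinitePart x * (infinitePart y)⁻¹)) = 1 := rfl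
      rw [h1, mul_one]
      exact H.component_ideleNorm_principalIdele v a
  -- Both infinite parts are squares, one as the norm of a square, the other as a positive rational.
  obtain ⟨z, hz⟩ : IsSquare (infinitePart x * (infinitePart y)⁻¹) := by
    refine (isSquare_infinitePart_ideleNorm H.isSquare_infinite _).mul (IsSquare.inv ?_)
    exact isSquare_infinitePart_principalIdele (H.norm_pos a.ne_zero)
  rw [h, map_mul, hν', hz, map_mul, map_mul, ← pow_two, hν, one_mul]

/-- A global integer b approximates x so closely at the places above v that continuity brings N b
close to N x. The norm of b is global by `prod_localNorm`, and b ≡ a modulo M passes to norms. -/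
theorem congrMod_ideleNorm {M : ℕ} (hM : M ≠ 0) {x : Ideles K} (hx : x ∈ unitIdeles K) {a : 𝓞 K} (ha : CongrMod M x a) :
    CongrMod M (ideleNorm ℚ K x) ((Algebra.norm ℤ a : ℤ) : 𝓞 ℚ) := by
  classical
  intro v
  have hcont : Continuous fun y : ∀ w : PlacesAbove ℚ K v, w.1.adicCompletion K =>
      ∏ w : PlacesAbove ℚ K v, (haveI := w.2; localNorm ℚ K v w.1 (y w)) :=
    continuous_finsetProd _ fun w _ => by
      have := w.2
      exact (continuous_localNorm ℚ K v w.1).comp (continuous_apply w)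
  obtain ⟨m, hm⟩ : ∃ m : ℕ, WithZero.exp (-(m : ℤ)) ≤ Valued.v (M : v.adicCompletion ℚ) := by
    refine ⟨(-WithZero.log (Valued.v (M : v.adicCompletion ℚ))).toNat, ?_⟩
    rw [← WithZero.le_log_iff_exp_le (valued_natCast_ne_zero v hM)]
    lia
  have hnhds := (hcont.continuousAt (x := fun w : PlacesAbove ℚ K v => (component w.1 x : w.1.adicCompletion K))).preimage_mem_nhds
    (mem_nhds_adicCompletion.2 ⟨m, subset_rfl⟩)
  rw [nhds_pi, Filter.mem_pi'] at hnhds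
  obtain ⟨I, t, ht, hIt⟩ := hnhds
  choose n hn using fun w => mem_nhds_adicCompletion.1 (ht w)
  set S := (finite_valued_natCast_ne_one (K := K) hM).toFinset
  set N := S.sup fun v => (-WithZero.log (Valued.v (M : v.adicCompletion K))).toNat
  obtain ⟨b, hb⟩ := exists_int_forall_valued_sub_le (S ∪ Finset.univ.image (fun w : PlacesAbove ℚ K v => w.1)) (max N (I.sup n))
    (fun v => component v x) fun v _ => (hx v).le
  have hbM : CongrMod M x b := by
    intro w
    by_cases hw : w ∈ S
    · refine (hb w (Finset.mem_union_left _ hw)).trans ?_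
      rw [← WithZero.le_log_iff_exp_le (valued_natCast_ne_zero w hM)]
      have := Finset.le_sup (f := fun v : FinPlace K => (-WithZero.log (Valued.v (M : v.adicCompletion K))).toNat) hw
      lia
    · have hv' : Valued.v (M : w.adicCompletion K) = 1 := by simpa [S] using hw
      rw [hv']
      exact (w.adicCompletionIntegers K).sub_mem (show _ ∈ w.adicCompletionIntegers K from (hx w).le)
        (coe_mem_adicCompletionIntegers w b)
  have hbt : (fun w : PlacesAbove ℚ K v => algebraMap K (w.1.adicCompletion K) (b : K)) ∈ Set.pi (I : Set (PlacesAbove ℚ K v)) t := by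
    intro w hw
    refine hn w ?_
    have h1 := hb w.1 (Finset.mem_union_right _ (Finset.mem_image_of_mem _ (Finset.mem_univ w)))
    rw [IsScalarTower.algebraMap_apply (𝓞 K) K, Valuation.map_sub_swap] at h1
    refine h1.trans ?_
    rw [WithZero.exp_le_exp]
    have := Finset.le_sup (f := n) hw
    lia
  have h1 := hIt hbt
  have h2 : Valued.v ((Rat.cast (Algebra.norm ℚ (b : K)) : v.adicCompletion ℚ) - component v (ideleNorm ℚ K x)) ≤
      WithZero.exp (-(m : ℤ)) := by
    rw [← H.prod_localNorm v, component_ideleNorm]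
    exact h1
  obtain ⟨e, he⟩ := H.dvd_norm_sub (hbM.dvd_sub hM ha)
  have h3 : (component v (ideleNorm ℚ K x) : v.adicCompletion ℚ) - ((Algebra.norm ℤ a : ℤ) : v.adicCompletion ℚ) =
      M * (e : v.adicCompletion ℚ) - ((Rat.cast (Algebra.norm ℚ (b : K)) : v.adicCompletion ℚ) - component v (ideleNorm ℚ K x)) := by
    have h4 : ((Algebra.norm ℤ b : ℤ) : v.adicCompletion ℚ) - (Algebra.norm ℤ a : ℤ) = M * e := by
      exact_mod_cast congrArg (Int.cast : ℤ → v.adicCompletion ℚ) he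
    rw [← Algebra.coe_norm_int, Rat.cast_intCast, ← h4]
    ring
  rw [map_intCast, h3]
  refine (Valuation.map_sub _ _ _).trans (max_le ?_ (h2.trans hm))
  rw [map_mul]
  exact mul_le_of_le_one_right' (intCast_mem (v.adicCompletionIntegers ℚ) e)

end IsSqrtGenerator

end QuadIdele

/-! ### Characters from base change -/

namespace QuadIdele

/-- The value of an infinite idele of `ℚ` in the real numbers. -/
def ratInfiniteToReal : InfiniteAdeleRing ℚ →+* ℝ :=
  (InfinitePlace.Completion.extensionEmbeddingOfIsReal Rat.isReal_infinitePlace).comp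
    (Pi.evalRingHom (fun v : InfinitePlace ℚ => v.Completion) Rat.infinitePlace)

theorem continuous_ratInfiniteToReal : Continuous ratInfiniteToReal :=
  (InfinitePlace.Completion.isometry_extensionEmbeddingOfIsReal Rat.isReal_infinitePlace).continuous.comp
    (continuous_apply (A := fun v : InfinitePlace ℚ => v.Completion) Rat.infinitePlace)

/-- The sign character of the infinite ideles of `ℚ`. -/
def infiniteSign : (InfiniteAdeleRing ℚ)ˣ →* Circle where
  toFun z := if 0 < ratInfiniteToReal z then 1 else -1
  map_one' := by simp
  map_mul' x y := by
    have hx : ratInfiniteToReal x ≠ 0 := (x.isUnit.map ratInfiniteToReal).ne_zero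
    have hy : ratInfiniteToReal y ≠ 0 := (y.isUnit.map ratInfiniteToReal).ne_zero
    rw [Units.val_mul, map_mul]
    rcases lt_or_gt_of_ne hx with hx | hx <;> rcases lt_or_gt_of_ne hy with hy | hy
    · rw [if_pos (mul_pos_of_neg_of_neg hx hy), if_neg hx.not_gt, if_neg hy.not_gt]
      simp
    · rw [if_neg (mul_neg_of_neg_of_pos hx hy).not_gt, if_neg hx.not_gt, if_pos hy]
      simp
    · rw [if_neg (mul_neg_of_pos_of_neg hx hy).not_gt, if_pos hx, if_neg hy.not_gt]
      simp
    · rw [if_pos (mul_pos hx hy), if_pos hx, if_pos hy]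
      simp

theorem infiniteSign_apply (z : (InfiniteAdeleRing ℚ)ˣ) : infiniteSign z = if 0 < ratInfiniteToReal z then 1 else -1 := rfl

theorem infiniteSign_sq (z : (InfiniteAdeleRing ℚ)ˣ) : infiniteSign z ^ 2 = 1 := by
  rw [infiniteSign_apply]
  split_ifs <;> simp

theorem infiniteSign_mem_nhds : {z | infiniteSign z = 1} ∈ nhds 1 := by
  have h := (continuous_ratInfiniteToReal.comp Units.continuous_val).continuousAt (x := (1 : (InfiniteAdeleRing ℚ)ˣ))
  have h2 : Set.Ioi (0 : ℝ) ∈ nhds ((ratInfiniteToReal ∘ Units.val) (1 : (InfiniteAdeleRing ℚ)ˣ)) :=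
    isOpen_Ioi.mem_nhds (by simp)
  filter_upwards [h.preimage_mem_nhds h2] with z hz
  rw [infiniteSign_apply]
  exact if_pos hz

theorem infiniteSign_principalIdele (q : ℚˣ) :
    infiniteSign (infinitePart (principalIdele ℚ q)) = if 0 < (q : ℚ) then 1 else -1 := by
  have h : ratInfiniteToReal (infinitePart (principalIdele ℚ q) : (InfiniteAdeleRing ℚ)ˣ) = ((q : ℚ) : ℝ) :=
    map_ratCast (ratInfiniteToReal.comp (algebraMap ℚ (InfiniteAdeleRing ℚ))) (q : ℚ)
  rw [infiniteSign_apply, h]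
  simp

/-- The idele class character of `ℚ` attached to a quadratic Dirichlet character. -/
theorem exists_rat_ideleClassCharacter {M : ℕ} (hM : M ≠ 0) (χ : ZMod M →* ℤ) :
    ∃ ν : ideleClassCharacters ℚ, (∀ x, ν.1 x ^ 2 = 1) ∧
      ∀ x ∈ unitIdeles ℚ, IsSquare (infinitePart x) → ∀ a : ℤ, CongrMod M x (a : 𝓞 ℚ) → ν.1 x = circleSign (χ a) := by
  let κ : 𝓞 ℚ →* ℤ := χ.comp ((Int.castRingHom (ZMod M)).comp (Rat.ringOfIntegersEquiv : 𝓞 ℚ →+* ℤ)).toMonoidHom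
  have hκ (a b : 𝓞 ℚ) (h : (M : 𝓞 ℚ) ∣ a - b) : κ a = κ b := by
    obtain ⟨e, he⟩ := h
    change χ ((Rat.ringOfIntegersEquiv a : ℤ) : ZMod M) = χ ((Rat.ringOfIntegersEquiv b : ℤ) : ZMod M)
    congr 1
    rw [← sub_eq_zero, ← Int.cast_sub, ← map_sub, he, map_mul, map_natCast]
    simp
  have hneg : IsUnit (χ (-1)) := IsUnit.map χ isUnit_one.neg
  have hodd : Odd (classNumber ℚ) := by
    rw [Rat.classNumber_eq]
    exact odd_one
  have hunit (u : (𝓞 ℚ)ˣ) : u = 1 ∨ u = -1 := by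
    rcases Int.isUnit_iff.1 (u.isUnit.map (Rat.ringOfIntegersEquiv : 𝓞 ℚ →+* ℤ)) with h | h
    · left
      exact Units.ext (Rat.ringOfIntegersEquiv.injective (h.trans (map_one _).symm))
    · right
      exact Units.ext (Rat.ringOfIntegersEquiv.injective (h.trans (by rw [Units.val_neg, map_neg, Units.val_one, map_one])))
  -- The only nontrivial unit is −1. The character at infinity is trivial or the sign, whichever
  -- cancels χ(−1).
  obtain ⟨σ, hσ, hσ', hσ1⟩ : ∃ σ : (InfiniteAdeleRing ℚ)ˣ →* Circle, (∀ z, σ z ^ 2 = 1) ∧ {z | σ z = 1} ∈ nhds 1 ∧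
      circleSign (χ (-1)) * σ (infinitePart (principalIdele ℚ (-1))) = 1 := by
    rcases Int.isUnit_iff.1 hneg with h | h
    · exact ⟨1, by simp, by simp, by simp [h, circleSign]⟩
    · refine ⟨infiniteSign, infiniteSign_sq, infiniteSign_mem_nhds, ?_⟩
      rw [infiniteSign_principalIdele, h]
      simp [circleSign]
  obtain ⟨ν, hν, hν'⟩ := exists_ideleClassCharacter hodd hM κ hκ σ hσ hσ' fun u => by
    rcases hunit u with rfl | rfl
    · rw [map_one, map_one, map_one, map_one, Units.val_one, map_one, circleSign_one, one_mul]
    · convert hσ1 using 2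
      · congr 1
        change χ _ = _
        simp
      · congr 3
  refine ⟨ν, hν, fun x hx hsq a ha => ?_⟩
  obtain ⟨z, hz⟩ := hsq
  rw [hν' x hx _ ha, hz, map_mul, ← pow_two, hσ, mul_one]
  congr 1
  change χ _ = _
  simp

variable {K : Type*} [Field K] [NumberField K]

theorem IsSqrtGenerator.norm_unit {d : ℕ} {s : K} (H : IsSqrtGenerator d s) (u : (𝓞 K)ˣ) : Algebra.norm ℤ (u : 𝓞 K) = 1 := by
  have h1 : IsUnit (Algebra.norm ℤ (u : 𝓞 K)) := u.isUnit.map _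
  have h2 := H.norm_pos (a := ((u : 𝓞 K) : K)) (by simp)
  rw [← Algebra.coe_norm_int] at h2
  rcases Int.isUnit_iff.1 h1 with h | h
  · exact h
  · rw [h] at h2
    norm_num at h2

/-- Quadratic idele class characters of `K` from base change. -/
theorem IsSqrtGenerator.exists_isBaseChange {d : ℕ} {s : K} (H : IsSqrtGenerator d s) (hodd : Odd (classNumber K))
    {M : ℕ} (hM : M ≠ 0) (χ : ZMod M →* ℤ) :
    ∃ η : ideleClassCharacters K, (∀ x, η.1 x ^ 2 = 1) ∧
      (∀ x ∈ unitIdeles K, ∀ a, CongrMod M x a → η.1 x = circleSign (χ (Algebra.norm ℤ a : ℤ))) ∧ IsBaseChange η := by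
  obtain ⟨ν, hν, hν'⟩ := exists_rat_ideleClassCharacter hM χ
  let κ : 𝓞 K →* ℤ := χ.comp ((Int.castRingHom (ZMod M)).toMonoidHom.comp (Algebra.norm ℤ))
  have hκ (a b : 𝓞 K) (h : (M : 𝓞 K) ∣ a - b) : κ a = κ b := by
    obtain ⟨e, he⟩ := H.dvd_norm_sub h
    change χ ((Algebra.norm ℤ a : ℤ) : ZMod M) = χ ((Algebra.norm ℤ b : ℤ) : ZMod M)
    congr 1
    rw [← sub_eq_zero, ← Int.cast_sub, he]
    simp
  -- Global units have norm 1, so the trivial character at infinity already meets the extension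
  -- condition.
  obtain ⟨η, hη, hη'⟩ := exists_ideleClassCharacter hodd hM κ hκ 1 (by simp) (by simp) fun u => by
    have h : κ u = 1 := by
      change χ ((Algebra.norm ℤ (u : 𝓞 K) : ℤ) : ZMod M) = 1
      rw [H.norm_unit u, Int.cast_one, map_one]
    rw [h, circleSign_one, one_mul]
    rfl
  have hη'' (x) (hx : x ∈ unitIdeles K) (a) (ha : CongrMod M x a) : η.1 x = circleSign (χ (Algebra.norm ℤ a : ℤ)) := by
    rw [hη' x hx a ha, MonoidHom.one_apply, mul_one]
    rfl
  refine ⟨η, hη, hη'', ν, fun x => ?_⟩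
  -- Both characters take values ±1, so their equality is the triviality of the product, which is
  -- tested on principal ideles and unit ideles.
  let f : Ideles K →* Circle := η.1.toMonoidHom * (ν.1.toMonoidHom.comp (ideleNorm ℚ K))
  have hf (x) : f x = η.1 x * ν.1 (ideleNorm ℚ K x) := rfl
  have h := character_eq_one hodd f (fun x => by rw [hf, mul_pow, hη, hν, one_mul]) (fun a => ?_) (fun x hx => ?_) x
  · rw [hf] at h
    have h2 := hν (ideleNorm ℚ K x)
    rw [pow_two] at h2
    exact mul_right_cancel (h.trans h2.symm)
  · rw [hf, η.2 a, one_mul]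
    exact H.character_ideleNorm_principalIdele ν.1.toMonoidHom hν ν.2 a
  · obtain ⟨a, ha⟩ := exists_congrMod hM hx
    rw [hf, hη'' x hx a ha, hν' _ (ideleNorm_mem_unitIdeles hx) (isSquare_infinitePart_ideleNorm H.isSquare_infinite x) _
      (H.congrMod_ideleNorm hM hx ha), ← pow_two, circleSign_sq]

end QuadIdele

/-! ### Conductors and local values -/

namespace QuadIdele
variable {K : Type*} [Field K] [NumberField K]

omit [NumberField K] in
theorem pow_multiplicity_le {v : FinPlace K} {f : Ideal (𝓞 K)} : f ≤ v.asIdeal ^ multiplicity v.asIdeal f :=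
  Ideal.le_of_dvd (pow_multiplicity_dvd _ _)

theorem algebraMap_int_ne_zero {v : FinPlace K} {a : 𝓞 K} (ha : a ∉ v.asIdeal) : algebraMap K (v.adicCompletion K) (a : K) ≠ 0 := by
  intro h
  rw [map_eq_zero] at h
  have h0 : a = 0 := by exact_mod_cast h
  exact ha (h0 ▸ zero_mem _)

theorem algebraMap_coe (v : FinPlace K) (a : 𝓞 K) :
    algebraMap K (v.adicCompletion K) (a : K) = algebraMap (𝓞 K) (v.adicCompletion K) a := rfl

theorem valued_eq_one_of_notMem {v : FinPlace K} {a : 𝓞 K} (ha : a ∉ v.asIdeal) :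
    Valued.v (algebraMap K (v.adicCompletion K) (a : K)) = 1 := by
  rw [valued_algebraMap]
  exact valuation_eq_one_iff_notMem v |>.2 ha

theorem valued_natCast_eq_intValuation (v : FinPlace K) (M : ℕ) : Valued.v (M : v.adicCompletion K) = v.intValuation (M : 𝓞 K) := by
  rw [← valued_algebraMap_int v, ← (map_natCast (algebraMap (𝓞 K) (v.adicCompletion K)) M)]

theorem circleSign_ne_one {k : ℤ} (hk : k ≠ 1) : circleSign k ≠ 1 := by
  unfold circleSign
  rw [if_neg hk]
  exact circle_neg_one_ne_one

/-- The conductor of a character given on unit ideles by a function on integers modulo `M`. -/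
theorem hasConductor_of_apply {η : ideleClassCharacters K} {M : ℕ} (hM : M ≠ 0) {κ : 𝓞 K → ℤ}
    (hη : ∀ x ∈ unitIdeles K, ∀ a, CongrMod M x a → η.1 x = circleSign (κ a)) {f : Ideal (𝓞 K)} (hf : f ≠ ⊥)
    (hMf : (M : 𝓞 K) ∈ f) (hκ : ∀ a, (M : 𝓞 K) ∣ a - 1 → κ a = 1)
    (h₁ : ∀ v : FinPlace K, (M : 𝓞 K) ∈ v.asIdeal → ∀ a, a ∉ v.asIdeal → a - 1 ∈ v.asIdeal ^ multiplicity v.asIdeal f →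
      (∀ w : FinPlace K, w ≠ v → w.intValuation (a - 1) ≤ w.intValuation (M : 𝓞 K)) → κ a = 1)
    (h₂ : ∀ v : FinPlace K, ∀ n < multiplicity v.asIdeal f, ∃ a, a ∉ v.asIdeal ∧ a - 1 ∈ v.asIdeal ^ n ∧
      (∀ w : FinPlace K, w ≠ v → w.intValuation (a - 1) ≤ w.intValuation (M : 𝓞 K)) ∧ κ a ≠ 1) :
    HasConductor η f := by
  refine ⟨hf, fun v => ⟨fun u hu => ?_, fun n hn => ?_⟩⟩
  · have hx := localIdele_mem_unitIdeles hu.1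
    obtain ⟨a, ha⟩ := exists_congrMod hM hx
    refine (hη _ hx a ha).trans ?_
    have h3 := ha v
    rw [component_localIdele_same] at h3
    have hMv : Valued.v (M : v.adicCompletion K) ≤ WithZero.exp (-(multiplicity v.asIdeal f : ℤ)) := by
      rw [valued_natCast_eq_intValuation, intValuation_le_pow_iff_mem]
      exact pow_multiplicity_le hMf
    have haw : ∀ w : FinPlace K, w ≠ v → w.intValuation (a - 1) ≤ w.intValuation (M : 𝓞 K) := fun w hw => by
      have h4 := ha w
      rwa [component_localIdele_of_ne hw, Units.val_one, Valuation.map_sub_swap, ← map_one (algebraMap (𝓞 K) (w.adicCompletion K)),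
        ← map_sub, valued_algebraMap_int, valued_natCast_eq_intValuation] at h4
    -- If v does not divide M, the congruences at the other places already give a ≡ 1 modulo M.
    by_cases hvM : (M : 𝓞 K) ∈ v.asIdeal
    swap
    · rw [hκ a (dvd_of_forall_valued_le (by exact_mod_cast hM) fun w => ?_), circleSign_one]
      rw [valued_algebraMap_int, valued_natCast_eq_intValuation]
      by_cases hw : w = v
      · subst hw
        rw [w.intValuation_eq_one_iff.2 hvM]
        exact w.intValuation_le_one _
      · exact haw w hw
    have hav : a ∉ v.asIdeal := fun hav => by
      have h6 : Valued.v (algebraMap (𝓞 K) (v.adicCompletion K) a) < Valued.v (u : v.adicCompletion K) := by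
        rw [valued_algebraMap_int, hu.1]
        exact (v.intValuation_lt_one_iff_mem a).2 hav
      rw [Valuation.map_sub_eq_of_lt_left _ h6, hu.1, valued_natCast_eq_intValuation] at h3
      exact absurd ((v.intValuation_lt_one_iff_mem _).2 hvM) (not_lt.2 h3)
    rw [h₁ v hvM a hav, circleSign_one]
    · rw [← valued_algebraMap_int_le, map_sub, map_one]
      have : algebraMap (𝓞 K) (v.adicCompletion K) a - 1 = ((u : v.adicCompletion K) - 1) - ((u : v.adicCompletion K) - algebraMap (𝓞 K) (v.adicCompletion K) a) := by ring
      rw [this]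
      exact (Valuation.map_sub _ _ _).trans (max_le hu.2 (h3.trans hMv))
    · exact haw
  · by_contra! hlt
    obtain ⟨a, hav, han, haw, hκ⟩ := h₂ v n hlt
    -- The witness a, placed at v alone, is an idele congruent to a modulo M, and η is nontrivial on
    -- it.
    let u := Units.mk0 _ (algebraMap_int_ne_zero hav)
    have hu : u ∈ unitFiltration v n := by
      refine ⟨valued_eq_one_of_notMem hav, ?_⟩
      rw [← valued_algebraMap_int_le, map_sub, map_one] at han
      exact han
    have hx := localIdele_mem_unitIdeles hu.1
    have ha : CongrMod M (localIdele v u) a := by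
      intro w
      by_cases hw : w = v
      · subst hw
        rw [component_localIdele_same, Units.val_mk0, algebraMap_coe, sub_self, map_zero]
        exact zero_le
      · rw [component_localIdele_of_ne hw, Units.val_one, Valuation.map_sub_swap, ← map_one (algebraMap (𝓞 K) (w.adicCompletion K)),
          ← map_sub, valued_algebraMap_int, valued_natCast_eq_intValuation]
        exact haw w hw
    have h5 := hn u hu
    exact circleSign_ne_one hκ ((hη _ hx a ha).symm.trans h5)

/-! ### Local components evaluated at global integers. -/

section localValue

variable {v : FinPlace K} (χ χ' : ideleClassCharacters K)

theorem localValue_of_ne_zero {a : K} (ha : algebraMap K (v.adicCompletion K) a ≠ 0) :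
    localValue χ v a = localComponent χ v (Units.mk0 _ ha) := dif_neg ha

theorem localValue_mul (a b : K) : localValue χ v (a * b) = localValue χ v a * localValue χ v b := by
  have h0 : ∀ c : K, algebraMap K (v.adicCompletion K) c = 0 → localValue χ v c = 0 := fun c hc => dif_pos hc
  by_cases ha : algebraMap K (v.adicCompletion K) a = 0
  · rw [h0 a ha, zero_mul, h0 _ (by rw [map_mul, ha, zero_mul])]
  by_cases hb : algebraMap K (v.adicCompletion K) b = 0
  · rw [h0 b hb, mul_zero, h0 _ (by rw [map_mul, hb, mul_zero])]
  have hab : algebraMap K (v.adicCompletion K) (a * b) ≠ 0 := by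
    rw [map_mul]
    exact mul_ne_zero ha hb
  rw [localValue_of_ne_zero χ ha, localValue_of_ne_zero χ hb, localValue_of_ne_zero χ hab, ← Circle.coe_mul, ← map_mul]
  congr 2
  exact Units.ext (map_mul _ _ _)

theorem localValue_one : localValue χ v 1 = 1 := by
  have h : algebraMap K (v.adicCompletion K) 1 ≠ 0 := by
    rw [map_one]
    exact one_ne_zero
  rw [localValue_of_ne_zero χ h]
  have : Units.mk0 _ h = 1 := Units.ext (map_one _)
  rw [this, map_one, Circle.coe_one]

variable {χ}

theorem localValue_eq_one_or (hχ : ∀ x, χ.1 x ^ 2 = 1) {a : 𝓞 K} (ha : a ∉ v.asIdeal) :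
    localValue χ v a = 1 ∨ localValue χ v a = -1 := by
  rw [localValue_of_ne_zero χ (algebraMap_int_ne_zero ha)]
  rcases circle_eq_one_or (hχ (localIdele v (Units.mk0 _ (algebraMap_int_ne_zero ha)))) with h | h
  · left
    exact congrArg Subtype.val h
  · right
    exact congrArg Subtype.val h

/-- The quotient u / a lies in the n-th step of the filtration. Local characters may therefore be
computed on global integers. -/
theorem coe_localComponent_eq {n : ℕ} (hn : ∀ u ∈ unitFiltration v n, localComponent χ v u = 1) {u : (v.adicCompletion K)ˣ}
    (hu : Valued.v (u : v.adicCompletion K) = 1) {a : 𝓞 K} (ha : a ∉ v.asIdeal)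
    (hua : Valued.v ((u : v.adicCompletion K) - algebraMap (𝓞 K) _ a) ≤ WithZero.exp (-(n : ℤ))) :
    (localComponent χ v u : ℂ) = localValue χ v a := by
  rw [localValue_of_ne_zero χ (algebraMap_int_ne_zero ha)]
  set b := Units.mk0 _ (algebraMap_int_ne_zero ha)
  have hb : Valued.v (b : v.adicCompletion K) = 1 := valued_eq_one_of_notMem ha
  have h := hn (u * b⁻¹) ⟨by rw [Units.val_mul, map_mul, hu, Units.val_inv_eq_inv_val, map_inv₀, hb, inv_one, one_mul], ?_⟩
  · rw [map_mul, map_inv, mul_inv_eq_one] at h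
    rw [h]
  · have h2 : ((u * b⁻¹ : (v.adicCompletion K)ˣ) : v.adicCompletion K) - 1 = ((u : v.adicCompletion K) - b) * (b : v.adicCompletion K)⁻¹ := by
      rw [Units.val_mul, Units.val_inv_eq_inv_val, sub_mul, mul_inv_cancel₀ b.ne_zero]
    rw [h2, map_mul, map_inv₀, hb, inv_one, mul_one]
    exact hua

theorem localValue_congr {n : ℕ} (hn : ∀ u ∈ unitFiltration v n, localComponent χ v u = 1) {a b : 𝓞 K} (ha : a ∉ v.asIdeal)
    (hb : b ∉ v.asIdeal) (hab : a - b ∈ v.asIdeal ^ n) : localValue χ v a = localValue χ v b := by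
  rw [localValue_of_ne_zero χ (algebraMap_int_ne_zero ha)]
  set u := Units.mk0 _ (algebraMap_int_ne_zero ha) with hu
  have hu1 : (u : v.adicCompletion K) = algebraMap (𝓞 K) (v.adicCompletion K) a := rfl
  refine coe_localComponent_eq hn (hu1 ▸ valued_eq_one_of_notMem ha) hb ?_
  rw [hu1, ← map_sub, valued_algebraMap_int_le]
  exact hab

theorem unitFiltration_anti {m n : ℕ} (h : m ≤ n) : unitFiltration v n ⊆ unitFiltration v m := fun u hu =>
  ⟨hu.1, hu.2.trans (by rw [WithZero.exp_le_exp]; lia)⟩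

theorem exists_int_of_mem_unitFiltration {m n : ℕ} (hmn : m ≤ n) (hn : 0 < n) {u : (v.adicCompletion K)ˣ} (hu : u ∈ unitFiltration v m) :
    ∃ a : 𝓞 K, a ∉ v.asIdeal ∧ a - 1 ∈ v.asIdeal ^ m ∧
      Valued.v ((u : v.adicCompletion K) - algebraMap (𝓞 K) _ a) ≤ WithZero.exp (-(n : ℤ)) := by
  obtain ⟨a, ha⟩ := exists_int_valued_sub_le hu.1.le n
  refine ⟨a, fun hav => ?_, ?_, ha⟩
  · have h1 : Valued.v (algebraMap (𝓞 K) (v.adicCompletion K) a) < Valued.v (u : v.adicCompletion K) := by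
      rw [valued_algebraMap_int, hu.1]
      exact (v.intValuation_lt_one_iff_mem a).2 hav
    rw [Valuation.map_sub_eq_of_lt_left _ h1, hu.1, ← WithZero.exp_zero, WithZero.exp_le_exp] at ha
    lia
  · rw [← valued_algebraMap_int_le, map_sub, map_one]
    have : algebraMap (𝓞 K) (v.adicCompletion K) a - 1 = ((u : v.adicCompletion K) - 1) - ((u : v.adicCompletion K) - algebraMap (𝓞 K) (v.adicCompletion K) a) := by ring
    rw [this]
    refine (Valuation.map_sub _ _ _).trans (max_le hu.2 (ha.trans ?_))
    rw [WithZero.exp_le_exp]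
    lia

/-- A character trivial on one step of the unit filtration, and on representatives of the previous
step, is trivial on the previous step. -/
theorem trivial_on_unitFiltration_of_succ {i : ℕ} (hi : ∀ u ∈ unitFiltration v (i + 1), localComponent χ v u = 1)
    (hR : ∀ a : 𝓞 K, a ∉ v.asIdeal → a - 1 ∈ v.asIdeal ^ i → ∃ r : 𝓞 K, a - r ∈ v.asIdeal ^ (i + 1) ∧ localValue χ v r = 1) :
    ∀ u ∈ unitFiltration v i, localComponent χ v u = 1 := by
  intro u hu
  obtain ⟨a, ha, ha1, hua⟩ := exists_int_of_mem_unitFiltration (Nat.le_succ i) i.succ_pos hu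
  obtain ⟨r, har, hr⟩ := hR a ha ha1
  have hrv : r ∉ v.asIdeal := fun h => ha (by
    have := add_mem (Ideal.pow_le_self i.succ_ne_zero har) h
    rwa [sub_add_cancel] at this)
  refine Circle.ext ?_
  rw [coe_localComponent_eq hi hu.1 ha hua, localValue_congr hi ha hrv har, hr, Circle.coe_one]

theorem exists_localValue_ne_one {i n : ℕ} (hin : i ≤ n) (hn : 0 < n) (h : ∀ u ∈ unitFiltration v n, localComponent χ v u = 1)
    (hi : ¬ ∀ u ∈ unitFiltration v i, localComponent χ v u = 1) :
    ∃ a : 𝓞 K, a ∉ v.asIdeal ∧ a - 1 ∈ v.asIdeal ^ i ∧ localValue χ v a ≠ 1 := by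
  push Not at hi
  obtain ⟨u, hu, hu1⟩ := hi
  obtain ⟨a, ha, ha1, hua⟩ := exists_int_of_mem_unitFiltration hin hn hu
  refine ⟨a, ha, ha1, fun h1 => hu1 (Circle.ext ?_)⟩
  rw [coe_localComponent_eq h hu.1 ha hua, h1, Circle.coe_one]

theorem localValue_mul_inv (χ χ' : ideleClassCharacters K) (a : K) (ha : a ≠ 0) :
    localValue (χ * χ'⁻¹) v a = localValue χ v a * (localValue χ' v a)⁻¹ := by
  have h : algebraMap K (v.adicCompletion K) a ≠ 0 := (map_ne_zero _).2 ha
  rw [localValue_of_ne_zero _ h, localValue_of_ne_zero _ h, localValue_of_ne_zero _ h, ← Circle.coe_inv, ← Circle.coe_mul]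
  rfl

theorem localComponent_mul_inv (χ χ' : ideleClassCharacters K) (u : (v.adicCompletion K)ˣ) :
    localComponent (χ * χ'⁻¹) v u = localComponent χ v u * (localComponent χ' v u)⁻¹ := rfl

/-- The product formula for a quadratic character at a global unit. -/
theorem prod_localValue_unit (hc : ∀ z : (InfiniteAdeleRing K)ˣ, IsSquare z) (hχ : ∀ x, χ.1 x ^ 2 = 1) (S : Finset (FinPlace K))
    (hS : ∀ v ∉ S, ∀ u ∈ unitFiltration v 0, localComponent χ v u = 1) (u : (𝓞 K)ˣ) :
    ∏ v ∈ S, localValue χ v ((u : 𝓞 K) : K) = 1 := by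
  let y : Kˣ := Units.map (algebraMap (𝓞 K) K) u
  have hx : principalIdele K y ∈ unitIdeles K := by
    intro v
    rw [← coe_component, component_principalIdele]
    exact valued_eq_one_of_notMem fun h => v.isPrime.ne_top (Ideal.eq_top_of_isUnit_mem _ h u.isUnit)
  have h := character_eq_prod hc χ hχ S hS hx
  rw [χ.2 y] at h
  have h2 := congrArg (Circle.coeHom) h
  rw [map_one, map_prod] at h2
  rw [h2]
  refine Finset.prod_congr rfl fun v _ => ?_
  refine (localValue_of_ne_zero χ ((map_ne_zero _).2 y.ne_zero)).trans ?_
  have hy : Units.mk0 _ ((map_ne_zero (algebraMap K (v.adicCompletion K))).2 y.ne_zero) = component v (principalIdele K y) :=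
    Units.ext (component_principalIdele v y).symm
  exact congrArg (fun z => (localComponent χ v z : ℂ)) hy

end localValue

end QuadIdele

/-! ### Conductors supported at one or two places -/

namespace QuadIdele
variable {K : Type*} [Field K] [NumberField K]

theorem eq_of_asIdeal_le {v w : FinPlace K} (h : v.asIdeal ≤ w.asIdeal) : v = w :=
  HeightOneSpectrum.ext (v.isMaximal.eq_of_le w.isPrime.ne_top h)

theorem eq_of_dvd_pow {v w : FinPlace K} {n : ℕ} (h : w.asIdeal ∣ v.asIdeal ^ n) : w = v :=
  (eq_of_asIdeal_le (Ideal.le_of_dvd (w.prime.dvd_of_dvd_pow h))).symm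

theorem multiplicity_pow_self (v : FinPlace K) (n : ℕ) : multiplicity v.asIdeal (v.asIdeal ^ n) = n :=
  multiplicity_pow_self_of_prime v.prime n

theorem multiplicity_pow_of_ne {v w : FinPlace K} (h : w ≠ v) (n : ℕ) : multiplicity w.asIdeal (v.asIdeal ^ n) = 0 :=
  multiplicity_eq_zero.2 fun h2 => h (eq_of_dvd_pow h2)

theorem multiplicity_mul_pow (u v w : FinPlace K) (n : ℕ) : multiplicity u.asIdeal ((v.asIdeal * w.asIdeal) ^ n) =
    multiplicity u.asIdeal (v.asIdeal ^ n) + multiplicity u.asIdeal (w.asIdeal ^ n) := by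
  rw [mul_pow, multiplicity_mul u.prime]
  exact FiniteMultiplicity.of_prime_left u.prime (mul_ne_zero (pow_ne_zero _ v.ne_bot) (pow_ne_zero _ w.ne_bot))

theorem multiplicity_mul_pow_left {v w : FinPlace K} (h : v ≠ w) (n : ℕ) :
    multiplicity v.asIdeal ((v.asIdeal * w.asIdeal) ^ n) = n := by
  rw [multiplicity_mul_pow, multiplicity_pow_self, multiplicity_pow_of_ne h, add_zero]

theorem multiplicity_mul_pow_right {v w : FinPlace K} (h : v ≠ w) (n : ℕ) :
    multiplicity w.asIdeal ((v.asIdeal * w.asIdeal) ^ n) = n := by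
  rw [multiplicity_mul_pow, multiplicity_pow_self, multiplicity_pow_of_ne h.symm, zero_add]

theorem multiplicity_mul_pow_of_ne {u v w : FinPlace K} (hv : u ≠ v) (hw : u ≠ w) (n : ℕ) :
    multiplicity u.asIdeal ((v.asIdeal * w.asIdeal) ^ n) = 0 := by
  rw [multiplicity_mul_pow, multiplicity_pow_of_ne hv, multiplicity_pow_of_ne hw, zero_add]

theorem intValuation_le_of_notMem {w : FinPlace K} {M : 𝓞 K} (hM : M ∉ w.asIdeal) (a : 𝓞 K) :
    w.intValuation a ≤ w.intValuation M := by
  rw [w.intValuation_eq_one_iff.2 hM]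
  exact w.intValuation_le_one _

/-- With a single place dividing M, the congruences elsewhere are vacuous. The filtration decreases,
so one witness in step n − 1 proves minimality. -/
theorem hasConductor_pow_of_apply {η : ideleClassCharacters K} {M : ℕ} (hM : M ≠ 0) {κ : 𝓞 K → ℤ}
    (hη : ∀ x ∈ unitIdeles K, ∀ a, CongrMod M x a → η.1 x = circleSign (κ a))
    (hκ : ∀ a, (M : 𝓞 K) ∣ a - 1 → κ a = 1) {v : FinPlace K} {n : ℕ} (hMv : (M : 𝓞 K) ∈ v.asIdeal ^ n)
    (hMw : ∀ w : FinPlace K, (M : 𝓞 K) ∈ w.asIdeal → w = v)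
    (h₁ : ∀ a, a ∉ v.asIdeal → a - 1 ∈ v.asIdeal ^ n → κ a = 1)
    (h₂ : ∃ a, a ∉ v.asIdeal ∧ a - 1 ∈ v.asIdeal ^ (n - 1) ∧ κ a ≠ 1) :
    HasConductor η (v.asIdeal ^ n) := by
  refine hasConductor_of_apply hM hη (pow_ne_zero _ v.ne_bot) hMv hκ (fun w hw a ha ha1 _ => ?_) fun w m hm => ?_
  · obtain rfl := hMw w hw
    rw [multiplicity_pow_self] at ha1
    exact h₁ a ha ha1
  · by_cases hw : w = v
    · subst hw
      rw [multiplicity_pow_self] at hm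
      obtain ⟨a, ha, ha1, ha2⟩ := h₂
      exact ⟨a, ha, Ideal.pow_le_pow_right (by lia) ha1, fun u hu => intValuation_le_of_notMem (fun h => hu (hMw u h)) _, ha2⟩
    · rw [multiplicity_pow_of_ne hw] at hm
      exact absurd hm (Nat.not_lt_zero _)

/-- Here M generates the conductor, so being 1 modulo the conductor is being 1 modulo M. Minimality
needs, at each of the two places, a witness that is trivial at the other. -/
theorem hasConductor_mul_pow_of_apply {η : ideleClassCharacters K} {M : ℕ} (hM : M ≠ 0) {κ : 𝓞 K → ℤ}
    (hη : ∀ x ∈ unitIdeles K, ∀ a, CongrMod M x a → η.1 x = circleSign (κ a))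
    (hκ : ∀ a, (M : 𝓞 K) ∣ a - 1 → κ a = 1) {v w : FinPlace K} (hvw : v ≠ w) {n : ℕ}
    (hMvw : Ideal.span {(M : 𝓞 K)} = (v.asIdeal * w.asIdeal) ^ n)
    (hv : ∃ a, a ∉ v.asIdeal ∧ a - 1 ∈ v.asIdeal ^ (n - 1) ∧ a - 1 ∈ w.asIdeal ^ n ∧ κ a ≠ 1)
    (hw : ∃ a, a ∉ w.asIdeal ∧ a - 1 ∈ w.asIdeal ^ (n - 1) ∧ a - 1 ∈ v.asIdeal ^ n ∧ κ a ≠ 1) :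
    HasConductor η ((v.asIdeal * w.asIdeal) ^ n) := by
  have hMu : ∀ u : FinPlace K, (M : 𝓞 K) ∈ u.asIdeal → u = v ∨ u = w := by
    intro u hu
    rw [← Ideal.dvd_span_singleton, hMvw] at hu
    rcases (Prime.dvd_mul u.prime).1 (u.prime.dvd_of_dvd_pow hu) with h | h
    · exact Or.inl (eq_of_asIdeal_le (Ideal.le_of_dvd h)).symm
    · exact Or.inr (eq_of_asIdeal_le (Ideal.le_of_dvd h)).symm
  have hval : ∀ u : FinPlace K, multiplicity u.asIdeal ((v.asIdeal * w.asIdeal) ^ n) = n →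
      u.intValuation (M : 𝓞 K) = WithZero.exp (-(n : ℤ)) := by
    intro u hu
    have hM0 : (M : 𝓞 K) ≠ 0 := Nat.cast_ne_zero.2 hM
    refine le_antisymm ?_ ?_
    · rw [intValuation_le_pow_iff_mem, ← hu]
      exact pow_multiplicity_le (hMvw ▸ Ideal.mem_span_singleton_self _)
    · by_contra! h
      have h2 : u.intValuation (M : 𝓞 K) ≤ WithZero.exp (-((n + 1 : ℕ) : ℤ)) := by
        rw [intValuation_if_neg _ hM0] at h ⊢
        rw [WithZero.exp_lt_exp] at h
        rw [WithZero.exp_le_exp]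
        push_cast
        lia
      rw [intValuation_le_pow_iff_mem, ← Ideal.dvd_span_singleton, hMvw] at h2
      have h3 : FiniteMultiplicity u.asIdeal ((v.asIdeal * w.asIdeal) ^ n) :=
        FiniteMultiplicity.of_prime_left u.prime (pow_ne_zero _ (mul_ne_zero v.ne_bot w.ne_bot))
      have h4 := h3.le_multiplicity_of_pow_dvd h2
      lia
  have key : ∀ u t : FinPlace K, multiplicity t.asIdeal ((v.asIdeal * w.asIdeal) ^ n) = n →
      (∀ r : FinPlace K, (M : 𝓞 K) ∈ r.asIdeal → r = u ∨ r = t) →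
      ∀ a : 𝓞 K, a - 1 ∈ t.asIdeal ^ n → ∀ r : FinPlace K, r ≠ u → r.intValuation (a - 1) ≤ r.intValuation (M : 𝓞 K) := by
    intro u t ht hut a ha r hr
    by_cases hrM : (M : 𝓞 K) ∈ r.asIdeal
    · obtain rfl := (hut r hrM).resolve_left hr
      rw [hval r ht, intValuation_le_pow_iff_mem]
      exact ha
    · exact intValuation_le_of_notMem hrM _
  refine hasConductor_of_apply hM hη (pow_ne_zero _ (mul_ne_zero v.ne_bot w.ne_bot))
    (hMvw ▸ Ideal.mem_span_singleton_self _) hκ (fun u hu a ha ha1 ha2 => hκ a ?_) fun u m hm => ?_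
  · refine dvd_of_forall_valued_le hM fun t => ?_
    rw [valued_algebraMap_int, valued_natCast_eq_intValuation]
    by_cases ht : t = u
    · subst ht
      have hmt : multiplicity t.asIdeal ((v.asIdeal * w.asIdeal) ^ n) = n := by
        rcases hMu t hu with rfl | rfl
        · exact multiplicity_mul_pow_left hvw n
        · exact multiplicity_mul_pow_right hvw n
      rw [hval t hmt, intValuation_le_pow_iff_mem]
      rwa [hmt] at ha1
    · exact ha2 t ht
  · by_cases huv : u = v
    · subst huv
      rw [multiplicity_mul_pow_left hvw] at hm
      obtain ⟨a, ha, ha1, ha2, ha3⟩ := hv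
      exact ⟨a, ha, Ideal.pow_le_pow_right (by lia) ha1, key u w (multiplicity_mul_pow_right hvw n) hMu a ha2, ha3⟩
    by_cases huw : u = w
    · subst huw
      rw [multiplicity_mul_pow_right hvw] at hm
      obtain ⟨a, ha, ha1, ha2, ha3⟩ := hw
      exact ⟨a, ha, Ideal.pow_le_pow_right (by lia) ha1,
        key u v (multiplicity_mul_pow_left hvw n) (fun r hr => (hMu r hr).symm) a ha2, ha3⟩
    · rw [multiplicity_mul_pow_of_ne huv huw] at hm
      exact absurd hm (Nat.not_lt_zero _)

/-! ### Passing from a conductor to the unit filtration. -/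

section extraction

variable {χ : ideleClassCharacters K}

theorem HasConductor.eq_one {f : Ideal (𝓞 K)} (h : HasConductor χ f) {v : FinPlace K} {n : ℕ}
    (hn : multiplicity v.asIdeal f = n) : ∀ u ∈ unitFiltration v n, localComponent χ v u = 1 :=
  hn ▸ (h.2 v).1

theorem HasConductor.not_eq_one {f : Ideal (𝓞 K)} (h : HasConductor χ f) {v : FinPlace K} {m : ℕ}
    (hm : m < multiplicity v.asIdeal f) : ¬ ∀ u ∈ unitFiltration v m, localComponent χ v u = 1 :=
  fun h2 => absurd ((h.2 v).2 h2) (not_le.2 hm)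

theorem sq_eq_one_of_orderOf {χ : ideleClassCharacters K} (h : orderOf χ = 2) (x : Ideles K) : χ.1 x ^ 2 = 1 := by
  have h1 : χ ^ 2 = 1 := h ▸ pow_orderOf_eq_one χ
  exact DFunLike.congr_fun (congrArg Subtype.val h1) x

theorem sq_mul_inv {χ χ' : ideleClassCharacters K} (h : ∀ x, χ.1 x ^ 2 = 1) (h' : ∀ x, χ'.1 x ^ 2 = 1) (x : Ideles K) :
    (χ * χ'⁻¹).1 x ^ 2 = 1 := by
  change (χ.1 x * (χ'.1 x)⁻¹) ^ 2 = 1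
  rw [mul_pow, inv_pow, h, h', inv_one, one_mul]

/-- The trivial character has exponent 0 at a maximal ideal containing f, where f has positive
order. A proper conductor therefore excludes it. -/
theorem mem_quadraticOfConductor {f : Ideal (𝓞 K)} (hf : f ≠ ⊤) (hsq : ∀ x, χ.1 x ^ 2 = 1) (h : HasConductor χ f) :
    χ ∈ quadraticOfConductor K f := by
  refine ⟨orderOf_eq_prime (Subtype.ext (DFunLike.ext _ _ hsq)) fun h1 => hf ?_, h⟩
  subst h1
  by_contra hf1
  obtain ⟨m, hm, hfm⟩ := Ideal.exists_le_maximal f hf1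
  have hm0 : m ≠ ⊥ := fun h0 => h.1 (le_bot_iff.1 (h0 ▸ hfm))
  let v : FinPlace K := ⟨m, hm.isPrime, hm0⟩
  refine h.not_eq_one (v := v) (m := 0) (Nat.pos_of_ne_zero fun h0 => ?_) fun _ _ => rfl
  rw [multiplicity_eq_zero] at h0
  exact h0 (Ideal.dvd_iff_le.2 hfm)

end extraction

end QuadIdele

/-! ### Integers -/

namespace QuadIdele
variable {K : Type*} [Field K] [NumberField K]

/-- The square of the denominator of r divides the squarefree number d. -/
theorem exists_eq_intCast_of_sq_mul {d : ℕ} (hd : Squarefree d) {r : ℚ} {k : ℤ} (h : d * r ^ 2 = k) : ∃ a : ℤ, r = a := by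
  have h1 : (d : ℤ) * r.num ^ 2 = k * (r.den : ℤ) ^ 2 := by
    have hr : (r.den : ℚ) ≠ 0 := Nat.cast_ne_zero.2 r.den_nz
    rw [← Rat.num_div_den r, div_pow, mul_div_assoc', div_eq_iff (pow_ne_zero _ hr)] at h
    exact_mod_cast h
  have h2 : (r.den : ℤ) ^ 2 ∣ d := by
    have h3 : IsCoprime ((r.den : ℤ) ^ 2) (r.num ^ 2) :=
      (Int.isCoprime_iff_gcd_eq_one.2 (by rw [Int.gcd_comm]; exact r.reduced)).pow
    exact h3.dvd_of_dvd_mul_right (Dvd.intro_left k h1.symm)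
  have h4 : r.den ^ 2 ∣ d := by exact_mod_cast h2
  have h5 : r.den = 1 := Nat.isUnit_iff.1 (hd _ (by rwa [← pow_two]))
  exact ⟨r.num, (Rat.coe_int_num_of_den_eq_one h5).symm⟩

namespace IsSqrtGenerator
variable {d : ℕ} {s : K} (H : IsSqrtGenerator d s)
include H

theorem isIntegral : IsIntegral ℤ s :=
  ⟨Polynomial.X ^ 2 + Polynomial.C (d : ℤ), by monicity!, by simp [H.sq]⟩

omit H in
/-- The square root as an algebraic integer. -/
def root (H : IsSqrtGenerator d s) : 𝓞 K := ⟨s, H.isIntegral⟩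

theorem coe_root : (H.root : K) = s := rfl

theorem root_sq : H.root ^ 2 = -(d : 𝓞 K) := RingOfIntegers.ext (by
  change algebraMap (𝓞 K) K _ = algebraMap (𝓞 K) K _
  rw [map_pow]
  exact H.sq.trans (by simp))

theorem conjInt_root : H.conjInt H.root = -H.root := RingOfIntegers.ext (by
  rw [coe_conjInt, coe_root, H.conj_s]
  simp [coe_root])

/-- Writing x = p + q s, the trace makes 2p an integer, the norm then makes d (2q)² an integer, and
squarefreeness does the rest. The doubled form serves every residue of d modulo 4. -/
theorem exists_two_mul_eq (x : 𝓞 K) : ∃ a b : ℤ, 2 * x = a + b * H.root ∧ 4 * Algebra.norm ℤ x = a ^ 2 + d * b ^ 2 := by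
  obtain ⟨p, q, h⟩ := H.exists_eq (x : K)
  have htr : ((x + H.conjInt x : 𝓞 K) : K) = algebraMap ℚ K (2 * p) := by
    change (x : K) + H.conj x = _
    rw [h, H.conj_eq, map_mul, map_ofNat]
    ring
  obtain ⟨a, ha⟩ : ∃ a : ℤ, 2 * p = a := by
    have h1 : IsIntegral ℤ (algebraMap ℚ K (2 * p)) := htr ▸ (x + H.conjInt x).isIntegral_coe
    rw [isIntegral_algebraMap_iff (algebraMap ℚ K).injective] at h1
    obtain ⟨a, ha⟩ := IsIntegrallyClosed.isIntegral_iff.1 h1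
    exact ⟨a, ha.symm⟩
  have hn : (Algebra.norm ℤ x : ℚ) = p ^ 2 + d * q ^ 2 := by
    rw [Algebra.coe_norm_int, h, H.norm_eq]
  obtain ⟨b, hb⟩ : ∃ b : ℤ, 2 * q = b := exists_eq_intCast_of_sq_mul H.squarefree
    (k := 4 * Algebra.norm ℤ x - a ^ 2) (by
      push_cast
      rw [hn, ← ha]
      ring)
  refine ⟨a, b, RingOfIntegers.ext ?_, ?_⟩
  · change 2 * (x : K) = algebraMap (𝓞 K) K _
    have hr : algebraMap (𝓞 K) K H.root = s := rfl
    rw [h, map_add, map_mul, hr, map_intCast, map_intCast]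
    have ha' := congrArg (algebraMap ℚ K) ha
    have hb' := congrArg (algebraMap ℚ K) hb
    rw [map_mul, map_ofNat, map_intCast] at ha' hb'
    linear_combination ha' + s * hb'
  · have : (4 * Algebra.norm ℤ x : ℚ) = a ^ 2 + d * b ^ 2 := by
      rw [hn, ← ha, ← hb]
      ring
    exact_mod_cast this

theorem norm_nonneg (x : 𝓞 K) : 0 ≤ Algebra.norm ℤ x := by
  obtain ⟨a, b, -, h⟩ := H.exists_two_mul_eq x
  nlinarith [sq_nonneg a, mul_nonneg (Nat.cast_nonneg (α := ℤ) d) (sq_nonneg b)]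

theorem norm_natCast (n : ℕ) : Algebra.norm ℤ (n : 𝓞 K) = n ^ 2 := by
  have h := H.mul_conjInt (n : 𝓞 K)
  rw [map_natCast] at h
  have h2 : (((n : ℤ) ^ 2 : ℤ) : 𝓞 K) = (Algebra.norm ℤ (n : 𝓞 K) : ℤ) := by
    rw [← h]
    push_cast
    ring
  exact (Int.cast_injective h2).symm

theorem absNorm_span_natCast (n : ℕ) : Ideal.absNorm (Ideal.span {(n : 𝓞 K)}) = n ^ 2 := by
  rw [Ideal.absNorm_span_singleton, H.norm_natCast, Int.natAbs_pow, Int.natAbs_natCast]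

theorem norm_root : Algebra.norm ℤ H.root = d := by
  have h := H.mul_conjInt H.root
  rw [conjInt_root, mul_neg, ← pow_two, root_sq, neg_neg] at h
  exact (Int.cast_injective (α := 𝓞 K) (by rw [← h, Int.cast_natCast])).symm

theorem absNorm_span_root : Ideal.absNorm (Ideal.span {H.root}) = d := by
  rw [Ideal.absNorm_span_singleton, H.norm_root, Int.natAbs_natCast]

theorem exists_half (hd : d % 4 = 3) : ∃ θ : 𝓞 K, 2 * θ = 1 + H.root := by
  have h : IsIntegral ℤ ((1 + s) / 2) := by
    obtain ⟨k, hk⟩ : ∃ k : ℤ, (d : ℤ) + 1 = 4 * k := ⟨(d + 1) / 4, by lia⟩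
    have hk' : (d : K) + 1 = 4 * k := by exact_mod_cast congrArg (Int.cast (R := K)) hk
    refine ⟨Polynomial.X ^ 2 - Polynomial.X + Polynomial.C k, by monicity!, ?_⟩
    simp only [Polynomial.eval₂_add, Polynomial.eval₂_sub, Polynomial.eval₂_pow, Polynomial.eval₂_X, Polynomial.eval₂_C]
    rw [eq_intCast]
    linear_combination H.sq / 4 - hk' / 4
  refine ⟨⟨_, h⟩, RingOfIntegers.ext ?_⟩
  change 2 * ((1 + s) / 2) = 1 + s
  ring

/-- For d ≡ 3 modulo 4, divisibility of a² + d b² by 4 forces a and b to have the same parity. -/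
theorem exists_eq_add_mul_half (hd : d % 4 = 3) {θ : 𝓞 K} (hθ : 2 * θ = 1 + H.root) (x : 𝓞 K) : ∃ m n : ℤ, x = m + n * θ := by
  obtain ⟨a, b, h, hn⟩ := H.exists_two_mul_eq x
  have hab : (2 : ℤ) ∣ a - b := by
    obtain ⟨k, hk⟩ : ∃ k : ℤ, (d : ℤ) = 4 * k + 3 := ⟨d / 4, by lia⟩
    have h2 : Even ((a - b) * (a + b)) := ⟨2 * (Algebra.norm ℤ x - k * b ^ 2 - b ^ 2), by
      rw [hk] at hn
      linear_combination -hn⟩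
    rcases Int.even_mul.1 h2 with h | h
    · exact h.two_dvd
    · obtain ⟨e, he⟩ := h
      exact ⟨e - b, by lia⟩
  obtain ⟨m, hm⟩ := hab
  refine ⟨m, b, ?_⟩
  have h2 : (2 : 𝓞 K) ≠ 0 := two_ne_zero
  refine mul_left_cancel₀ h2 ?_
  have hm' : (a : 𝓞 K) = 2 * m + b := by exact_mod_cast congrArg (Int.cast (R := 𝓞 K)) (by lia : a = 2 * m + b)
  linear_combination h - b * hθ + hm'

theorem norm_add_mul_root (a b : ℤ) : Algebra.norm ℤ (a + b * H.root) = a ^ 2 + d * b ^ 2 := by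
  have h := H.mul_conjInt (a + b * H.root)
  rw [map_add, map_mul, conjInt_root, map_intCast, map_intCast] at h
  refine Int.cast_injective (α := 𝓞 K) ?_
  rw [← h]
  push_cast
  linear_combination -b ^ 2 * H.root_sq

theorem eq_zero_int {a b : ℤ} (h : a + b * H.root = 0) : a = 0 ∧ b = 0 := by
  have h2 := H.eq_zero (x := a) (y := b) (by
    have := congrArg (algebraMap (𝓞 K) K) h
    simpa [coe_root] using this)
  exact_mod_cast h2

end IsSqrtGenerator

/-- Divisibility of a² + 2 b² by 4 makes a even, and then b even. -/
theorem IsSqrtGenerator.exists_eq_add_mul_root {s : K} (H : IsSqrtGenerator 2 s) (x : 𝓞 K) : ∃ m n : ℤ, x = m + n * H.root := by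
  obtain ⟨a, b, h, hn⟩ := H.exists_two_mul_eq x
  have ha : Even a := by
    have : Even (a ^ 2) := ⟨2 * Algebra.norm ℤ x - b ^ 2, by push_cast at hn; linear_combination -hn⟩
    exact (Int.even_pow' two_ne_zero).1 this
  obtain ⟨m, rfl⟩ := ha
  have hb : Even b := by
    have : Even (b ^ 2) := ⟨Algebra.norm ℤ x - m ^ 2, by push_cast at hn; linarith⟩
    exact (Int.even_pow' two_ne_zero).1 this
  obtain ⟨n, rfl⟩ := hb
  refine ⟨m, n, mul_left_cancel₀ (two_ne_zero (α := 𝓞 K)) ?_⟩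
  push_cast at h
  linear_combination h

end QuadIdele

/-! ### Ideals -/

namespace QuadIdele
variable {K : Type*} [Field K] [NumberField K]

omit [NumberField K] in
theorem span_singleton_ne_bot {a : 𝓞 K} (ha : a ≠ 0) : Ideal.span {a} ≠ ⊥ := by
  rwa [Ne, Ideal.span_singleton_eq_bot]

theorem absNorm_ne_one (v : FinPlace K) : Ideal.absNorm v.asIdeal ≠ 1 :=
  fun h => v.isPrime.ne_top (Ideal.absNorm_eq_one_iff.1 h)

theorem exists_prime_mem (v : FinPlace K) : ∃ p : ℕ, p.Prime ∧ (p : 𝓞 K) ∈ v.asIdeal := by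
  have h : ∀ n : ℕ, n ≠ 0 → (n : 𝓞 K) ∈ v.asIdeal → ∃ p : ℕ, p.Prime ∧ (p : 𝓞 K) ∈ v.asIdeal := by
    intro n
    induction n using Nat.recOnMul with
    | zero => exact fun h => absurd rfl h
    | one => exact fun _ h => absurd ((Ideal.eq_top_iff_one _).2 (by simpa using h)) v.isPrime.ne_top
    | prime p hp => exact fun _ h => ⟨p, hp, h⟩
    | mul a b ha hb =>
      intro h0 hab
      rw [Nat.cast_mul] at hab
      rcases v.isPrime.mem_or_mem hab with h | h
      · exact ha (left_ne_zero_of_mul h0) h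
      · exact hb (right_ne_zero_of_mul h0) h
  refine h _ ?_ (Ideal.absNorm_mem v.asIdeal)
  rw [Ne, Ideal.absNorm_eq_zero_iff]
  exact v.ne_bot

theorem mul_dvd_of_ne {v w : FinPlace K} (hvw : v ≠ w) {I : Ideal (𝓞 K)} (hv : v.asIdeal ∣ I) (hw : w.asIdeal ∣ I) :
    v.asIdeal * w.asIdeal ∣ I := by
  obtain ⟨J, rfl⟩ := hv
  refine mul_dvd_mul_left _ ((w.prime.dvd_or_dvd hw).resolve_left fun h => hvw (eq_of_asIdeal_le (Ideal.le_of_dvd h)))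

theorem eq_of_dvd_of_absNorm_eq {I J : Ideal (𝓞 K)} (hJ : J ≠ ⊥) (h : I ∣ J) (hIJ : Ideal.absNorm I = Ideal.absNorm J) : I = J := by
  obtain ⟨L, rfl⟩ := h
  rw [map_mul] at hIJ
  have h0 : Ideal.absNorm I ≠ 0 := by
    rw [Ne, Ideal.absNorm_eq_zero_iff]
    rintro rfl
    simp at hJ
  have h1 : Ideal.absNorm L = 1 := mul_left_cancel₀ h0 (by rw [← hIJ, mul_one])
  rw [Ideal.absNorm_eq_one_iff] at h1
  rw [h1, Ideal.mul_top]

theorem exists_sub_natCast_mem {v : FinPlace K} {p : ℕ} (hp : p.Prime) (h : Ideal.absNorm v.asIdeal = p) (a : 𝓞 K) :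
    ∃ n : ℕ, a - n ∈ v.asIdeal := by
  have : Fact p.Prime := ⟨hp⟩
  have hcard : Nat.card (𝓞 K ⧸ v.asIdeal) = p := by
    rw [← h]
    rfl
  have hpv : (p : 𝓞 K) ∈ v.asIdeal := h ▸ Ideal.absNorm_mem v.asIdeal
  have : Finite (𝓞 K ⧸ v.asIdeal) := Nat.finite_of_card_ne_zero (hcard ▸ hp.ne_zero)
  have : Fintype (𝓞 K ⧸ v.asIdeal) := Fintype.ofFinite _
  have : CharP (𝓞 K ⧸ v.asIdeal) p := by
    have : Nontrivial (𝓞 K ⧸ v.asIdeal) := Ideal.Quotient.nontrivial_iff.2 v.isPrime.ne_top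
    have h0 : ((p : ℕ) : 𝓞 K ⧸ v.asIdeal) = 0 := by
      rw [← map_natCast (Ideal.Quotient.mk v.asIdeal), Ideal.Quotient.eq_zero_iff_mem]
      exact hpv
    exact (CharP.charP_iff_prime_eq_zero hp).2 h0
  have hb : Function.Bijective (ZMod.castHom (dvd_refl p) (𝓞 K ⧸ v.asIdeal)) :=
    ZMod.castHom_bijective _ (by rw [← Nat.card_eq_fintype_card, hcard])
  obtain ⟨z, hz⟩ := hb.2 (Ideal.Quotient.mk _ a)
  refine ⟨z.val, ?_⟩
  rw [← Ideal.Quotient.eq_zero_iff_mem, map_sub, ← hz, map_natCast, sub_eq_zero, ZMod.castHom_apply, ZMod.cast_eq_val]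

/-- The class of I has order dividing 2 in a group of odd order. -/
theorem isPrincipal_of_sq (hodd : Odd (classNumber K)) {I : Ideal (𝓞 K)} (hI : I ≠ ⊥) {a : 𝓞 K} (h : I ^ 2 = Ideal.span {a}) :
    ∃ b, I = Ideal.span {b} := by
  let J : nonZeroDivisors (Ideal (𝓞 K)) := ⟨I, mem_nonZeroDivisors_of_ne_zero hI⟩
  have h2 : ClassGroup.mk0 J ^ 2 = 1 := by
    rw [← map_pow, ClassGroup.mk0_eq_one_iff]
    exact ⟨a, h⟩
  have h3 : ClassGroup.mk0 J ^ classNumber K = 1 := pow_card_eq_one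
  have h4 : ClassGroup.mk0 J = 1 := by
    obtain ⟨k, hk⟩ := hodd
    rwa [hk, pow_succ, pow_mul, h2, one_pow, one_mul] at h3
  rw [ClassGroup.mk0_eq_one_iff] at h4
  exact h4.principal

namespace IsSqrtGenerator
variable {d : ℕ} {s : K} (H : IsSqrtGenerator d s)
include H

theorem absNorm_eq_or_eq_sq {v : FinPlace K} {p : ℕ} (hp : p.Prime) (hv : (p : 𝓞 K) ∈ v.asIdeal) :
    Ideal.absNorm v.asIdeal = p ∨ Ideal.absNorm v.asIdeal = p ^ 2 := by
  have h : Ideal.absNorm v.asIdeal ∣ p ^ 2 := by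
    rw [← H.absNorm_span_natCast]
    exact map_dvd _ (Ideal.dvd_span_singleton.2 hv)
  obtain ⟨k, hk, hk'⟩ := (Nat.dvd_prime_pow hp).1 h
  interval_cases k
  · exact absurd hk' (absNorm_ne_one v)
  · left
    simpa using hk'
  · exact Or.inr hk'

/-- Each norm is p or p², and their product divides p², so both are p and v w has the norm of (p).
-/
theorem mul_eq_span {v w : FinPlace K} {p : ℕ} (hp : p.Prime) (hvw : v ≠ w) (hv : (p : 𝓞 K) ∈ v.asIdeal) (hw : (p : 𝓞 K) ∈ w.asIdeal) :
    v.asIdeal * w.asIdeal = Ideal.span {(p : 𝓞 K)} ∧ Ideal.absNorm v.asIdeal = p := by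
  have h := mul_dvd_of_ne hvw (Ideal.dvd_span_singleton.2 hv) (Ideal.dvd_span_singleton.2 hw)
  have h2 : Ideal.absNorm v.asIdeal * Ideal.absNorm w.asIdeal ∣ p ^ 2 := by
    rw [← H.absNorm_span_natCast, ← map_mul]
    exact map_dvd _ h
  have hp1 := hp.one_lt
  have hvp : Ideal.absNorm v.asIdeal = p ∧ Ideal.absNorm w.asIdeal = p := by
    have hle := Nat.le_of_dvd (pow_pos hp.pos 2) h2
    rcases H.absNorm_eq_or_eq_sq hp hv with h3 | h3 <;> rcases H.absNorm_eq_or_eq_sq hp hw with h4 | h4 <;> rw [h3, h4] at hle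
    · exact ⟨h3, h4⟩
    all_goals exfalso; nlinarith [pow_pos hp.pos 2, pow_pos hp.pos 3]
  refine ⟨eq_of_dvd_of_absNorm_eq (by simpa using hp.ne_zero) h ?_, hvp.1⟩
  rw [map_mul, hvp.1, hvp.2, H.absNorm_span_natCast, pow_two]

theorem natCast_mem_conjPlace {v : FinPlace K} {p : ℕ} (hv : (p : 𝓞 K) ∈ v.asIdeal) : (p : 𝓞 K) ∈ (H.conjPlace v).asIdeal := by
  rwa [mem_conjPlace, map_natCast]

/-- Conjugation acts trivially on a residue field of prime order, so v contains a minus its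
conjugate for every a. Such a difference equals √−d for a suitable a, or 2√−d when d = 2. -/
theorem root_mem (hd : d = 2 ∨ d % 4 = 3) {v : FinPlace K} (hv : H.conjPlace v = v) {p : ℕ} (hp : p.Prime)
    (hvp : Ideal.absNorm v.asIdeal = p) : H.root ∈ v.asIdeal := by
  have h : ∀ a : 𝓞 K, a - H.conjInt a ∈ v.asIdeal := by
    intro a
    obtain ⟨n, hn⟩ := exists_sub_natCast_mem hp hvp a
    have hn' : H.conjInt a - n ∈ v.asIdeal := by
      rw [← hv, mem_conjPlace, map_sub, conjInt_conjInt, map_natCast]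
      exact hn
    simpa using sub_mem hn hn'
  rcases hd with rfl | hd
  · have h1 := h H.root
    rw [conjInt_root, sub_neg_eq_add, ← two_mul] at h1
    rcases v.isPrime.mem_or_mem h1 with h2 | h2
    · refine v.isPrime.mem_of_pow_mem 2 ?_
      rw [root_sq, neg_mem_iff]
      exact_mod_cast h2
    · exact h2
  · obtain ⟨θ, hθ⟩ := H.exists_half hd
    have h1 : θ - H.conjInt θ = H.root := by
      have h2 := congrArg H.conjInt hθ
      rw [map_mul, map_add, conjInt_root, map_ofNat, map_one] at h2
      refine mul_left_cancel₀ (two_ne_zero (α := 𝓞 K)) ?_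
      linear_combination hθ - h2
    exact h1 ▸ h θ

theorem isPrime_span_root (hd : d.Prime) : (Ideal.span {H.root}).IsPrime :=
  Ideal.isPrime_of_irreducible_absNorm (by rwa [H.absNorm_span_root])

theorem root_ne_zero : H.root ≠ 0 := fun h => by
  have h1 := H.root_sq
  rw [h, zero_pow two_ne_zero, zero_eq_neg] at h1
  exact H.pos.ne' (Nat.cast_eq_zero.1 h1)

theorem eq_span_root (hd : d.Prime) {v : FinPlace K} (hv : H.root ∈ v.asIdeal) : v.asIdeal = Ideal.span {H.root} := by
  let w : FinPlace K := ⟨_, H.isPrime_span_root hd, by simpa using H.root_ne_zero⟩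
  have h : w = v := eq_of_asIdeal_le (by rwa [Ideal.span_singleton_le_iff_mem])
  rw [← h]

/-- A place moved by conjugation goes to the other one, since both products equal (p). If both
places were fixed, both would contain √−d and coincide. -/
theorem conjPlace_eq (hd : d.Prime) (hd' : d = 2 ∨ d % 4 = 3) {v w : FinPlace K} {p : ℕ} (hp : p.Prime) (hvw : v ≠ w)
    (hv : (p : 𝓞 K) ∈ v.asIdeal) (hw : (p : 𝓞 K) ∈ w.asIdeal) : H.conjPlace v = w := by
  have h := H.mul_eq_span hp hvw hv hw
  have h2 := H.mul_eq_span hp hvw.symm hw hv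
  have key : ∀ u t : FinPlace K, (p : 𝓞 K) ∈ u.asIdeal → u.asIdeal * t.asIdeal = Ideal.span {(p : 𝓞 K)} → H.conjPlace u ≠ u → H.conjPlace u = t := by
    intro u t hu hut hne
    have h3 := (H.mul_eq_span hp hne.symm hu (H.natCast_mem_conjPlace hu)).1
    exact HeightOneSpectrum.ext (mul_left_cancel₀ u.ne_bot (h3.trans hut.symm))
  by_contra hne
  have hv1 : H.conjPlace v = v := by
    by_contra h3
    exact hne (key v w hv h.1 h3)
  have hw1 : H.conjPlace w = w := by
    by_contra h3
    have h4 := key w v hw h2.1 h3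
    rw [← h4] at hv1
    refine h3 ?_
    rw [hv1.symm]
    ext a
    rw [mem_conjPlace, mem_conjPlace, conjInt_conjInt]
  exact hvw (HeightOneSpectrum.ext ((H.eq_span_root hd (H.root_mem hd' hv1 hp h.2)).trans
    (H.eq_span_root hd (H.root_mem hd' hw1 hp h2.2)).symm))

theorem dvd_of_root_mem {v : FinPlace K} {p : ℕ} (hp : p.Prime) (hv : (p : 𝓞 K) ∈ v.asIdeal) (hs : H.root ∈ v.asIdeal) : p ∣ d := by
  by_contra h
  obtain ⟨a, b, hab⟩ := (Nat.isCoprime_iff_coprime.2 ((Nat.Prime.coprime_iff_not_dvd hp).2 h))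
  have hd : (d : 𝓞 K) ∈ v.asIdeal := by
    rw [← neg_neg (d : 𝓞 K), ← root_sq, neg_mem_iff]
    exact Ideal.pow_mem_of_mem _ hs 2 two_pos
  refine v.isPrime.ne_top ((Ideal.eq_top_iff_one _).2 ?_)
  have h1 : (1 : 𝓞 K) = a * p + b * d := by exact_mod_cast (congrArg (Int.cast (R := 𝓞 K)) hab).symm
  rw [h1]
  exact add_mem (Ideal.mul_mem_left _ _ hv) (Ideal.mul_mem_left _ _ hd)

/-- If v² divides p, then v has degree one and is stable under conjugation, so `root_mem` applies.
Conversely the square of (√−d) is (d). -/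
theorem isRamified_iff (hd : d.Prime) (hd' : d = 2 ∨ d % 4 = 3) {v : FinPlace K} {p : ℕ} (hp : p.Prime) :
    IsRamified p v ↔ p = d ∧ v.asIdeal = Ideal.span {H.root} := by
  constructor
  · intro h
    have hv : (p : 𝓞 K) ∈ v.asIdeal := Ideal.dvd_span_singleton.1 ((dvd_pow_self _ two_ne_zero).trans h)
    have hn : Ideal.absNorm v.asIdeal = p := by
      refine (H.absNorm_eq_or_eq_sq hp hv).resolve_right fun h1 => ?_
      have h2 : Ideal.absNorm v.asIdeal ^ 2 ∣ p ^ 2 := by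
        rw [← H.absNorm_span_natCast p, ← map_pow]
        exact map_dvd _ h
      rw [h1] at h2
      have h3 := Nat.le_of_dvd (pow_pos hp.pos 2) h2
      have := hp.one_lt
      nlinarith [pow_pos hp.pos 2, pow_pos hp.pos 3]
    have hsq : v.asIdeal ^ 2 = Ideal.span {(p : 𝓞 K)} :=
      eq_of_dvd_of_absNorm_eq (by simpa using hp.ne_zero) h (by rw [map_pow, hn, H.absNorm_span_natCast])
    have hc : H.conjPlace v = v := by
      by_contra hne
      have h3 := (H.mul_eq_span hp (Ne.symm hne) hv (H.natCast_mem_conjPlace hv)).1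
      rw [← hsq, pow_two] at h3
      exact hne (HeightOneSpectrum.ext (mul_left_cancel₀ v.ne_bot h3))
    have hs := H.root_mem hd' hc hp hn
    exact ⟨(Nat.prime_dvd_prime_iff_eq hp hd).1 (H.dvd_of_root_mem hp hv hs), H.eq_span_root hd hs⟩
  · rintro ⟨rfl, hv⟩
    unfold IsRamified
    rw [hv, Ideal.span_singleton_pow, root_sq, Ideal.span_singleton_neg]

omit H in
/-- The ramified place. -/
def ramifiedPlace (H : IsSqrtGenerator d s) (hd : d.Prime) : FinPlace K :=
  ⟨Ideal.span {H.root}, H.isPrime_span_root hd, by simpa using H.root_ne_zero⟩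

theorem existsUnique_ramified (hd : d.Prime) (hd' : d = 2 ∨ d % 4 = 3) : ∃! p : ℕ, p.Prime ∧ ∃ v : FinPlace K, IsRamified p v :=
  ⟨d, ⟨hd, H.ramifiedPlace hd, (H.isRamified_iff hd hd' hd).2 ⟨rfl, rfl⟩⟩, fun _ ⟨hp, _, hv⟩ => ((H.isRamified_iff hd hd' hp).1 hv).1⟩

theorem root_mem_of_natCast_mem {v : FinPlace K} (hv : (d : 𝓞 K) ∈ v.asIdeal) : H.root ∈ v.asIdeal :=
  v.isPrime.mem_of_pow_mem 2 (by rwa [root_sq, neg_mem_iff])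

/-! ### Ideals stable under conjugation, and the parity of the class number. -/

theorem comap_conjInt_mul (I J : Ideal (𝓞 K)) : (I * J).comap H.conjInt = I.comap H.conjInt * J.comap H.conjInt := by
  rw [← Ideal.map_symm, ← Ideal.map_symm, ← Ideal.map_symm, Ideal.map_mul]

theorem comap_comap_conjInt (I : Ideal (𝓞 K)) : (I.comap H.conjInt).comap H.conjInt = I := by
  ext a
  rw [Ideal.mem_comap, Ideal.mem_comap, conjInt_conjInt]

theorem comap_conjInt_span (a : 𝓞 K) : (Ideal.span {a}).comap H.conjInt = Ideal.span {H.conjInt a} := by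
  ext b
  rw [Ideal.mem_comap, Ideal.mem_span_singleton, Ideal.mem_span_singleton]
  constructor
  · rintro ⟨c, hc⟩
    exact ⟨H.conjInt c, by rw [← map_mul, ← hc, conjInt_conjInt]⟩
  · rintro ⟨c, hc⟩
    exact ⟨H.conjInt c, by rw [hc, map_mul, conjInt_conjInt]⟩

/-- A stable ideal is built from the prime (√−d), inert primes (p), and products (p) of two
conjugate primes, all principal. Induction on the norm splits off one such factor. -/
theorem isPrincipal_of_comap_eq (hd : d.Prime) (hd' : d = 2 ∨ d % 4 = 3) (n : ℕ) : ∀ I : Ideal (𝓞 K), I ≠ ⊥ → Ideal.absNorm I ≤ n →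
    I.comap H.conjInt = I → ∃ a, I = Ideal.span {a} := by
  induction n with
  | zero =>
    intro I hI hn _
    exact absurd (Ideal.absNorm_eq_zero_iff.1 (Nat.le_zero.1 hn)) hI
  | succ n ih =>
    intro I hI hn hc
    by_cases htop : I = ⊤
    · exact ⟨1, by rw [htop, Ideal.span_singleton_one]⟩
    obtain ⟨m, hm, hIm⟩ := Ideal.exists_le_maximal I htop
    let v : FinPlace K := ⟨m, hm.isPrime, fun h0 => hI (le_bot_iff.1 (h0 ▸ hIm))⟩
    have key : ∀ a : 𝓞 K, Ideal.span {a} ∣ I → Ideal.span {H.conjInt a} = Ideal.span {a} →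
        Ideal.absNorm (Ideal.span {a}) ≠ 1 → ∃ a, I = Ideal.span {a} := by
      rintro a ⟨J, rfl⟩ ha ha1
      rw [comap_conjInt_mul, comap_conjInt_span, ha] at hc
      have h0 : Ideal.span {a} ≠ ⊥ := fun h => hI (by rw [h, Ideal.bot_mul])
      have hJ : J ≠ ⊥ := fun h => hI (by rw [h, Ideal.mul_bot])
      rw [map_mul] at hn
      have h1 : Ideal.absNorm J ≠ 0 := by rwa [Ne, Ideal.absNorm_eq_zero_iff]
      have h2 : Ideal.absNorm (Ideal.span {a}) ≠ 0 := by rwa [Ne, Ideal.absNorm_eq_zero_iff]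
      have h3 : 2 ≤ Ideal.absNorm (Ideal.span {a}) := by lia
      obtain ⟨b, hb⟩ := ih J hJ (by nlinarith [Nat.pos_of_ne_zero h1]) (mul_left_cancel₀ h0 hc)
      exact ⟨a * b, by rw [hb, Ideal.span_singleton_mul_span_singleton]⟩
    have hvI : v.asIdeal ∣ I := Ideal.dvd_iff_le.2 hIm
    obtain ⟨p, hp, hvp⟩ := exists_prime_mem v
    have hpn : Ideal.absNorm (Ideal.span {(p : 𝓞 K)}) ≠ 1 := by
      rw [H.absNorm_span_natCast]
      exact (Nat.one_lt_pow two_ne_zero hp.one_lt).ne'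
    by_cases hcv : H.conjPlace v = v
    · rcases H.absNorm_eq_or_eq_sq hp hvp with h1 | h1
      · have hv := H.eq_span_root hd (H.root_mem hd' hcv hp h1)
        refine key H.root (hv ▸ hvI) (by rw [conjInt_root, Ideal.span_singleton_neg]) (hv ▸ absNorm_ne_one v)
      · have hv : v.asIdeal = Ideal.span {(p : 𝓞 K)} :=
          eq_of_dvd_of_absNorm_eq (by simpa using hp.ne_zero) (Ideal.dvd_span_singleton.2 hvp) (by rw [h1, H.absNorm_span_natCast])
        exact key p (hv ▸ hvI) (by rw [map_natCast]) hpn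
    · have h1 := (H.mul_eq_span hp (Ne.symm hcv) hvp (H.natCast_mem_conjPlace hvp)).1
      refine key p (h1 ▸ mul_dvd_of_ne (Ne.symm hcv) hvI ?_) (by rw [map_natCast]) hpn
      rw [Ideal.dvd_iff_le] at hvI ⊢
      intro a ha
      rw [mem_conjPlace]
      exact hvI (by rwa [← Ideal.mem_comap, hc])

/-- If the class of I has order two, it equals the class of the conjugate of I, because their
product is stable and so principal. Comparing generators gives x and y of equal norm, and Hilbert 90
turns I into a stable ideal of the same class. -/
theorem odd_classNumber (hd : d.Prime) (hd' : d = 2 ∨ d % 4 = 3) : Odd (classNumber K) := by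
  by_contra heven
  rw [Nat.not_odd_iff_even] at heven
  have : Fact (Nat.Prime 2) := ⟨Nat.prime_two⟩
  obtain ⟨C, hC⟩ := exists_prime_orderOf_dvd_card (G := ClassGroup (𝓞 K)) 2 heven.two_dvd
  obtain ⟨⟨I, hI⟩, rfl⟩ := ClassGroup.mk0_surjective C
  have hI0 : I ≠ ⊥ := nonZeroDivisors.ne_zero hI
  have hcI0 : I.comap H.conjInt ≠ ⊥ := fun h => hI0 (by
    rw [← H.comap_comap_conjInt I, h]
    exact Ideal.comap_bot_of_injective _ H.conjInt.injective)
  have hinv : ∀ J : Ideal (𝓞 K), J ≠ ⊥ → J.comap H.conjInt = J → ∃ a, J = Ideal.span {a} := fun J hJ hc =>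
    H.isPrincipal_of_comap_eq hd hd' _ J hJ le_rfl hc
  have hnp : ∀ a, I ≠ Ideal.span {a} := by
    intro a ha
    have h1 : ClassGroup.mk0 (⟨I, hI⟩ : nonZeroDivisors (Ideal (𝓞 K))) = 1 := (ClassGroup.mk0_eq_one_iff hI).2 ⟨a, ha⟩
    rw [h1, orderOf_one] at hC
    lia
  obtain ⟨x, y, hx, hy, hxy⟩ : ∃ x y : 𝓞 K, x ≠ 0 ∧ y ≠ 0 ∧ Ideal.span {x} * I = Ideal.span {y} * I.comap H.conjInt := by
    have h1 : ClassGroup.mk0 ⟨I, hI⟩ * ClassGroup.mk0 ⟨_, mem_nonZeroDivisors_of_ne_zero hcI0⟩ = 1 := by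
      rw [← map_mul, ClassGroup.mk0_eq_one_iff]
      refine ⟨hinv _ (mul_ne_zero hI0 hcI0) ?_⟩
      change (I * I.comap H.conjInt).comap _ = I * I.comap H.conjInt
      rw [comap_conjInt_mul, comap_comap_conjInt, mul_comm]
    have h2 : ClassGroup.mk0 ⟨I, hI⟩ * ClassGroup.mk0 ⟨I, hI⟩ = 1 := by
      rw [← pow_two, ← hC, pow_orderOf_eq_one]
    obtain ⟨x, y, hx, hy, h⟩ := ClassGroup.mk0_eq_mk0_iff.1 (mul_left_cancel (h2.trans h1.symm))
    exact ⟨x, y, hx, hy, h⟩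
  have hN : x * H.conjInt x = y * H.conjInt y := by
    have h1 := congrArg Ideal.absNorm hxy
    have h2 : Ideal.absNorm (I.comap H.conjInt) = Ideal.absNorm I := by
      exact (Nat.card_congr (Ideal.quotientEquiv I (I.comap H.conjInt) H.conjInt.symm (Ideal.map_symm _).symm).toEquiv).symm
    rw [map_mul, map_mul, h2] at h1
    have h3 := Nat.eq_of_mul_eq_mul_right (Nat.pos_of_ne_zero (by rwa [Ne, Ideal.absNorm_eq_zero_iff])) h1
    rw [Ideal.absNorm_span_singleton, Ideal.absNorm_span_singleton] at h3
    rw [mul_conjInt, mul_conjInt]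
    congr 1
    have := H.norm_nonneg x
    have := H.norm_nonneg y
    lia
  -- The element γ below vanishes exactly when x = −y, and then I itself is stable.
  by_cases h0 : x + y = 0
  · have hxy' : x = -y := eq_neg_of_add_eq_zero_left h0
    rw [hxy', Ideal.span_singleton_neg] at hxy
    obtain ⟨a, ha⟩ := hinv I hI0 (mul_left_cancel₀ (by simpa using hy) hxy).symm
    exact hnp a ha
  -- Hilbert 90 for x / y, of norm 1: the conjugate of γ divided by γ is x / y. Multiplying I by
  -- that conjugate makes it stable.
  · set γ := y * (H.conjInt x + H.conjInt y) with hγ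
    have hγ' : H.conjInt γ = H.conjInt y * (x + y) := by
      rw [hγ, map_mul, map_add, conjInt_conjInt, conjInt_conjInt]
    have hcy : H.conjInt y ≠ 0 := fun h => hy (by rw [← H.conjInt_conjInt y, h, map_zero])
    have hγ0 : H.conjInt γ ≠ 0 := hγ' ▸ mul_ne_zero hcy h0
    have h1 : γ * x = y * H.conjInt γ := by
      rw [hγ', hγ]
      linear_combination y * hN
    have h2 : Ideal.span {γ} * I.comap H.conjInt = Ideal.span {H.conjInt γ} * I := by
      have h3 : Ideal.span {y} ≠ ⊥ := by simpa using hy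
      refine mul_left_cancel₀ h3 ?_
      rw [← mul_assoc, mul_comm (Ideal.span {y}), mul_assoc, ← hxy, ← mul_assoc, ← mul_assoc, Ideal.span_singleton_mul_span_singleton,
        Ideal.span_singleton_mul_span_singleton, h1]
    obtain ⟨a, ha⟩ := hinv (Ideal.span {H.conjInt γ} * I) (mul_ne_zero (span_singleton_ne_bot hγ0) hI0) (by
      rw [comap_conjInt_mul, comap_conjInt_span, conjInt_conjInt, h2])
    have ha2 : a ∈ Ideal.span {H.conjInt γ} * I := ha ▸ Ideal.mem_span_singleton_self a
    have ha3 : a ∈ Ideal.span {H.conjInt γ} := Ideal.mul_le_left ha2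
    obtain ⟨b, hb⟩ := Ideal.mem_span_singleton.1 ha3
    have hab : Ideal.span {H.conjInt γ} * I = Ideal.span {H.conjInt γ} * Ideal.span {b} := by
      rw [ha, hb, Ideal.span_singleton_mul_span_singleton]
    exact hnp b (mul_left_cancel₀ (span_singleton_ne_bot hγ0) hab)

end IsSqrtGenerator

end QuadIdele

/-! ### Class number and units -/

namespace QuadIdele
variable {K : Type*} [Field K] [NumberField K]
namespace IsSqrtGenerator
variable {d : ℕ} {s : K} (H : IsSqrtGenerator d s)
include H

theorem unit_sq_eq (u : (𝓞 K)ˣ) : ∃ a b : ℤ, 2 * (u : 𝓞 K) = a + b * H.root ∧ a ^ 2 + d * b ^ 2 = 4 := by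
  obtain ⟨a, b, h, hn⟩ := H.exists_two_mul_eq u
  exact ⟨a, b, h, by rw [← hn, H.norm_unit, mul_one]⟩

/-- For d > 4 the equation a² + d b² = 4 forces b = 0. For d = 2 a nonzero b would need a² = 2 or b²
= 2. -/
theorem unit_eq_one_or (hd : d = 2 ∨ 4 < d) (u : (𝓞 K)ˣ) : u = 1 ∨ u = -1 := by
  obtain ⟨a, b, h, hab⟩ := H.unit_sq_eq u
  have h2 : (2 : 𝓞 K) ≠ 0 := two_ne_zero
  have hb : b = 0 := by
    by_contra hb
    have hb1 : 1 ≤ b ^ 2 := by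
      have := sq_nonneg b
      have := pow_ne_zero 2 hb
      lia
    rcases hd with rfl | hd
    · have ha : a ^ 2 = 2 ∨ a ^ 2 = 0 := by
        have := sq_nonneg a
        push_cast at hab
        lia
      rcases ha with ha | ha
      · have h1 : a < 2 := by nlinarith
        have h3 : -2 < a := by nlinarith
        interval_cases a <;> lia
      · rw [ha] at hab
        push_cast at hab
        have hb2 : b ^ 2 = 2 := by lia
        have h1 : b < 2 := by nlinarith
        have h3 : -2 < b := by nlinarith
        interval_cases b <;> lia
    · have : (5 : ℤ) ≤ d := by exact_mod_cast hd
      nlinarith [sq_nonneg a]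
  subst hb
  have ha : (a - 2) * (a + 2) = 0 := by linear_combination hab
  rcases mul_eq_zero.1 ha with ha | ha
  · left
    obtain rfl : a = 2 := by lia
    refine Units.ext (mul_left_cancel₀ h2 ?_)
    rw [h]
    simp
  · right
    obtain rfl : a = -2 := by lia
    refine Units.ext (mul_left_cancel₀ h2 ?_)
    rw [h]
    simp

theorem exists_isPrimitiveRoot (hd : d = 3) : ∃ ζ : (𝓞 K)ˣ, IsPrimitiveRoot ζ 6 ∧ Subgroup.zpowers ζ = ⊤ := by
  obtain ⟨θ, hθ⟩ := H.exists_half (by lia)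
  have h2 : (2 : 𝓞 K) ≠ 0 := two_ne_zero
  have hsq : θ ^ 2 = θ - 1 := by
    refine mul_left_cancel₀ (mul_ne_zero h2 h2) ?_
    have h3 := H.root_sq
    have hd3 : (d : 𝓞 K) = 3 := by exact_mod_cast congrArg (Nat.cast (R := 𝓞 K)) hd
    linear_combination (2 * θ + H.root - 1) * hθ + h3 - hd3
  let ζ : (𝓞 K)ˣ := ⟨θ, 1 - θ, by linear_combination -hsq, by linear_combination -hsq⟩
  have hζ : (ζ : 𝓞 K) = θ := rfl
  have e2 : ((ζ ^ 2 : (𝓞 K)ˣ) : 𝓞 K) = θ - 1 := by rw [Units.val_pow_eq_pow_val, hζ, hsq]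
  have e3 : ζ ^ 3 = -1 := Units.ext (by
    rw [Units.val_pow_eq_pow_val, hζ, Units.val_neg, Units.val_one]
    linear_combination (θ + 1) * hsq)
  have e4 : ζ ^ 4 = -ζ := by rw [pow_succ, e3, neg_one_mul]
  have e5 : ζ ^ 5 = -ζ ^ 2 := by rw [show ζ ^ 5 = ζ ^ 3 * ζ ^ 2 from pow_add ζ 3 2, e3, neg_one_mul]
  have e6 : ζ ^ 6 = 1 := by rw [show ζ ^ 6 = ζ ^ 3 * ζ ^ 3 from pow_add ζ 3 3, e3]; simp
  have hne : (1 : (𝓞 K)ˣ) ≠ -1 := fun h => by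
    have h3 := congrArg Units.val h
    rw [Units.val_neg, Units.val_one] at h3
    exact h2 (by linear_combination h3)
  have h1 : ζ ≠ 1 := fun h => by
    rw [h, one_pow] at e3
    exact hne e3
  have h22 : ζ ^ 2 ≠ 1 := fun h => by
    have h3 : ζ ^ 3 = ζ := by rw [pow_succ, h, one_mul]
    rw [e3] at h3
    rw [← h3] at e2
    have h4 : θ = -1 := by rw [← hζ, ← h3]; simp
    rw [h4] at hsq
    have h5 : (3 : 𝓞 K) = 0 := by linear_combination hsq
    exact OfNat.ofNat_ne_zero 3 h5
  refine ⟨ζ, IsPrimitiveRoot.mk_of_lt _ (by norm_num) e6 fun l hl hl6 => ?_, ?_⟩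
  · interval_cases l
    · rwa [pow_one]
    · exact h22
    · rw [e3]
      exact hne.symm
    · rw [e4]
      intro h
      apply h22
      rw [← neg_sq, h, one_pow]
    · intro h
      apply h1
      rw [pow_succ, h, one_mul] at e6
      exact e6
  · rw [Subgroup.eq_top_iff']
    intro u
    obtain ⟨a, b, h, hab⟩ := H.unit_sq_eq u
    rw [hd] at hab
    push_cast at hab
    have hr : H.root = 2 * θ - 1 := by linear_combination -hθ
    rw [hr] at h
    have hb1 : b < 2 := by nlinarith
    have hb2 : -2 < b := by nlinarith
    have ha1 : a < 3 := by nlinarith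
    have ha2 : -3 < a := by nlinarith
    have key : ∀ n : ℕ, 2 * (u : 𝓞 K) = 2 * (ζ : 𝓞 K) ^ n → u ∈ Subgroup.zpowers ζ := fun n hn =>
      ⟨n, by
        refine (zpow_natCast ζ n).trans ?_
        refine (Units.ext (mul_left_cancel₀ h2 ?_)).symm
        rw [hn, Units.val_pow_eq_pow_val]⟩
    rw [hζ] at key
    -- The six integral solutions of a² + 3 b² = 4 are the six powers of ζ.
    interval_cases b <;> interval_cases a <;> simp only [Int.reducePow, Int.reduceMul, Int.reduceAdd, Int.reduceEq, Int.reduceNeg] at hab <;>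
      push_cast at h
    · exact key 4 (by rw [h]; linear_combination -2 * (θ ^ 2 + θ) * hsq)
    · exact key 5 (by rw [h]; linear_combination -2 * (θ ^ 3 + θ ^ 2 - 1) * hsq)
    · exact key 3 (by rw [h]; linear_combination -2 * (θ + 1) * hsq)
    · exact key 0 (by rw [h]; ring)
    · exact key 2 (by rw [h]; linear_combination -2 * hsq)
    · exact key 1 (by rw [h]; ring)

/-- For d = p m, the ideal (p, √−d) has square (p), so it is principal and gives an element of norm
p. The norm equation becomes p a'² + m b² = 4, which leaves only m = 1. -/
theorem prime_or_eq_one (hodd : Odd (classNumber K)) : d = 1 ∨ d.Prime := by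
  by_cases h1 : d = 1
  · exact Or.inl h1
  right
  obtain ⟨p, hp, m, rfl⟩ := Nat.exists_prime_and_dvd h1
  have hcop : Nat.Coprime p m := Nat.coprime_of_squarefree_mul H.squarefree
  obtain ⟨e, f, hef⟩ := Nat.isCoprime_iff_coprime.2 hcop
  have hsq := H.root_sq
  have hI : Ideal.span {(p : 𝓞 K), H.root} ^ 2 = Ideal.span {(p : 𝓞 K)} := by
    rw [pow_two, Ideal.span_pair_mul_span_pair]
    apply le_antisymm
    · rw [Ideal.span_le]
      have hpp : (p : 𝓞 K) ∈ Ideal.span {(p : 𝓞 K)} := Ideal.mem_span_singleton_self _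
      rintro x (rfl | rfl | rfl | rfl)
      · exact Ideal.mul_mem_left _ _ hpp
      · exact Ideal.mul_mem_right _ _ hpp
      · exact Ideal.mul_mem_left _ _ hpp
      · refine Ideal.mem_span_singleton.2 ⟨-m, ?_⟩
        push_cast at hsq
        linear_combination hsq
    · rw [Ideal.span_singleton_le_iff_mem]
      -- The Bézout relation e p + f m = 1 is multiplied by p, and p m is minus the square of √−d.
      have h1 : (p : 𝓞 K) = e * (p * p) + (-f) * (H.root * H.root) := by
        have : (e : 𝓞 K) * p + f * m = 1 := by exact_mod_cast congrArg (Int.cast (R := 𝓞 K)) hef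
        push_cast at hsq
        linear_combination f * hsq - p * this
      have key : ∀ J : Ideal (𝓞 K), (p : 𝓞 K) * p ∈ J → H.root * H.root ∈ J → (p : 𝓞 K) ∈ J := fun J h2 h3 => by
        have h4 := add_mem (Ideal.mul_mem_left J (e : 𝓞 K) h2) (Ideal.mul_mem_left J (-f : 𝓞 K) h3)
        rwa [← h1] at h4
      exact key _ (Ideal.subset_span (by simp)) (Ideal.subset_span (by simp))
  have hp0 : (p : 𝓞 K) ≠ 0 := Nat.cast_ne_zero.2 hp.ne_zero
  have hI0 : Ideal.span {(p : 𝓞 K), H.root} ≠ ⊥ := fun h => by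
    rw [h, pow_two, Ideal.bot_mul] at hI
    exact span_singleton_ne_bot hp0 hI.symm
  obtain ⟨α, hα⟩ := isPrincipal_of_sq hodd hI0 hI
  have hN : Algebra.norm ℤ α = p := by
    have h2 := congrArg Ideal.absNorm hI
    rw [hα, map_pow, H.absNorm_span_natCast, Ideal.absNorm_span_singleton] at h2
    have h3 := Nat.pow_left_injective two_ne_zero h2
    have := H.norm_nonneg α
    lia
  obtain ⟨a, b, -, hab⟩ := H.exists_two_mul_eq α
  rw [hN] at hab
  push_cast at hab
  have hpz : Prime (p : ℤ) := Nat.prime_iff_prime_int.1 hp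
  obtain ⟨a', rfl⟩ : (p : ℤ) ∣ a := hpz.dvd_of_dvd_pow (n := 2) ⟨4 - m * b ^ 2, by linear_combination -hab⟩
  have h4 : p * a' ^ 2 + m * b ^ 2 = 4 := by
    refine mul_left_cancel₀ hpz.ne_zero ?_
    linear_combination -hab
  have hm0 : 0 < m := Nat.pos_of_ne_zero fun h => H.pos.ne' (by rw [h, mul_zero])
  suffices m = 1 by rwa [this, mul_one]
  by_contra hm1
  have hp2 : (2 : ℤ) ≤ p := by exact_mod_cast hp.two_le
  have hm2 : (2 : ℤ) ≤ m := by lia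
  have hpz0 : (0 : ℤ) < p := by lia
  have hmz0 : (0 : ℤ) < m := by lia
  have hsqz : ∀ z : ℤ, z = 0 ∨ 1 ≤ z ^ 2 := fun z => by
    by_cases hz : z = 0
    · exact Or.inl hz
    · have := sq_nonneg z
      have := pow_ne_zero 2 hz
      right
      lia
  -- The bound leaves only z = ±1, so q would be 4, which is not squarefree.
  have hsmall : ∀ (q : ℕ) (z : ℤ), Squarefree q → 2 ≤ q → (q : ℤ) * z ^ 2 ≠ 4 := by
    intro q z hq hq2 hz
    have hz2 : z ^ 2 ≤ 2 := by nlinarith [sq_nonneg z]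
    have hz3 : z < 2 := by nlinarith
    have hz4 : -2 < z := by nlinarith
    have hq4 : q = 4 := by interval_cases z <;> lia
    rw [hq4] at hq
    exact absurd (hq 2 ⟨1, by norm_num⟩) (by simp)
  rcases hsqz a' with rfl | ha'
  · exact hsmall m b H.squarefree.of_mul_right (by lia) (by linear_combination h4)
  rcases hsqz b with rfl | hb'
  · exact hsmall p a' H.squarefree.of_mul_left (by lia) (by linear_combination h4)
  -- With a' and b both nonzero, p + m ≤ 4 gives p = m = 2, against coprimality.
  have hpm : p = m := by
    have h5 : (p : ℤ) ≤ 2 := by nlinarith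
    have h6 : (m : ℤ) ≤ 2 := by nlinarith
    lia
  rw [← hpm, Nat.coprime_self] at hcop
  exact hp.ne_one hcop

/-- For d ≡ 1 modulo 4 the ideal (2, 1 + √−d) has square (2). If principal, it gives a² + d b² = 8,
which has no solution with d ≥ 5 in this residue class. -/
theorem mod_four_ne_one (hodd : Odd (classNumber K)) (h1 : d ≠ 1) : d % 4 ≠ 1 := by
  intro h4
  obtain ⟨k, hk⟩ : ∃ k, d = 4 * k + 1 := ⟨d / 4, by lia⟩
  have hsq := H.root_sq
  have hd : (d : 𝓞 K) = 4 * k + 1 := by exact_mod_cast congrArg (Nat.cast (R := 𝓞 K)) hk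
  have hI : Ideal.span {((2 : ℕ) : 𝓞 K), 1 + H.root} ^ 2 = Ideal.span {((2 : ℕ) : 𝓞 K)} := by
    rw [pow_two, Ideal.span_pair_mul_span_pair]
    apply le_antisymm
    · rw [Ideal.span_le]
      have hpp : ((2 : ℕ) : 𝓞 K) ∈ Ideal.span {((2 : ℕ) : 𝓞 K)} := Ideal.mem_span_singleton_self _
      rintro x (rfl | rfl | rfl | rfl)
      · exact Ideal.mul_mem_left _ _ hpp
      · exact Ideal.mul_mem_right _ _ hpp
      · exact Ideal.mul_mem_left _ _ hpp
      · refine Ideal.mem_span_singleton.2 ⟨H.root - 2 * k, ?_⟩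
        push_cast
        linear_combination hsq - hd
    · rw [Ideal.span_singleton_le_iff_mem]
      have h1 : ((2 : ℕ) : 𝓞 K) = (-k : 𝓞 K) * (((2 : ℕ) : 𝓞 K) * ((2 : ℕ) : 𝓞 K)) +
          (1 * (((2 : ℕ) : 𝓞 K) * (1 + H.root)) + (-1) * ((1 + H.root) * (1 + H.root))) := by
        push_cast
        linear_combination hsq - hd
      have key : ∀ J : Ideal (𝓞 K), ((2 : ℕ) : 𝓞 K) * ((2 : ℕ) : 𝓞 K) ∈ J → ((2 : ℕ) : 𝓞 K) * (1 + H.root) ∈ J →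
          (1 + H.root) * (1 + H.root) ∈ J → ((2 : ℕ) : 𝓞 K) ∈ J := fun J h2 h3 h4 => by
        have h5 := add_mem (Ideal.mul_mem_left J (-k : 𝓞 K) h2) (add_mem (Ideal.mul_mem_left J 1 h3) (Ideal.mul_mem_left J (-1) h4))
        rwa [← h1] at h5
      exact key _ (Ideal.subset_span (by simp)) (Ideal.subset_span (by simp)) (Ideal.subset_span (by simp))
  have h20 : ((2 : ℕ) : 𝓞 K) ≠ 0 := Nat.cast_ne_zero.2 two_ne_zero
  have hI0 : Ideal.span {((2 : ℕ) : 𝓞 K), 1 + H.root} ≠ ⊥ := fun h => by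
    rw [h, pow_two, Ideal.bot_mul] at hI
    exact span_singleton_ne_bot h20 hI.symm
  obtain ⟨α, hα⟩ := isPrincipal_of_sq hodd hI0 hI
  have hN : Algebra.norm ℤ α = 2 := by
    have h2 := congrArg Ideal.absNorm hI
    rw [hα, map_pow, H.absNorm_span_natCast, Ideal.absNorm_span_singleton] at h2
    have h3 := Nat.pow_left_injective two_ne_zero h2
    have := H.norm_nonneg α
    lia
  obtain ⟨a, b, -, hab⟩ := H.exists_two_mul_eq α
  rw [hN] at hab
  have hd5 : (5 : ℤ) ≤ d := by lia
  have hb1 : b < 2 := by nlinarith [sq_nonneg a]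
  have hb2 : -2 < b := by nlinarith [sq_nonneg a]
  have ha1 : a < 3 := by nlinarith [mul_nonneg (Nat.cast_nonneg (α := ℤ) d) (sq_nonneg b)]
  have ha2 : -3 < a := by nlinarith [mul_nonneg (Nat.cast_nonneg (α := ℤ) d) (sq_nonneg b)]
  interval_cases b <;> interval_cases a <;> lia

/-- For d = 1 there is a unit u with u² = −1. It is not ±1, and u⁶ = −1 keeps it out of a group of
order 6. -/
theorem ne_one_of_units (h : (∀ u : (𝓞 K)ˣ, u = 1 ∨ u = -1) ∨ ∃ ζ : (𝓞 K)ˣ, IsPrimitiveRoot ζ 6 ∧ Subgroup.zpowers ζ = ⊤) :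
    d ≠ 1 := by
  rintro rfl
  have hsq := H.root_sq
  rw [Nat.cast_one] at hsq
  let u : (𝓞 K)ˣ := ⟨H.root, -H.root, by linear_combination -hsq, by linear_combination -hsq⟩
  have hu : u ^ 2 = -1 := Units.ext (by simpa [u] using hsq)
  have hne : (1 : (𝓞 K)ˣ) ≠ -1 := fun h => by
    have h3 := congrArg Units.val h
    rw [Units.val_neg, Units.val_one] at h3
    exact two_ne_zero (α := 𝓞 K) (by linear_combination h3)
  rcases h with h | ⟨ζ, hζ, htop⟩
  · refine hne (Eq.trans ?_ hu)
    rcases h u with h | h <;> simp [h]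
  · obtain ⟨k, hk⟩ : u ∈ Subgroup.zpowers ζ := htop ▸ Subgroup.mem_top u
    have h6 : u ^ 6 = 1 := by
      rw [← hk]
      change (ζ ^ k) ^ 6 = 1
      rw [← zpow_natCast, ← zpow_mul, mul_comm, zpow_mul, zpow_natCast, hζ.pow_eq_one, one_zpow]
    have h6' : u ^ 6 = -1 := by
      rw [show u ^ 6 = (u ^ 2) ^ 3 from pow_mul u 2 3, hu]
      exact Odd.neg_one_pow (by decide)
    exact hne (h6.symm.trans h6')

theorem oddClassNumberSmallUnits_iff : OddClassNumberSmallUnits K ↔ d = 2 ∨ (d.Prime ∧ d % 4 = 3) := by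
  constructor
  · rintro ⟨hodd, hu⟩
    have h1 := H.ne_one_of_units hu
    have hp := (H.prime_or_eq_one hodd).resolve_left h1
    have h4 := H.mod_four_ne_one hodd h1
    rcases hp.eq_two_or_odd with h | h
    · exact Or.inl h
    · exact Or.inr ⟨hp, by lia⟩
  · intro h
    have hp : d.Prime := by
      rcases h with rfl | h
      · exact Nat.prime_two
      · exact h.1
    refine ⟨H.odd_classNumber hp (h.imp_right And.right), ?_⟩
    by_cases h3 : d = 3
    · exact Or.inr (H.exists_isPrimitiveRoot h3)
    · left
      refine H.unit_eq_one_or ?_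
      lia

end IsSqrtGenerator
end QuadIdele

/-! ### Comparison of characters -/

namespace QuadIdele
variable {K : Type*} [Field K] [NumberField K]

theorem localValue_eq_circleSign {η : ideleClassCharacters K} {M : ℕ} {κ : 𝓞 K → ℤ}
    (hη : ∀ x ∈ unitIdeles K, ∀ a, CongrMod M x a → η.1 x = circleSign (κ a)) {v : FinPlace K} {a : 𝓞 K} (hav : a ∉ v.asIdeal)
    (haw : ∀ w : FinPlace K, w ≠ v → w.intValuation (a - 1) ≤ w.intValuation (M : 𝓞 K)) :
    localValue η v a = circleSign (κ a) := by
  have hx : localIdele v (Units.mk0 _ (algebraMap_int_ne_zero hav)) ∈ unitIdeles K :=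
    localIdele_mem_unitIdeles (valued_eq_one_of_notMem hav)
  rw [localValue_of_ne_zero η (algebraMap_int_ne_zero hav)]
  refine congrArg Subtype.val (hη _ hx a fun w => ?_)
  by_cases hw : w = v
  · subst hw
    rw [component_localIdele_same, Units.val_mk0, algebraMap_coe, sub_self, map_zero]
    exact zero_le
  · rw [component_localIdele_of_ne hw, Units.val_one, Valuation.map_sub_swap, ← map_one (algebraMap (𝓞 K) (w.adicCompletion K)),
      ← map_sub, valued_algebraMap_int, valued_natCast_eq_intValuation]
    exact haw w hw

section

variable {χ χ' : ideleClassCharacters K} {v : FinPlace K}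

theorem eq_of_mul_inv (hodd : Odd (classNumber K)) (hc : ∀ z : (InfiniteAdeleRing K)ˣ, IsSquare z)
    (hχ : ∀ x, χ.1 x ^ 2 = 1) (hχ' : ∀ x, χ'.1 x ^ 2 = 1)
    (h : ∀ v, ∀ u ∈ unitFiltration v 0, localComponent (χ * χ'⁻¹) v u = 1) : χ = χ' :=
  mul_inv_eq_one.1 (ideleClassCharacter_eq_one hodd hc _ (sq_mul_inv hχ hχ') h)

theorem mul_inv_trivial {n : ℕ} (h : ∀ u ∈ unitFiltration v n, localComponent χ v u = 1)
    (h' : ∀ u ∈ unitFiltration v n, localComponent χ' v u = 1) : ∀ u ∈ unitFiltration v n, localComponent (χ * χ'⁻¹) v u = 1 := by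
  intro u hu
  rw [localComponent_mul_inv, h u hu, h' u hu, inv_one, one_mul]

omit [NumberField K] in
theorem int_ne_zero_of_notMem {a : 𝓞 K} (ha : a ∉ v.asIdeal) : (a : K) ≠ 0 := by
  intro h
  have h0 : a = 0 := by exact_mod_cast h
  exact ha (h0 ▸ zero_mem _)

omit [NumberField K] in
theorem one_notMem : (1 : 𝓞 K) ∉ v.asIdeal := fun h => v.isPrime.ne_top ((Ideal.eq_top_iff_one _).2 h)

omit [NumberField K] in
theorem notMem_of_sub_one_mem {a : 𝓞 K} (h : a - 1 ∈ v.asIdeal) : a ∉ v.asIdeal := fun ha =>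
  one_notMem (v := v) (by simpa using sub_mem ha h)

theorem localValue_mul_inv_eq_one (hχ : ∀ x, χ.1 x ^ 2 = 1) {a : 𝓞 K} (ha : a ∉ v.asIdeal)
    (h : localValue χ v a = localValue χ' v a) : localValue (χ * χ'⁻¹) v a = 1 := by
  rw [localValue_mul_inv _ _ _ (int_ne_zero_of_notMem ha), ← h]
  rcases localValue_eq_one_or hχ ha with h | h <;> rw [h] <;> norm_num

theorem localValue_sq (hχ : ∀ x, χ.1 x ^ 2 = 1) {a : 𝓞 K} (ha : a ∉ v.asIdeal) :
    localValue χ v ((a ^ 2 : 𝓞 K) : K) = 1 := by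
  have h2 : ((a ^ 2 : 𝓞 K) : K) = (a : K) * a := by
    rw [← pow_two]
    exact map_pow (algebraMap (𝓞 K) K) a 2
  rw [h2, localValue_mul]
  rcases localValue_eq_one_or hχ ha with h | h <;> rw [h] <;> norm_num

theorem localValue_mul_int (a b : 𝓞 K) : localValue χ v ((a * b : 𝓞 K) : K) = localValue χ v a * localValue χ v b := by
  rw [← localValue_mul]
  exact congrArg _ (map_mul (algebraMap (𝓞 K) K) a b)

/-- A character of conductor exponent one at `v` is the quadratic character of the residue field. -/
theorem localValue_eq_one_iff (hχ : ∀ x, χ.1 x ^ 2 = 1) (h1 : ∀ u ∈ unitFiltration v 1, localComponent χ v u = 1)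
    (h0 : ¬ ∀ u ∈ unitFiltration v 0, localComponent χ v u = 1) {a : 𝓞 K} (ha : a ∉ v.asIdeal) :
    localValue χ v a = 1 ↔ ∃ b : 𝓞 K, a - b ^ 2 ∈ v.asIdeal := by
  classical
  have hcongr : ∀ {a b : 𝓞 K}, a ∉ v.asIdeal → b ∉ v.asIdeal → a - b ∈ v.asIdeal → localValue χ v a = localValue χ v b :=
    fun ha hb hab => localValue_congr h1 ha hb (by rwa [pow_one])
  have hnm : ∀ {a b : 𝓞 K}, a ∉ v.asIdeal → a - b ^ 2 ∈ v.asIdeal → b ∉ v.asIdeal := fun {a b} ha hab hb =>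
    ha (by simpa using add_mem hab (Ideal.pow_mem_of_mem _ hb 2 two_pos))
  have hsq : ∀ {a : 𝓞 K}, a ∉ v.asIdeal → (∃ b : 𝓞 K, a - b ^ 2 ∈ v.asIdeal) → localValue χ v a = 1 := by
    rintro a ha ⟨b, hb⟩
    have hbv := hnm ha hb
    rw [hcongr ha (fun h => hbv (v.isPrime.mem_of_pow_mem 2 h)) hb, localValue_sq hχ hbv]
  refine ⟨fun h => ?_, hsq ha⟩
  by_contra hns
  -- Some g has value different from 1, so it is a nonresidue. If a were also a nonresidue, g a
  -- would be a square modulo v, and χ(a) = 1 would give χ(g) = 1.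
  obtain ⟨g, hg, -, hg1⟩ := exists_localValue_ne_one (Nat.zero_le 1) one_pos h1 h0
  have hgns : ¬ ∃ b : 𝓞 K, g - b ^ 2 ∈ v.asIdeal := fun h => hg1 (hsq hg h)
  let : Field (𝓞 K ⧸ v.asIdeal) := Ideal.Quotient.field v.asIdeal
  have : Finite (𝓞 K ⧸ v.asIdeal) := (Ideal.absNorm_ne_zero_iff _).1 (by rw [Ne, Ideal.absNorm_eq_zero_iff]; exact v.ne_bot)
  let : Fintype (𝓞 K ⧸ v.asIdeal) := Fintype.ofFinite _
  have hq : ∀ {c : 𝓞 K}, IsSquare (Ideal.Quotient.mk v.asIdeal c) ↔ ∃ b : 𝓞 K, c - b ^ 2 ∈ v.asIdeal := by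
    intro c
    constructor
    · rintro ⟨r, hr⟩
      obtain ⟨b, rfl⟩ := Ideal.Quotient.mk_surjective r
      refine ⟨b, ?_⟩
      rw [← Ideal.Quotient.eq_zero_iff_mem, map_sub, hr, map_pow, pow_two, sub_self]
    · rintro ⟨b, hb⟩
      rw [← Ideal.Quotient.eq_zero_iff_mem, map_sub, sub_eq_zero] at hb
      exact ⟨Ideal.Quotient.mk _ b, by rw [hb, map_pow, pow_two]⟩
  have hga : ∃ b : 𝓞 K, g * a - b ^ 2 ∈ v.asIdeal := by
    rw [← hq, map_mul]
    have h2 := quadraticChar_neg_one_iff_not_isSquare.2 (hq.not.2 hgns)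
    have h3 := quadraticChar_neg_one_iff_not_isSquare.2 (hq.not.2 hns)
    rw [← quadraticChar_one_iff_isSquare, map_mul, h2, h3]
    · norm_num
    · refine mul_ne_zero ?_ ?_ <;> rwa [Ne, Ideal.Quotient.eq_zero_iff_mem]
  have h4 := hsq (v.isPrime.mul_notMem hg ha) hga
  rw [localValue_mul_int, h, mul_one] at h4
  exact hg1 h4

theorem mul_inv_trivial_of_one (hχ : ∀ x, χ.1 x ^ 2 = 1) (hχ' : ∀ x, χ'.1 x ^ 2 = 1)
    (h1 : ∀ u ∈ unitFiltration v 1, localComponent χ v u = 1) (h0 : ¬ ∀ u ∈ unitFiltration v 0, localComponent χ v u = 1)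
    (h1' : ∀ u ∈ unitFiltration v 1, localComponent χ' v u = 1) (h0' : ¬ ∀ u ∈ unitFiltration v 0, localComponent χ' v u = 1) :
    ∀ u ∈ unitFiltration v 0, localComponent (χ * χ'⁻¹) v u = 1 := by
  refine trivial_on_unitFiltration_of_succ (mul_inv_trivial h1 h1') fun a ha _ => ⟨a, by simp, localValue_mul_inv_eq_one hχ ha ?_⟩
  have h := (localValue_eq_one_iff hχ h1 h0 ha).trans (localValue_eq_one_iff hχ' h1' h0' ha).symm
  rcases localValue_eq_one_or hχ ha with h2 | h2
  · rw [h2, h.1 h2]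
  · rcases localValue_eq_one_or hχ' ha with h3 | h3
    · rw [h3, h.2 h3]
    · rw [h2, h3]

/-- At a ramified place both characters restrict to the quadratic character of the residue field, so
their quotient is unramified everywhere. -/
theorem eq_of_multiplicity_le_one (hodd : Odd (classNumber K)) (hc : ∀ z : (InfiniteAdeleRing K)ˣ, IsSquare z) {f : Ideal (𝓞 K)}
    (hf : ∀ v : FinPlace K, multiplicity v.asIdeal f = 0 ∨ multiplicity v.asIdeal f = 1) (h : χ ∈ quadraticOfConductor K f)
    (h' : χ' ∈ quadraticOfConductor K f) : χ = χ' := by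
  have hχ := sq_eq_one_of_orderOf h.1
  have hχ' := sq_eq_one_of_orderOf h'.1
  refine eq_of_mul_inv hodd hc hχ hχ' fun v => ?_
  rcases hf v with hv | hv
  · exact mul_inv_trivial (h.2.eq_one hv) (h'.2.eq_one hv)
  · exact mul_inv_trivial_of_one hχ hχ' (h.2.eq_one hv) (h.2.not_eq_one (by rw [hv]; exact one_pos)) (h'.2.eq_one hv)
      (h'.2.not_eq_one (by rw [hv]; exact one_pos))

/-! ### Graded pieces of the unit filtration. -/

theorem intValuation_uniformizer {π : 𝓞 K} (hπ : π ∈ v.asIdeal) (hπ2 : π ∉ v.asIdeal ^ 2) :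
    v.intValuation π = WithZero.exp (-(1 : ℤ)) := by
  have h0 : π ≠ 0 := fun h => hπ2 (h ▸ zero_mem _)
  have h1 : v.intValuation π ≤ WithZero.exp (-((1 : ℕ) : ℤ)) := (v.intValuation_le_pow_iff_mem π 1).2 (by rwa [pow_one])
  have h2 : ¬ v.intValuation π ≤ WithZero.exp (-((2 : ℕ) : ℤ)) := fun h => hπ2 ((v.intValuation_le_pow_iff_mem π 2).1 h)
  rw [intValuation_if_neg _ h0, WithZero.exp_le_exp] at h1 h2
  rw [intValuation_if_neg _ h0, WithZero.exp_inj]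
  lia

theorem exists_sub_mul_mem {π : 𝓞 K} (hπ : π ∈ v.asIdeal) (hπ2 : π ∉ v.asIdeal ^ 2) {i : ℕ} {a : 𝓞 K} (ha : a ∈ v.asIdeal ^ i) :
    ∃ b, a - π ^ i * b ∈ v.asIdeal ^ (i + 1) := by
  have h2 : π ^ i ∉ v.asIdeal ^ (i + 1) := by
    rw [← intValuation_le_pow_iff_mem, map_pow, intValuation_uniformizer hπ hπ2, ← WithZero.exp_nsmul, WithZero.exp_le_exp]
    simp
  obtain ⟨b, e, he, h⟩ := Ideal.exists_mul_add_mem_pow_succ v.ne_bot _ a (Ideal.pow_mem_pow hπ i) h2 ha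
  exact ⟨b, by rw [← h, add_sub_cancel_left]; exact he⟩

/-- The step of the unit filtration in terms of representatives of the residue field. -/
theorem trivial_of_residues {π : 𝓞 K} (hπ : π ∈ v.asIdeal) (hπ2 : π ∉ v.asIdeal ^ 2) {i : ℕ}
    (hi : ∀ u ∈ unitFiltration v (i + 1), localComponent χ v u = 1)
    (hR : ∀ b : 𝓞 K, ∃ r : 𝓞 K, b - r ∈ v.asIdeal ∧ localValue χ v ((1 + π ^ i * r : 𝓞 K) : K) = 1) :
    ∀ u ∈ unitFiltration v i, localComponent χ v u = 1 := by
  refine trivial_on_unitFiltration_of_succ hi fun a _ ha1 => ?_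
  obtain ⟨b, hb⟩ := exists_sub_mul_mem hπ hπ2 ha1
  obtain ⟨r, hr, h1⟩ := hR b
  refine ⟨_, ?_, h1⟩
  have h2 : π ^ i * (b - r) ∈ v.asIdeal ^ (i + 1) := by
    rw [pow_succ]
    exact Ideal.mul_mem_mul (Ideal.pow_mem_pow hπ i) hr
  have h3 := add_mem hb h2
  convert h3 using 1
  ring

theorem exists_residue_of_absNorm_eq_two (hv : Ideal.absNorm v.asIdeal = 2) (b : 𝓞 K) : b ∈ v.asIdeal ∨ b - 1 ∈ v.asIdeal := by
  obtain ⟨n, hn⟩ := exists_sub_natCast_mem Nat.prime_two hv b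
  have h2 : (2 : 𝓞 K) ∈ v.asIdeal := by
    have := Ideal.absNorm_mem v.asIdeal
    rwa [hv] at this
  rcases Nat.even_or_odd' n with ⟨k, rfl | rfl⟩
  · left
    have h3 := add_mem hn (Ideal.mul_mem_right (k : 𝓞 K) _ h2)
    push_cast at h3
    simpa using h3
  · right
    have h3 := add_mem hn (Ideal.mul_mem_right (k : 𝓞 K) _ h2)
    push_cast at h3
    convert h3 using 1
    ring

/-- With residue field 𝔽₂ and i ≥ 1, the only nontrivial class of the graded piece is that of 1 + π
^ i. -/
theorem trivial_of_absNorm_eq_two (hv : Ideal.absNorm v.asIdeal = 2) {π : 𝓞 K} (hπ : π ∈ v.asIdeal) (hπ2 : π ∉ v.asIdeal ^ 2) {i : ℕ}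
    (hi : ∀ u ∈ unitFiltration v (i + 1), localComponent χ v u = 1) (h : localValue χ v ((1 + π ^ i : 𝓞 K) : K) = 1) :
    ∀ u ∈ unitFiltration v i, localComponent χ v u = 1 := by
  refine trivial_of_residues hπ hπ2 hi fun b => ?_
  rcases exists_residue_of_absNorm_eq_two hv b with hb | hb
  · refine ⟨0, by rwa [sub_zero], ?_⟩
    rw [mul_zero, add_zero]
    exact (congrArg _ (map_one (algebraMap (𝓞 K) K))).trans (localValue_one χ)
  · exact ⟨1, hb, by rwa [mul_one]⟩

/-- The group 𝔽₂ˣ is trivial, so every local unit is congruent to 1. -/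
theorem trivial_zero_of_absNorm_eq_two (hv : Ideal.absNorm v.asIdeal = 2)
    (h : ∀ u ∈ unitFiltration v 1, localComponent χ v u = 1) : ∀ u ∈ unitFiltration v 0, localComponent χ v u = 1 := by
  refine trivial_on_unitFiltration_of_succ h fun a ha _ => ⟨1, ?_, ?_⟩
  · rw [zero_add, pow_one]
    exact (exists_residue_of_absNorm_eq_two hv a).resolve_left ha
  · exact (congrArg _ (map_one (algebraMap (𝓞 K) K))).trans (localValue_one χ)

/-- If the residue field has two elements, conductor exponent `i + 1` determines the value at `1 + π ^ i`. -/
theorem localValue_one_add_pow (hχ : ∀ x, χ.1 x ^ 2 = 1) (hv : Ideal.absNorm v.asIdeal = 2) {π : 𝓞 K} (hπ : π ∈ v.asIdeal)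
    (hπ2 : π ∉ v.asIdeal ^ 2) {i : ℕ} (hi0 : i ≠ 0)
    (hi : ∀ u ∈ unitFiltration v (i + 1), localComponent χ v u = 1) (h : ¬ ∀ u ∈ unitFiltration v i, localComponent χ v u = 1) :
    localValue χ v ((1 + π ^ i : 𝓞 K) : K) = -1 := by
  refine (localValue_eq_one_or hχ ?_).resolve_left fun h1 => h (trivial_of_absNorm_eq_two hv hπ hπ2 hi h1)
  exact notMem_of_sub_one_mem (by simpa using Ideal.pow_mem_of_mem _ hπ i (Nat.pos_of_ne_zero hi0))

end

/-- A sign that separates the elements of Q leaves room for at most two. This is how the sets of two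
characters are counted. -/
theorem eq_pair_of_sign {α : Type*} {Q : Set α} (φ : α → ℂ) (hφ : ∀ η ∈ Q, φ η = 1 ∨ φ η = -1)
    (hinj : ∀ η₁ ∈ Q, ∀ η₂ ∈ Q, φ η₁ = φ η₂ → η₁ = η₂) {η₁ η₂ : α} (h₁ : η₁ ∈ Q) (h₂ : η₂ ∈ Q) (hne : η₁ ≠ η₂) :
    Q = {η₁, η₂} := by
  ext η
  constructor
  · intro hη
    by_contra h
    rw [Set.mem_insert_iff, Set.mem_singleton_iff, not_or] at h
    have e1 : φ η ≠ φ η₁ := fun e => h.1 (hinj _ hη _ h₁ e)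
    have e2 : φ η ≠ φ η₂ := fun e => h.2 (hinj _ hη _ h₂ e)
    have e3 : φ η₁ ≠ φ η₂ := fun e => hne (hinj _ h₁ _ h₂ e)
    rcases hφ η hη with a | a <;> rcases hφ η₁ h₁ with b | b <;> rcases hφ η₂ h₂ with c | c <;> simp [a, b, c] at e1 e2 e3
  · rintro (rfl | rfl)
    · exact h₁
    · exact h₂

theorem localValue_neg_one_prod {χ : ideleClassCharacters K} (hc : ∀ z : (InfiniteAdeleRing K)ˣ, IsSquare z) (hχ : ∀ x, χ.1 x ^ 2 = 1)
    (S : Finset (FinPlace K)) (hS : ∀ v ∉ S, ∀ u ∈ unitFiltration v 0, localComponent χ v u = 1) :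
    ∏ v ∈ S, localValue χ v ((-1 : 𝓞 K) : K) = 1 :=
  prod_localValue_unit hc hχ S hS (-1)

end QuadIdele

/-! ### Odd primes -/

namespace QuadIdele
variable {K : Type*} [Field K] [NumberField K]
namespace IsSqrtGenerator
variable {d : ℕ} {s : K} (H : IsSqrtGenerator d s)
include H

omit [NumberField K] H in
theorem apply_norm_eq {M : ℕ} (χ : ZMod M →* ℤ) {a : 𝓞 K} {m : ℤ} (h : (M : ℤ) ∣ Algebra.norm ℤ a - m) :
    χ ((Algebra.norm ℤ a : ℤ) : ZMod M) = χ (m : ZMod M) := by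
  congr 1
  rw [← sub_eq_zero, ← Int.cast_sub]
  exact (ZMod.intCast_zmod_eq_zero_iff_dvd _ _).2 h

theorem apply_norm_eq_one {M : ℕ} (χ : ZMod M →* ℤ) {a : 𝓞 K} (h : (M : 𝓞 K) ∣ a - 1) :
    χ ((Algebra.norm ℤ a : ℤ) : ZMod M) = 1 := by
  have h1 := H.dvd_norm_sub h
  rw [map_one] at h1
  rw [apply_norm_eq χ h1, Int.cast_one, map_one]

/-- Once uniqueness is known, a single base change of the right conductor proves both existence and
the base change property. -/
theorem existsUnique_of_conductor (hodd : Odd (classNumber K)) {f : Ideal (𝓞 K)} (hf : f ≠ ⊤)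
    (hu : ∀ η₁ ∈ quadraticOfConductor K f, ∀ η₂ ∈ quadraticOfConductor K f, η₁ = η₂) {M : ℕ} (hM : M ≠ 0) (χ : ZMod M →* ℤ)
    (h : ∀ η : ideleClassCharacters K, (∀ x ∈ unitIdeles K, ∀ a, CongrMod M x a → η.1 x = circleSign (χ (Algebra.norm ℤ a : ℤ))) →
      HasConductor η f) :
    (∃! η, η ∈ quadraticOfConductor K f) ∧ ∀ η ∈ quadraticOfConductor K f, IsBaseChange η := by
  obtain ⟨η, hsq, hη, hb⟩ := H.exists_isBaseChange hodd hM χ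
  have hmem := mem_quadraticOfConductor hf hsq (h η hη)
  exact ⟨⟨η, hmem, fun η' h' => hu _ h' _ hmem⟩, fun η' h' => hu _ hmem _ h' ▸ hb⟩

-- If every x² + d were a square, translation by d would permute the finite set of squares. Then 0
-- would be hit, and −d would be a square modulo p.
omit [Field K] [NumberField K] H in
theorem exists_not_isSquare (d p : ℕ) [Fact p.Prime] (hns : ∀ x : ℤ, ¬ (p : ℤ) ∣ x ^ 2 + d) :
    ∃ x : ℤ, quadraticChar (ZMod p) ((x ^ 2 + d : ℤ) : ZMod p) = -1 := by
  by_contra! h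
  have hsq : ∀ x : ZMod p, IsSquare (x ^ 2 + d) := by
    intro x
    obtain ⟨n, rfl⟩ := ZMod.intCast_surjective x
    have h0 : ((n ^ 2 + d : ℤ) : ZMod p) ≠ 0 := by
      rw [Ne, ZMod.intCast_zmod_eq_zero_iff_dvd]
      exact hns n
    have h1 := quadraticChar_one_iff_isSquare h0 |>.1 ((quadraticChar_dichotomy h0).resolve_right (h n))
    push_cast at h1
    exact h1
  let f : {y : ZMod p // IsSquare y} → {y : ZMod p // IsSquare y} := fun y => ⟨y.1 + d, by
    obtain ⟨r, hr⟩ := y.2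
    rw [hr, ← pow_two]
    exact hsq r⟩
  have hf : Function.Injective f := fun a b hab => Subtype.ext (add_right_cancel (congrArg Subtype.val hab))
  obtain ⟨⟨y, r, hr⟩, hy⟩ := (Finite.injective_iff_surjective.1 hf) ⟨0, 0, by simp⟩
  have h3 : y + d = 0 := congrArg Subtype.val hy
  obtain ⟨n, rfl⟩ := ZMod.intCast_surjective r
  apply hns n
  rw [← ZMod.intCast_zmod_eq_zero_iff_dvd]
  push_cast
  rw [pow_two, ← hr, h3]

/-- If p divided x ± √−d, comparing the coefficients of √−d after doubling would give p ∣ 2. -/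
theorem add_root_notMem_of_isInert {p : ℕ} (hp : p.Prime) (hp2 : p ≠ 2) {v : FinPlace K} (hv : IsInert p v) (x : ℤ) :
    (x : 𝓞 K) + H.root ∉ v.asIdeal ∧ (x : 𝓞 K) - H.root ∉ v.asIdeal := by
  have key : ∀ e : ℤ, e = 1 ∨ e = -1 → (x : 𝓞 K) + e * H.root ∉ v.asIdeal := by
    intro e he h
    rw [hv, Ideal.mem_span_singleton] at h
    obtain ⟨z, hz⟩ := h
    obtain ⟨a, b, hab, -⟩ := H.exists_two_mul_eq z
    have h1 := H.eq_zero_int (a := 2 * x - p * a) (b := 2 * e - p * b) (by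
      push_cast
      linear_combination 2 * hz + p * hab)
    have h2 : (p : ℤ) ∣ 2 := by
      rcases he with rfl | rfl
      · exact ⟨b, by linarith [h1.2]⟩
      · exact ⟨-b, by linarith [h1.2]⟩
    exact hp2 ((Nat.prime_dvd_prime_iff_eq hp Nat.prime_two).1 (by exact_mod_cast h2))
  refine ⟨by simpa using key 1 (Or.inl rfl), ?_⟩
  have := key (-1) (Or.inr rfl)
  push_cast at this
  rwa [neg_one_mul, ← sub_eq_add_neg] at this

theorem inert_odd (hodd : Odd (classNumber K)) {p : ℕ} (hp : p.Prime) (hp2 : p ≠ 2) {v : FinPlace K} (hv : IsInert p v) :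
    (∃! η, η ∈ quadraticOfConductor K v.asIdeal) ∧ ∀ η ∈ quadraticOfConductor K v.asIdeal, IsBaseChange η := by
  have : Fact p.Prime := ⟨hp⟩
  have hpv : (p : 𝓞 K) ∈ v.asIdeal := hv ▸ Ideal.mem_span_singleton_self _
  have hmul : ∀ w : FinPlace K, multiplicity w.asIdeal v.asIdeal = 0 ∨ multiplicity w.asIdeal v.asIdeal = 1 := by
    intro w
    by_cases hw : w = v
    · right
      rw [hw]
      have := multiplicity_pow_self v 1
      rwa [pow_one] at this
    · left
      have := multiplicity_pow_of_ne hw 1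
      rwa [pow_one] at this
  refine H.existsUnique_of_conductor hodd v.isPrime.ne_top
    (fun η₁ h₁ η₂ h₂ => eq_of_multiplicity_le_one hodd H.isSquare_infinite hmul h₁ h₂) hp.ne_zero (quadraticChar (ZMod p)).toMonoidHom
    fun η hη => ?_
  -- The element x + √−d has norm x² + d, so a nonresidue of this form makes the character
  -- nontrivial on units. Inertness rules out p ∣ x² + d.
  obtain ⟨x, hx⟩ := exists_not_isSquare d p fun x hx => by
    have h1 : (x + H.root) * (x - H.root) ∈ v.asIdeal := by
      obtain ⟨k, hk⟩ := hx
      have h2 : ((x : 𝓞 K) + H.root) * (x - H.root) = p * k := by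
        have := congrArg (Int.cast (R := 𝓞 K)) hk
        push_cast at this
        linear_combination this - H.root_sq
      rw [h2]
      exact Ideal.mul_mem_right _ _ hpv
    rcases v.isPrime.mem_or_mem h1 with h | h
    · exact (H.add_root_notMem_of_isInert hp hp2 hv x).1 h
    · exact (H.add_root_notMem_of_isInert hp hp2 hv x).2 h
  have := hasConductor_pow_of_apply hp.ne_zero hη (fun a ha => H.apply_norm_eq_one _ ha) (v := v) (n := 1) (by rwa [pow_one])
    (fun w hw => (eq_of_asIdeal_le (by rw [hv, Ideal.span_singleton_le_iff_mem]; exact hw)).symm)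
    (fun a _ ha => H.apply_norm_eq_one _ (by rwa [pow_one, hv, Ideal.mem_span_singleton] at ha))
    ⟨x + H.root, (H.add_root_notMem_of_isInert hp hp2 hv x).1, by simp, ?_⟩
  · rwa [pow_one] at this
  · have h1 := H.norm_add_mul_root x 1
    rw [Int.cast_one, one_mul, one_pow, mul_one] at h1
    rw [h1]
    change quadraticChar (ZMod p) _ ≠ 1
    rw [hx]
    norm_num

/-! ### Split primes: norms at a pair of conjugate places. -/

theorem mem_conjPlace_pow {v : FinPlace K} {a : 𝓞 K} {n : ℕ} (ha : a ∈ v.asIdeal ^ n) : H.conjInt a ∈ (H.conjPlace v).asIdeal ^ n := by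
  have h : ∀ n : ℕ, (v.asIdeal ^ n).comap H.conjInt = (H.conjPlace v).asIdeal ^ n := by
    intro n
    induction n with
    | zero => rw [pow_zero, pow_zero, Ideal.one_eq_top, Ideal.comap_top]
    | succ n ih =>
      rw [pow_succ, pow_succ, comap_conjInt_mul, ih]
      rfl
  rw [← h, Ideal.mem_comap, conjInt_conjInt]
  exact ha

/-- Take a ≡ m at v and a ≡ 1 at w. Conjugation exchanges the two places, so the norm is congruent
to m at both. -/
theorem exists_norm_congr {v w : FinPlace K} (hvw : v ≠ w) (hc : H.conjPlace v = w) {M n : ℕ}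
    (hM : Ideal.span {(M : 𝓞 K)} = (v.asIdeal * w.asIdeal) ^ n) (m : ℤ) :
    ∃ a : 𝓞 K, a - m ∈ v.asIdeal ^ n ∧ a - 1 ∈ w.asIdeal ^ n ∧ (M : ℤ) ∣ Algebra.norm ℤ a - m := by
  have hc' : H.conjPlace w = v := by
    rw [← hc]
    ext a
    rw [mem_conjPlace, mem_conjPlace, conjInt_conjInt]
  have hcop : IsCoprime (v.asIdeal ^ n) (w.asIdeal ^ n) := by
    refine IsCoprime.pow ((Ideal.isCoprime_iff_sup_eq).2 ?_)
    exact v.isMaximal.coprime_of_ne w.isMaximal fun h => hvw (HeightOneSpectrum.ext h)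
  obtain ⟨x, hx, y, hy, hxy⟩ := Ideal.isCoprime_iff_exists.1 hcop
  have hav : 1 + (m - 1) * y - m ∈ v.asIdeal ^ n := by
    have h : 1 + (m - 1) * y - m = (1 - m) * x := by linear_combination (1 - (m : 𝓞 K)) * (-hxy)
    rw [h]
    exact Ideal.mul_mem_left _ _ hx
  have haw : 1 + (m - 1) * y - 1 ∈ w.asIdeal ^ n := by
    rw [add_sub_cancel_left]
    exact Ideal.mul_mem_left _ _ hy
  refine ⟨1 + (m - 1) * y, hav, haw, ?_⟩
  set a := 1 + ((m : 𝓞 K) - 1) * y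
  have h1 := H.mem_conjPlace_pow haw
  have h2 := H.mem_conjPlace_pow hav
  rw [hc', map_sub, map_one] at h1
  rw [hc, map_sub, map_intCast] at h2
  apply int_dvd_of_dvd (K := K)
  rw [Int.cast_sub, ← H.mul_conjInt, Int.cast_natCast, ← Ideal.mem_span_singleton, hM, mul_pow, Ideal.mul_eq_inf_of_coprime (Ideal.isCoprime_iff_sup_eq.1 hcop)]
  refine Ideal.mem_inf.2 ⟨?_, ?_⟩
  · have h3 := add_mem (Ideal.mul_mem_left _ a h1) hav
    convert h3 using 1
    ring
  · have h3 := add_mem (Ideal.mul_mem_left _ (H.conjInt a) haw) h2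
    convert h3 using 1
    ring

/-- By `exists_norm_congr`, each of the two local components behaves like χ itself. An m ≡ 1 modulo
p ^ (n − 1) with χ(m) ≠ 1 therefore shows that exponent n is needed at both places. -/
theorem hasConductor_split {v w : FinPlace K} (hvw : v ≠ w) (hc : H.conjPlace v = w) {p M n : ℕ} (hp : p.Prime) (hn : n ≠ 0)
    (hpvw : v.asIdeal * w.asIdeal = Ideal.span {(p : 𝓞 K)}) (hM : M = p ^ n) (χ : ZMod M →* ℤ) {m : ℤ} (hpm : ¬ (p : ℤ) ∣ m)
    (hm : (p ^ (n - 1) : ℤ) ∣ m - 1) (hχm : χ m ≠ 1) {η : ideleClassCharacters K}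
    (hη : ∀ x ∈ unitIdeles K, ∀ a, CongrMod M x a → η.1 x = circleSign (χ (Algebra.norm ℤ a : ℤ))) :
    HasConductor η ((v.asIdeal * w.asIdeal) ^ n) := by
  have hM0 : M ≠ 0 := hM ▸ pow_ne_zero n hp.ne_zero
  have hMvw : Ideal.span {(M : 𝓞 K)} = (v.asIdeal * w.asIdeal) ^ n := by
    rw [hpvw, Ideal.span_singleton_pow, hM, Nat.cast_pow]
  have hc' : H.conjPlace w = v := by
    rw [← hc]
    ext a
    rw [mem_conjPlace, mem_conjPlace, conjInt_conjInt]
  have key : ∀ u t : FinPlace K, u ≠ t → H.conjPlace u = t → Ideal.span {(M : 𝓞 K)} = (u.asIdeal * t.asIdeal) ^ n →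
      (p : 𝓞 K) ∈ u.asIdeal →
      ∃ a, a ∉ u.asIdeal ∧ a - 1 ∈ u.asIdeal ^ (n - 1) ∧ a - 1 ∈ t.asIdeal ^ n ∧ χ ((Algebra.norm ℤ a : ℤ) : ZMod M) ≠ 1 := by
    intro u t hut hu hMu hpu
    obtain ⟨a, ha, ha1, haN⟩ := H.exists_norm_congr hut hu hMu m
    refine ⟨a, fun h => ?_, ?_, ha1, by rwa [apply_norm_eq χ haN]⟩
    · have h1 : (m : 𝓞 K) ∈ u.asIdeal := by
        simpa using sub_mem h (Ideal.pow_le_self hn ha)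
      obtain ⟨e, f, hef⟩ := ((Nat.prime_iff_prime_int.1 hp).irreducible.coprime_iff_not_dvd.2 hpm)
      have h2 := add_mem (Ideal.mul_mem_left _ (e : 𝓞 K) hpu) (Ideal.mul_mem_left _ (f : 𝓞 K) h1)
      have h3 : (e : 𝓞 K) * p + f * m = 1 := by exact_mod_cast congrArg (Int.cast (R := 𝓞 K)) hef
      rw [h3] at h2
      exact one_notMem h2
    · obtain ⟨k, hk⟩ := hm
      have h2 : (m : 𝓞 K) - 1 = (p : 𝓞 K) ^ (n - 1) * k := by exact_mod_cast congrArg (Int.cast (R := 𝓞 K)) hk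
      have h3 := add_mem (Ideal.pow_le_pow_right (Nat.sub_le n 1) ha) (Ideal.mul_mem_right (k : 𝓞 K) _ (Ideal.pow_mem_pow hpu (n - 1)))
      rw [← h2] at h3
      simpa using h3
  have hpv : (p : 𝓞 K) ∈ v.asIdeal * w.asIdeal := hpvw ▸ Ideal.mem_span_singleton_self _
  exact hasConductor_mul_pow_of_apply hM0 hη (fun a ha => H.apply_norm_eq_one χ ha) hvw hMvw
    (key v w hvw hc hMvw (Ideal.mul_le_left hpv)) (key w v hvw.symm hc' (by rw [hMvw, mul_comm]) (Ideal.mul_le_right hpv))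

theorem split_odd (hd : d.Prime) (hd' : d = 2 ∨ d % 4 = 3) (hodd : Odd (classNumber K)) {p : ℕ} (hp : p.Prime) (hp2 : p ≠ 2)
    {v w : FinPlace K} (hvw : v ≠ w) (hv : LiesAbove p v) (hw : LiesAbove p w) :
    (∃! η, η ∈ quadraticOfConductor K (v.asIdeal * w.asIdeal)) ∧
      ∀ η ∈ quadraticOfConductor K (v.asIdeal * w.asIdeal), IsBaseChange η := by
  have : Fact p.Prime := ⟨hp⟩
  have hmul : ∀ u : FinPlace K, multiplicity u.asIdeal (v.asIdeal * w.asIdeal) = 0 ∨ multiplicity u.asIdeal (v.asIdeal * w.asIdeal) = 1 := by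
    intro u
    rw [← pow_one (v.asIdeal * w.asIdeal)]
    by_cases huv : u = v
    · rw [huv]
      exact Or.inr (multiplicity_mul_pow_left hvw 1)
    by_cases huw : u = w
    · rw [huw]
      exact Or.inr (multiplicity_mul_pow_right hvw 1)
    · exact Or.inl (multiplicity_mul_pow_of_ne huv huw 1)
  have hne : v.asIdeal * w.asIdeal ≠ ⊤ := fun h => v.isPrime.ne_top (top_le_iff.1 (h ▸ Ideal.mul_le_left))
  refine H.existsUnique_of_conductor hodd hne
    (fun η₁ h₁ η₂ h₂ => eq_of_multiplicity_le_one hodd H.isSquare_infinite hmul h₁ h₂) hp.ne_zero (quadraticChar (ZMod p)).toMonoidHom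
    fun η hη => ?_
  obtain ⟨x, hx⟩ := quadraticChar_exists_neg_one (F := ZMod p) (by rwa [ZMod.ringChar_zmod_n])
  obtain ⟨m, rfl⟩ := ZMod.intCast_surjective x
  have h := H.hasConductor_split hvw (H.conjPlace_eq hd hd' hp hvw hv hw) hp one_ne_zero (H.mul_eq_span hp hvw hv hw).1 (pow_one p).symm
    (quadraticChar (ZMod p)).toMonoidHom (m := m) (fun h => ?_) (by simp) ?_ hη
  · rwa [pow_one] at h
  · rw [(ZMod.intCast_zmod_eq_zero_iff_dvd _ _).2 h] at hx
    simp at hx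
  · change quadraticChar (ZMod p) _ ≠ 1
    rw [hx]
    norm_num

end IsSqrtGenerator
end QuadIdele

/-! ### The prime two, split -/

namespace QuadIdele
variable {K : Type*} [Field K] [NumberField K]

theorem ne_of_apply {η₁ η₂ : ideleClassCharacters K} {M : ℕ} {κ₁ κ₂ : 𝓞 K → ℤ}
    (h₁ : ∀ x ∈ unitIdeles K, ∀ a, CongrMod M x a → η₁.1 x = circleSign (κ₁ a))
    (h₂ : ∀ x ∈ unitIdeles K, ∀ a, CongrMod M x a → η₂.1 x = circleSign (κ₂ a)) {v : FinPlace K} {a : 𝓞 K} (hav : a ∉ v.asIdeal)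
    (haw : ∀ w : FinPlace K, w ≠ v → w.intValuation (a - 1) ≤ w.intValuation (M : 𝓞 K)) (hκ₁ : κ₁ a ≠ 1) (hκ₂ : κ₂ a = 1) : η₁ ≠ η₂ := by
  rintro rfl
  have h := (localValue_eq_circleSign h₁ hav haw).symm.trans (localValue_eq_circleSign h₂ hav haw)
  rw [hκ₂, circleSign_one] at h
  exact circleSign_ne_one hκ₁ (Circle.ext h)

section

variable {χ χ' : ideleClassCharacters K} {v : FinPlace K}

theorem mul_inv_trivial_of_succ (hχ : ∀ x, χ.1 x ^ 2 = 1) (hχ' : ∀ x, χ'.1 x ^ 2 = 1) (hv : Ideal.absNorm v.asIdeal = 2) {π : 𝓞 K}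
    (hπ : π ∈ v.asIdeal) (hπ2 : π ∉ v.asIdeal ^ 2) {i : ℕ} (hi0 : i ≠ 0)
    (h1 : ∀ u ∈ unitFiltration v (i + 1), localComponent χ v u = 1) (h0 : ¬ ∀ u ∈ unitFiltration v i, localComponent χ v u = 1)
    (h1' : ∀ u ∈ unitFiltration v (i + 1), localComponent χ' v u = 1) (h0' : ¬ ∀ u ∈ unitFiltration v i, localComponent χ' v u = 1) :
    ∀ u ∈ unitFiltration v i, localComponent (χ * χ'⁻¹) v u = 1 := by
  refine trivial_of_absNorm_eq_two hv hπ hπ2 (mul_inv_trivial h1 h1') (localValue_mul_inv_eq_one hχ ?_ ?_)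
  · exact notMem_of_sub_one_mem (by simpa using Ideal.pow_mem_of_mem _ hπ i (Nat.pos_of_ne_zero hi0))
  · rw [localValue_one_add_pow hχ hv hπ hπ2 hi0 h1 h0, localValue_one_add_pow hχ' hv hπ hπ2 hi0 h1' h0']

omit [NumberField K] in
theorem notMem_sq_of_eq_span {π : 𝓞 K} (hv : v.asIdeal = Ideal.span {π}) : π ∉ v.asIdeal ^ 2 := by
  intro h
  rw [hv, Ideal.span_singleton_pow, Ideal.mem_span_singleton] at h
  obtain ⟨z, hz⟩ := h
  have h0 : π ≠ 0 := fun h0 => v.ne_bot (by rw [hv, h0, Ideal.span_singleton_zero])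
  have h1 : (1 : 𝓞 K) = π * z := mul_left_cancel₀ h0 (by linear_combination hz)
  refine one_notMem (v := v) ?_
  rw [h1, hv]
  exact Ideal.mul_mem_right _ _ (Ideal.mem_span_singleton_self _)

omit [NumberField K] in
theorem neg_one_notMem : (-1 : 𝓞 K) ∉ v.asIdeal := fun h => one_notMem (neg_mem_iff.1 h)

/-- Since 3 ≡ −1 modulo 4, this value is governed by the product formula at −1. The exponent in 2 ^
1 is kept to match 1 + π ^ i. -/
theorem localValue_one_add_two (hχ : ∀ u ∈ unitFiltration v 2, localComponent χ v u = 1) (h2 : (2 : 𝓞 K) ∈ v.asIdeal) :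
    localValue χ v ((1 + 2 ^ 1 : 𝓞 K) : K) = localValue χ v ((-1 : 𝓞 K) : K) := by
  refine localValue_congr hχ (notMem_of_sub_one_mem (by simpa using h2)) neg_one_notMem ?_
  have h3 := Ideal.pow_mem_pow h2 2
  convert h3 using 1
  norm_num

end

namespace IsSqrtGenerator
variable {d : ℕ} {s : K} (H : IsSqrtGenerator d s)
include H

/-- Both residue fields are 𝔽₂. For exponent 3 the value at 5 is forced to be −1, and the value at 3
is free at v. The product formula then settles w, and `ZMod.χ₈` and `ZMod.χ₈'` realise the two
choices. -/
theorem split_two (hd : d.Prime) (hd' : d = 2 ∨ d % 4 = 3) (hodd : Odd (classNumber K)) {v w : FinPlace K} (hvw : v ≠ w)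
    (hv : LiesAbove 2 v) (hw : LiesAbove 2 w) :
    (∃! η, η ∈ quadraticOfConductor K ((v.asIdeal * w.asIdeal) ^ 2)) ∧
      (∀ η ∈ quadraticOfConductor K ((v.asIdeal * w.asIdeal) ^ 2), IsBaseChange η) ∧
      (quadraticOfConductor K ((v.asIdeal * w.asIdeal) ^ 3)).ncard = 2 ∧
      (∀ η₁ ∈ quadraticOfConductor K ((v.asIdeal * w.asIdeal) ^ 3),
        ∀ η₂ ∈ quadraticOfConductor K ((v.asIdeal * w.asIdeal) ^ 3),
        (∀ u ∈ unitFiltration v 0, localComponent η₁ v u = localComponent η₂ v u) → η₁ = η₂) ∧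
      ∀ η ∈ quadraticOfConductor K ((v.asIdeal * w.asIdeal) ^ 3), IsBaseChange η := by
  have hc := H.isSquare_infinite
  have hconj := H.conjPlace_eq hd hd' Nat.prime_two hvw hv hw
  obtain ⟨hspan, hvn⟩ := H.mul_eq_span Nat.prime_two hvw hv hw
  obtain ⟨-, hwn⟩ := H.mul_eq_span Nat.prime_two hvw.symm hw hv
  have hv2 : (2 : 𝓞 K) ∈ v.asIdeal := by exact_mod_cast hv
  have hw2 : (2 : 𝓞 K) ∈ w.asIdeal := by exact_mod_cast hw
  rw [Nat.cast_ofNat] at hspan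
  have hv22 : (2 : 𝓞 K) ∉ v.asIdeal ^ 2 := fun h => by
    rw [← Ideal.dvd_span_singleton, ← hspan, pow_two] at h
    have h1 := (mul_dvd_mul_iff_left v.ne_bot).1 h
    exact hvw (eq_of_asIdeal_le (Ideal.le_of_dvd h1)).symm
  have hw22 : (2 : 𝓞 K) ∉ w.asIdeal ^ 2 := fun h => by
    rw [← Ideal.dvd_span_singleton, ← hspan, pow_two] at h
    have h1 := (mul_dvd_mul_iff_right w.ne_bot).1 h
    exact hvw.symm (eq_of_asIdeal_le (Ideal.le_of_dvd h1)).symm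
  have hne (n : ℕ) (hn : n ≠ 0) : (v.asIdeal * w.asIdeal) ^ n ≠ ⊤ := fun h =>
    v.isPrime.ne_top (top_le_iff.1 (h ▸ (Ideal.pow_le_self hn).trans Ideal.mul_le_left))
  have huniq : ∀ η₁ ∈ quadraticOfConductor K ((v.asIdeal * w.asIdeal) ^ 2),
      ∀ η₂ ∈ quadraticOfConductor K ((v.asIdeal * w.asIdeal) ^ 2), η₁ = η₂ := by
    intro η₁ h₁ η₂ h₂
    have hs₁ := sq_eq_one_of_orderOf h₁.1
    have hs₂ := sq_eq_one_of_orderOf h₂.1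
    refine eq_of_mul_inv hodd hc hs₁ hs₂ fun u => ?_
    by_cases huv : u = v
    · subst huv
      have hm := multiplicity_mul_pow_left hvw 2
      exact trivial_zero_of_absNorm_eq_two hvn (mul_inv_trivial_of_succ hs₁ hs₂ hvn hv2 hv22 one_ne_zero (h₁.2.eq_one hm)
        (h₁.2.not_eq_one (by rw [hm]; norm_num)) (h₂.2.eq_one hm) (h₂.2.not_eq_one (by rw [hm]; norm_num)))
    by_cases huw : u = w
    · subst huw
      have hm := multiplicity_mul_pow_right hvw 2
      exact trivial_zero_of_absNorm_eq_two hwn (mul_inv_trivial_of_succ hs₁ hs₂ hwn hw2 hw22 one_ne_zero (h₁.2.eq_one hm)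
        (h₁.2.not_eq_one (by rw [hm]; norm_num)) (h₂.2.eq_one hm) (h₂.2.not_eq_one (by rw [hm]; norm_num)))
    have hm := multiplicity_mul_pow_of_ne huv huw 2
    exact mul_inv_trivial (h₁.2.eq_one hm) (h₂.2.eq_one hm)
  have hinj : ∀ η₁ ∈ quadraticOfConductor K ((v.asIdeal * w.asIdeal) ^ 3),
      ∀ η₂ ∈ quadraticOfConductor K ((v.asIdeal * w.asIdeal) ^ 3),
      localValue η₁ v ((1 + 2 ^ 1 : 𝓞 K) : K) = localValue η₂ v ((1 + 2 ^ 1 : 𝓞 K) : K) → η₁ = η₂ := by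
    intro η₁ h₁ η₂ h₂ h
    have hs₁ := sq_eq_one_of_orderOf h₁.1
    have hs₂ := sq_eq_one_of_orderOf h₂.1
    have hmv := multiplicity_mul_pow_left hvw 3
    have hmw := multiplicity_mul_pow_right hvw 3
    have htv := mul_inv_trivial_of_succ hs₁ hs₂ hvn hv2 hv22 two_ne_zero (h₁.2.eq_one hmv)
        (h₁.2.not_eq_one (by rw [hmv]; norm_num)) (h₂.2.eq_one hmv) (h₂.2.not_eq_one (by rw [hmv]; norm_num))
    have htw := mul_inv_trivial_of_succ hs₁ hs₂ hwn hw2 hw22 two_ne_zero (h₁.2.eq_one hmw)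
        (h₁.2.not_eq_one (by rw [hmw]; norm_num)) (h₂.2.eq_one hmw) (h₂.2.not_eq_one (by rw [hmw]; norm_num))
    have htu : ∀ u : FinPlace K, u ≠ v → u ≠ w → ∀ x ∈ unitFiltration u 0, localComponent (η₁ * η₂⁻¹) u x = 1 := fun u huv huw => by
      have hm := multiplicity_mul_pow_of_ne huv huw 3
      exact mul_inv_trivial (h₁.2.eq_one hm) (h₂.2.eq_one hm)
    have hlv : localValue (η₁ * η₂⁻¹) v ((1 + 2 ^ 1 : 𝓞 K) : K) = 1 :=
      localValue_mul_inv_eq_one hs₁ (notMem_of_sub_one_mem (by simpa using hv2)) h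
    -- The quotient is trivial on units congruent to 1 modulo 4, so its values at 3 and −1 agree at
    -- both places. The product formula at −1 carries triviality from v to w.
    have hlw : localValue (η₁ * η₂⁻¹) w ((1 + 2 ^ 1 : 𝓞 K) : K) = 1 := by
      classical
      have hp := localValue_neg_one_prod hc (sq_mul_inv hs₁ hs₂) {v, w} fun u hu => by
        rw [Finset.mem_insert, Finset.mem_singleton, not_or] at hu
        exact htu u hu.1 hu.2
      rwa [Finset.prod_pair hvw, ← localValue_one_add_two htv hv2, ← localValue_one_add_two htw hw2, hlv, one_mul] at hp
    refine eq_of_mul_inv hodd hc hs₁ hs₂ fun u => ?_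
    by_cases huv : u = v
    · subst huv
      exact trivial_zero_of_absNorm_eq_two hvn (trivial_of_absNorm_eq_two hvn hv2 hv22 htv hlv)
    by_cases huw : u = w
    · subst huw
      exact trivial_zero_of_absNorm_eq_two hwn (trivial_of_absNorm_eq_two hwn hw2 hw22 htw hlw)
    exact htu u huv huw
  have hspan' : v.asIdeal * w.asIdeal = Ideal.span {((2 : ℕ) : 𝓞 K)} := by rw [hspan, Nat.cast_ofNat]
  obtain ⟨hu2, hb2⟩ := H.existsUnique_of_conductor hodd (hne 2 two_ne_zero) huniq four_ne_zero ZMod.χ₄.toMonoidHom fun η hη =>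
    H.hasConductor_split hvw hconj Nat.prime_two two_ne_zero hspan' (by norm_num) ZMod.χ₄.toMonoidHom (m := 3) (by norm_num) (by norm_num)
      (by decide) hη
  obtain ⟨η₁, hs₁, h₁, hb₁⟩ := H.exists_isBaseChange hodd (M := 8) (by norm_num) ZMod.χ₈.toMonoidHom
  obtain ⟨η₂, hs₂, h₂, hb₂⟩ := H.exists_isBaseChange hodd (M := 8) (by norm_num) ZMod.χ₈'.toMonoidHom
  have hm₁ := mem_quadraticOfConductor (hne 3 three_ne_zero) hs₁
    (H.hasConductor_split hvw hconj Nat.prime_two three_ne_zero hspan' (by norm_num) ZMod.χ₈.toMonoidHom (m := 5) (by norm_num) (by norm_num)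
      (by decide) h₁)
  have hm₂ := mem_quadraticOfConductor (hne 3 three_ne_zero) hs₂
    (H.hasConductor_split hvw hconj Nat.prime_two three_ne_zero hspan' (by norm_num) ZMod.χ₈'.toMonoidHom (m := 5) (by norm_num) (by norm_num)
      (by decide) h₂)
  have hne12 : η₁ ≠ η₂ := by
    have h8 : Ideal.span {((8 : ℕ) : 𝓞 K)} = (v.asIdeal * w.asIdeal) ^ 3 := by
      rw [hspan, Ideal.span_singleton_pow]
      norm_num
    -- Norm 3 modulo 8 separates `ZMod.χ₈` and `ZMod.χ₈'`, whose values there are −1 and 1.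
    obtain ⟨a, ha, ha1, haN⟩ := H.exists_norm_congr hvw hconj h8 3
    refine ne_of_apply h₁ h₂ (v := v) (a := a) (notMem_of_sub_one_mem ?_) (fun u hu => ?_) ?_ ?_
    · have h3 := add_mem (Ideal.pow_le_self three_ne_zero ha) hv2
      convert h3 using 1
      push_cast
      ring
    · by_cases huw : u = w
      · subst huw
        have h3 : u.intValuation ((8 : ℕ) : 𝓞 K) = WithZero.exp (-((3 : ℕ) : ℤ)) := by
          rw [show ((8 : ℕ) : 𝓞 K) = 2 ^ 3 by norm_num, map_pow, intValuation_uniformizer hw2 hw22, ← WithZero.exp_nsmul]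
          rfl
        rw [h3, intValuation_le_pow_iff_mem]
        exact ha1
      · refine intValuation_le_of_notMem (fun h => ?_) _
        rw [← Ideal.dvd_span_singleton, h8] at h
        rcases (Prime.dvd_mul u.prime).1 (u.prime.dvd_of_dvd_pow h) with h | h
        · exact hu (eq_of_asIdeal_le (Ideal.le_of_dvd h)).symm
        · exact huw (eq_of_asIdeal_le (Ideal.le_of_dvd h)).symm
    · rw [apply_norm_eq _ haN]
      decide
    · rw [apply_norm_eq _ haN]
      decide
  have hpair := eq_pair_of_sign (fun η : ideleClassCharacters K => localValue η v ((1 + 2 ^ 1 : 𝓞 K) : K))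
    (fun η hη => localValue_eq_one_or (sq_eq_one_of_orderOf hη.1) (notMem_of_sub_one_mem (by simpa using hv2))) hinj hm₁ hm₂ hne12
  refine ⟨hu2, hb2, by rw [hpair, Set.ncard_pair hne12], fun θ₁ g₁ θ₂ g₂ h => hinj θ₁ g₁ θ₂ g₂ ?_, fun η hη => ?_⟩
  · have hv3 : (1 + 2 ^ 1 : 𝓞 K) ∉ v.asIdeal := notMem_of_sub_one_mem (by simpa using hv2)
    rw [localValue_of_ne_zero _ (algebraMap_int_ne_zero hv3), localValue_of_ne_zero _ (algebraMap_int_ne_zero hv3), h]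
    exact mem_unitFiltration_zero.2 (valued_eq_one_of_notMem hv3)
  · rw [hpair] at hη
    rcases hη with rfl | rfl
    · exact hb₁
    · exact hb₂

end IsSqrtGenerator
end QuadIdele

/-! ### The prime two, inert -/

namespace QuadIdele
variable {K : Type*} [Field K] [NumberField K]

theorem multiplicity_pow_self_or (u v : FinPlace K) (n : ℕ) : u = v ∨ multiplicity u.asIdeal (v.asIdeal ^ n) = 0 := by
  by_cases h : u = v
  · exact Or.inl h
  · exact Or.inr (multiplicity_pow_of_ne h n)

section single

variable {χ χ' : ideleClassCharacters K} {v : FinPlace K} {n : ℕ}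

theorem quadraticOfConductor_pow_eq (hodd : Odd (classNumber K)) (hc : ∀ z : (InfiniteAdeleRing K)ˣ, IsSquare z)
    (h : χ ∈ quadraticOfConductor K (v.asIdeal ^ n)) (h' : χ' ∈ quadraticOfConductor K (v.asIdeal ^ n))
    (hv : ∀ u ∈ unitFiltration v 0, localComponent (χ * χ'⁻¹) v u = 1) : χ = χ' := by
  refine eq_of_mul_inv hodd hc (sq_eq_one_of_orderOf h.1) (sq_eq_one_of_orderOf h'.1) fun u => ?_
  rcases multiplicity_pow_self_or u v n with rfl | hm
  · exact hv
  · exact mul_inv_trivial (h.2.eq_one hm) (h'.2.eq_one hm)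

theorem localValue_neg_one (hc : ∀ z : (InfiniteAdeleRing K)ˣ, IsSquare z) (h : χ ∈ quadraticOfConductor K (v.asIdeal ^ n)) :
    localValue χ v ((-1 : 𝓞 K) : K) = 1 := by
  have h1 := localValue_neg_one_prod hc (sq_eq_one_of_orderOf h.1) {v} fun u hu =>
    h.2.eq_one (multiplicity_pow_of_ne (fun e => hu (Finset.mem_singleton.2 e)) n)
  rwa [Finset.prod_singleton] at h1

theorem HasConductor.not_eq_one_pow (h : HasConductor χ (v.asIdeal ^ n)) {m : ℕ} (hm : m < n) :
    ¬ ∀ u ∈ unitFiltration v m, localComponent χ v u = 1 :=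
  h.not_eq_one (by rwa [multiplicity_pow_self])

theorem HasConductor.eq_one_pow (h : HasConductor χ (v.asIdeal ^ n)) : ∀ u ∈ unitFiltration v n, localComponent χ v u = 1 :=
  h.eq_one (multiplicity_pow_self v n)

end single

omit [NumberField K] in
theorem pow_ne_top (v : FinPlace K) {n : ℕ} (hn : n ≠ 0) : v.asIdeal ^ n ≠ ⊤ := fun h =>
  v.isPrime.ne_top (top_le_iff.1 (h ▸ Ideal.pow_le_self hn))

namespace IsSqrtGenerator
variable {d : ℕ} {s : K} (H : IsSqrtGenerator d s)
include H

/-- For d = 2 the prime 2 ramifies. For d ≡ 7 modulo 8 it divides θ (θ − 1) but neither factor, so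
it does not stay prime. -/
theorem mod_eight_of_isInert (hd' : d = 2 ∨ d % 4 = 3) {v : FinPlace K} (hv : v.asIdeal = Ideal.span {(2 : 𝓞 K)}) : d % 8 = 3 := by
  have h2v : (2 : 𝓞 K) ∈ v.asIdeal := hv ▸ Ideal.mem_span_singleton_self _
  have hnot : ∀ m n : ℤ, ¬ Even n → ∀ z : 𝓞 K, (m : 𝓞 K) + n * H.root ≠ 4 * z := by
    intro m n hn z hz
    obtain ⟨a, b, hab, -⟩ := H.exists_two_mul_eq z
    have h1 := H.eq_zero_int (a := m - 2 * a) (b := n - 2 * b) (by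
      push_cast
      linear_combination hz + 2 * hab)
    exact hn ⟨b, by lia⟩
  rcases hd' with rfl | hd
  · exfalso
    have h1 : H.root ∈ v.asIdeal := H.root_mem_of_natCast_mem (by exact_mod_cast h2v)
    rw [hv, Ideal.mem_span_singleton] at h1
    obtain ⟨z, hz⟩ := h1
    obtain ⟨a, b, rfl⟩ := H.exists_eq_add_mul_root z
    have h2 := H.eq_zero_int (a := 2 * a) (b := 2 * b - 1) (by
      push_cast
      linear_combination -hz)
    lia
  · by_contra h8
    obtain ⟨k, hk⟩ : ∃ k, d = 8 * k + 7 := ⟨d / 8, by lia⟩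
    have hk' : (d : 𝓞 K) = 8 * k + 7 := by exact_mod_cast congrArg (Nat.cast (R := 𝓞 K)) hk
    obtain ⟨θ, hθ⟩ := H.exists_half hd
    have h1 : θ * (θ - 1) = 2 * (-(k + 1)) := by
      refine mul_left_cancel₀ (OfNat.ofNat_ne_zero 4 : (4 : 𝓞 K) ≠ 0) ?_
      linear_combination (2 * θ - 1 + H.root) * hθ + H.root_sq - hk'
    have h3 : θ * (θ - 1) ∈ v.asIdeal := h1 ▸ Ideal.mul_mem_right _ _ h2v
    rcases v.isPrime.mem_or_mem h3 with h | h
    all_goals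
      rw [hv, Ideal.mem_span_singleton] at h
      obtain ⟨z, hz⟩ := h
    · refine hnot 1 1 (by decide) z ?_
      push_cast
      linear_combination 2 * hz - hθ
    · refine hnot (-1) 1 (by decide) z ?_
      push_cast
      linear_combination 2 * hz - hθ

theorem exists_residue_of_inert_two {v : FinPlace K} (hv : v.asIdeal = Ideal.span {(2 : 𝓞 K)}) (hd : d % 4 = 3) {θ : 𝓞 K}
    (hθ : 2 * θ = 1 + H.root) (b : 𝓞 K) : ∃ r : 𝓞 K, (r = 0 ∨ r = 1 ∨ r = θ ∨ r = 1 + θ) ∧ b - r ∈ v.asIdeal := by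
  obtain ⟨m, n, rfl⟩ := H.exists_eq_add_mul_half hd hθ b
  rw [hv]
  simp only [Ideal.mem_span_singleton]
  rcases Int.even_or_odd' m with ⟨e, rfl | rfl⟩ <;> rcases Int.even_or_odd' n with ⟨f, rfl | rfl⟩
  · exact ⟨0, by simp, e + f * θ, by push_cast; ring⟩
  · exact ⟨θ, by simp, e + f * θ, by push_cast; ring⟩
  · exact ⟨1, by simp, e + f * θ, by push_cast; ring⟩
  · exact ⟨1 + θ, by simp, e + f * θ, by push_cast; ring⟩

/-- The graded piece is 𝔽₄, generated by the classes of 1 + 2 ^ i and 1 + 2 ^ i θ. The remaining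
class is their product, because 2i ≥ i + 1. -/
theorem trivial_of_inert_two {v : FinPlace K} (hv : v.asIdeal = Ideal.span {(2 : 𝓞 K)}) (hd : d % 4 = 3) {θ : 𝓞 K}
    (hθ : 2 * θ = 1 + H.root) {χ : ideleClassCharacters K} {i : ℕ} (hi0 : i ≠ 0)
    (hi : ∀ u ∈ unitFiltration v (i + 1), localComponent χ v u = 1)
    (h1 : localValue χ v ((1 + 2 ^ i : 𝓞 K) : K) = 1) (hθ1 : localValue χ v ((1 + 2 ^ i * θ : 𝓞 K) : K) = 1) :
    ∀ u ∈ unitFiltration v i, localComponent χ v u = 1 := by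
  have h2v : (2 : 𝓞 K) ∈ v.asIdeal := hv ▸ Ideal.mem_span_singleton_self _
  have h2i : ∀ a : 𝓞 K, 1 + 2 ^ i * a ∉ v.asIdeal := fun a => notMem_of_sub_one_mem (by
    rw [add_sub_cancel_left]
    exact Ideal.mul_mem_right _ _ (Ideal.pow_mem_of_mem _ h2v i (Nat.pos_of_ne_zero hi0)))
  have h11 : localValue χ v ((1 + 2 ^ i * (1 + θ) : 𝓞 K) : K) = 1 := by
    have h3 : localValue χ v ((1 + 2 ^ i * (1 + θ) : 𝓞 K) : K) = localValue χ v (((1 + 2 ^ i * 1) * (1 + 2 ^ i * θ) : 𝓞 K) : K) := by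
      refine localValue_congr hi (h2i _) (v.isPrime.mul_notMem (h2i _) (h2i _)) ?_
      have h4 : (1 + 2 ^ i * (1 + θ)) - (1 + 2 ^ i * 1) * (1 + 2 ^ i * θ) = 2 ^ (i + i) * (-θ) := by ring
      rw [h4]
      exact Ideal.mul_mem_right _ _ (Ideal.pow_le_pow_right (by lia) (Ideal.pow_mem_pow h2v (i + i)))
    rw [h3, localValue_mul_int, mul_one, h1, hθ1, one_mul]
  refine trivial_of_residues h2v (notMem_sq_of_eq_span hv) hi fun b => ?_
  obtain ⟨r, hr, hbr⟩ := H.exists_residue_of_inert_two hv hd hθ b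
  refine ⟨r, hbr, ?_⟩
  rcases hr with rfl | rfl | rfl | rfl
  · rw [mul_zero, add_zero]
    exact (congrArg _ (map_one (algebraMap (𝓞 K) K))).trans (localValue_one χ)
  · rwa [mul_one]
  · exact hθ1
  · exact h11

/-- The group 𝔽₄ˣ has order 3: r³ ≡ 1, so a ±1-valued character is trivial at r. -/
theorem trivial_zero_of_inert_two {v : FinPlace K} (hv : v.asIdeal = Ideal.span {(2 : 𝓞 K)}) (hd : d % 8 = 3) {θ : 𝓞 K}
    (hθ : 2 * θ = 1 + H.root) {χ : ideleClassCharacters K} (hχ : ∀ x, χ.1 x ^ 2 = 1)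
    (hi : ∀ u ∈ unitFiltration v 1, localComponent χ v u = 1) : ∀ u ∈ unitFiltration v 0, localComponent χ v u = 1 := by
  have h2v : (2 : 𝓞 K) ∈ v.asIdeal := hv ▸ Ideal.mem_span_singleton_self _
  obtain ⟨k, hk⟩ : ∃ k, d = 8 * k + 3 := ⟨d / 8, by lia⟩
  have hk' : (d : 𝓞 K) = 8 * k + 3 := by exact_mod_cast congrArg (Nat.cast (R := 𝓞 K)) hk
  have hsq : θ ^ 2 = θ - (2 * k + 1) := by
    refine mul_left_cancel₀ (OfNat.ofNat_ne_zero 4 : (4 : 𝓞 K) ≠ 0) ?_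
    linear_combination (2 * θ - 1 + H.root) * hθ + H.root_sq - hk'
  refine trivial_on_unitFiltration_of_succ hi fun a ha _ => ?_
  obtain ⟨r, hr, har⟩ := H.exists_residue_of_inert_two hv (by lia) hθ a
  have hr0 : r ∉ v.asIdeal := fun h => ha (by simpa using add_mem har h)
  refine ⟨r, by rwa [zero_add, pow_one], ?_⟩
  have hcube : r ^ 2 * r - 1 ∈ v.asIdeal := by
    rw [hv, Ideal.mem_span_singleton]
    rcases hr with rfl | rfl | rfl | rfl
    · exact absurd (zero_mem _) hr0
    · simp
    · exact ⟨-k * r - k - 1, by linear_combination (r + 1) * hsq⟩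
    · exact ⟨-k * θ + 3 * θ - 4 * k - 2, by linear_combination (θ + 4) * hsq⟩
  have h1 : localValue χ v ((r ^ 2 * r : 𝓞 K) : K) = localValue χ v ((1 : 𝓞 K) : K) :=
    localValue_congr hi (notMem_of_sub_one_mem hcube) one_notMem (by rwa [pow_one])
  rw [localValue_mul_int, localValue_sq hχ hr0, one_mul] at h1
  rw [h1]
  exact (congrArg _ (map_one (algebraMap (𝓞 K) K))).trans (localValue_one χ)

/-- For exponent 2 the value at 3 ≡ −1 is 1, which forces −1 at 1 + 2θ. For exponent 3 the value at
5 is 1, which forces −1 at 1 + 4θ and leaves the sign at 1 + 2θ free. -/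
theorem inert_two (hd' : d = 2 ∨ d % 4 = 3) (hodd : Odd (classNumber K)) {v : FinPlace K} (hv : IsInert 2 v) :
    ((∃! η, η ∈ quadraticOfConductor K (v.asIdeal ^ 2)) ∧ ∀ η ∈ quadraticOfConductor K (v.asIdeal ^ 2), IsBaseChange η) ∧
      (quadraticOfConductor K (v.asIdeal ^ 3)).ncard = 2 ∧ ∀ η ∈ quadraticOfConductor K (v.asIdeal ^ 3), IsBaseChange η := by
  have hc := H.isSquare_infinite
  replace hv : v.asIdeal = Ideal.span {(2 : 𝓞 K)} := by exact_mod_cast hv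
  have h2v : (2 : 𝓞 K) ∈ v.asIdeal := hv ▸ Ideal.mem_span_singleton_self _
  have hd := H.mod_eight_of_isInert hd' hv
  have hd4 : d % 4 = 3 := by lia
  obtain ⟨θ, hθ⟩ := H.exists_half hd4
  have hθv : 1 + 2 ^ 1 * θ ∉ v.asIdeal := notMem_of_sub_one_mem (by
    rw [add_sub_cancel_left, pow_one]
    exact Ideal.mul_mem_right _ _ h2v)
  have hone : ∀ {n : ℕ} {η}, 2 ≤ n → η ∈ quadraticOfConductor K (v.asIdeal ^ n) → (∀ u ∈ unitFiltration v 2, localComponent η v u = 1) →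
      localValue η v ((1 + 2 ^ 1 : 𝓞 K) : K) = 1 := fun hn h h2 => (localValue_one_add_two h2 h2v).trans (localValue_neg_one hc h)
  have huniq : ∀ η₁ ∈ quadraticOfConductor K (v.asIdeal ^ 2), ∀ η₂ ∈ quadraticOfConductor K (v.asIdeal ^ 2), η₁ = η₂ := by
    have hval : ∀ η ∈ quadraticOfConductor K (v.asIdeal ^ 2), localValue η v ((1 + 2 ^ 1 * θ : 𝓞 K) : K) = -1 := fun η h => by
      refine (localValue_eq_one_or (sq_eq_one_of_orderOf h.1) hθv).resolve_left fun h1 => h.2.not_eq_one_pow one_lt_two ?_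
      exact H.trivial_of_inert_two hv hd4 hθ one_ne_zero h.2.eq_one_pow (hone le_rfl h h.2.eq_one_pow) h1
    intro η₁ h₁ η₂ h₂
    have hs₁ := sq_eq_one_of_orderOf h₁.1
    refine quadraticOfConductor_pow_eq hodd hc h₁ h₂ (H.trivial_zero_of_inert_two hv hd hθ (sq_mul_inv hs₁ (sq_eq_one_of_orderOf h₂.1)) ?_)
    refine H.trivial_of_inert_two hv hd4 hθ one_ne_zero (mul_inv_trivial h₁.2.eq_one_pow h₂.2.eq_one_pow) ?_ ?_
    · exact localValue_mul_inv_eq_one hs₁ (notMem_of_sub_one_mem (by simpa using h2v))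
        ((hone le_rfl h₁ h₁.2.eq_one_pow).trans (hone le_rfl h₂ h₂.2.eq_one_pow).symm)
    · exact localValue_mul_inv_eq_one hs₁ hθv ((hval _ h₁).trans (hval _ h₂).symm)
  -- Here θ² + θ ≡ 1 modulo 2, so (1 + 2θ)² ≡ 5 modulo 8.
  have h4θ : ∀ η ∈ quadraticOfConductor K (v.asIdeal ^ 3), localValue η v ((1 + 2 ^ 2 : 𝓞 K) : K) = 1 := fun η h => by
    rw [← localValue_sq (sq_eq_one_of_orderOf h.1) hθv]
    refine localValue_congr h.2.eq_one_pow (notMem_of_sub_one_mem ?_) (fun h => hθv (v.isPrime.mem_of_pow_mem 2 h)) ?_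
    · rw [add_sub_cancel_left]
      exact Ideal.pow_mem_of_mem _ h2v 2 two_pos
    · rw [hv, Ideal.span_singleton_pow, Ideal.mem_span_singleton]
      obtain ⟨k, hk⟩ : ∃ k, d = 8 * k + 3 := ⟨d / 8, by lia⟩
      have hk' : (d : 𝓞 K) = 8 * k + 3 := by exact_mod_cast congrArg (Nat.cast (R := 𝓞 K)) hk
      have hsq : 4 * θ ^ 2 = 4 * θ - (8 * k + 4) := by
        linear_combination (2 * θ - 1 + H.root) * hθ + H.root_sq - hk'
      exact ⟨1 + k - θ, by linear_combination -hsq⟩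
  have hinj : ∀ η₁ ∈ quadraticOfConductor K (v.asIdeal ^ 3), ∀ η₂ ∈ quadraticOfConductor K (v.asIdeal ^ 3),
      localValue η₁ v ((1 + 2 ^ 1 * θ : 𝓞 K) : K) = localValue η₂ v ((1 + 2 ^ 1 * θ : 𝓞 K) : K) → η₁ = η₂ := by
    have h4v : (1 + 2 ^ 2 * θ : 𝓞 K) ∉ v.asIdeal := notMem_of_sub_one_mem (by
      rw [add_sub_cancel_left]
      exact Ideal.mul_mem_right _ _ (Ideal.pow_mem_of_mem _ h2v 2 two_pos))
    have hval : ∀ η ∈ quadraticOfConductor K (v.asIdeal ^ 3), localValue η v ((1 + 2 ^ 2 * θ : 𝓞 K) : K) = -1 := fun η h => by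
      refine (localValue_eq_one_or (sq_eq_one_of_orderOf h.1) h4v).resolve_left fun h1 => h.2.not_eq_one_pow (Nat.lt_succ_self 2) ?_
      exact H.trivial_of_inert_two hv hd4 hθ two_ne_zero h.2.eq_one_pow (h4θ η h) h1
    intro η₁ h₁ η₂ h₂ h
    have hs₁ := sq_eq_one_of_orderOf h₁.1
    have hs := sq_mul_inv hs₁ (sq_eq_one_of_orderOf h₂.1)
    have ht2 : ∀ u ∈ unitFiltration v 2, localComponent (η₁ * η₂⁻¹) v u = 1 := by
      refine H.trivial_of_inert_two hv hd4 hθ two_ne_zero (mul_inv_trivial h₁.2.eq_one_pow h₂.2.eq_one_pow) ?_ ?_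
      · exact localValue_mul_inv_eq_one hs₁ (notMem_of_sub_one_mem (by simpa using Ideal.pow_mem_of_mem _ h2v 2 two_pos))
          ((h4θ _ h₁).trans (h4θ _ h₂).symm)
      · exact localValue_mul_inv_eq_one hs₁ h4v ((hval _ h₁).trans (hval _ h₂).symm)
    refine quadraticOfConductor_pow_eq hodd hc h₁ h₂ (H.trivial_zero_of_inert_two hv hd hθ hs
      (H.trivial_of_inert_two hv hd4 hθ one_ne_zero ht2 ?_ (localValue_mul_inv_eq_one hs₁ hθv h)))
    rw [localValue_one_add_two ht2 h2v]
    exact localValue_mul_inv_eq_one hs₁ neg_one_notMem ((localValue_neg_one hc h₁).trans (localValue_neg_one hc h₂).symm)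
  have hunique : ∀ n : ℕ, ∀ w : FinPlace K, ((2 ^ n : ℕ) : 𝓞 K) ∈ w.asIdeal → w = v := fun n w hw => by
    rw [Nat.cast_pow] at hw
    refine (eq_of_asIdeal_le ?_).symm
    rw [hv, Ideal.span_singleton_le_iff_mem]
    exact_mod_cast w.isPrime.mem_of_pow_mem n hw
  have hpow : ∀ n : ℕ, v.asIdeal ^ n = Ideal.span {((2 ^ n : ℕ) : 𝓞 K)} := fun n => by
    rw [hv, Ideal.span_singleton_pow]
    push_cast
    rfl
  have hcond : ∀ (n : ℕ) (χ : ZMod (2 ^ n) →* ℤ) (a : 𝓞 K) (m : ℤ), n ≠ 0 → a ∉ v.asIdeal → a - 1 ∈ v.asIdeal ^ (n - 1) →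
      ((2 ^ n : ℕ) : ℤ) ∣ Algebra.norm ℤ a - m → χ m ≠ 1 → ∀ η : ideleClassCharacters K,
      (∀ x ∈ unitIdeles K, ∀ a, CongrMod (2 ^ n) x a → η.1 x = circleSign (χ (Algebra.norm ℤ a : ℤ))) →
      HasConductor η (v.asIdeal ^ n) := by
    intro n χ a m hn ha ha1 hN hm η hη
    refine hasConductor_pow_of_apply (pow_ne_zero n two_ne_zero) hη (fun a ha => H.apply_norm_eq_one χ ha) ?_ (hunique n)
      (fun a _ ha => H.apply_norm_eq_one χ ?_) ⟨a, ha, ha1, by rwa [apply_norm_eq χ hN]⟩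
    · rw [hpow]
      exact Ideal.mem_span_singleton_self _
    · rwa [hpow, Ideal.mem_span_singleton] at ha
  -- Since d ≡ 3 modulo 8, the norms of 1 + 2θ and 1 + 4θ are 7 and 5 modulo 8. The first detects
  -- `ZMod.χ₄` and separates `ZMod.χ₈` from `ZMod.χ₈'`; the second detects exponent 3 for both of
  -- these.
  have hN2 : Algebra.norm ℤ (1 + 2 ^ 1 * θ) = 4 + d := by
    have h1 := H.norm_add_mul_root 2 1
    have h2 : (1 + 2 ^ 1 * θ : 𝓞 K) = (2 : ℤ) + (1 : ℤ) * H.root := by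
      push_cast
      linear_combination hθ
    rw [h2, h1]
    ring
  have hN4 : Algebra.norm ℤ (1 + 2 ^ 2 * θ) = 9 + 4 * d := by
    have h1 := H.norm_add_mul_root 3 2
    have h2 : (1 + 2 ^ 2 * θ : 𝓞 K) = (3 : ℤ) + (2 : ℤ) * H.root := by
      push_cast
      linear_combination 2 * hθ
    rw [h2, h1]
    ring
  have h4v : (1 + 2 ^ 2 * θ : 𝓞 K) ∉ v.asIdeal := notMem_of_sub_one_mem (by
    rw [add_sub_cancel_left]
    exact Ideal.mul_mem_right _ _ (Ideal.pow_mem_of_mem _ h2v 2 two_pos))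
  have h4v1 : (1 + 2 ^ 2 * θ : 𝓞 K) - 1 ∈ v.asIdeal ^ (3 - 1) := by
    rw [add_sub_cancel_left]
    exact Ideal.mul_mem_right _ _ (Ideal.pow_mem_pow h2v 2)
  refine ⟨H.existsUnique_of_conductor hodd (pow_ne_top v two_ne_zero) huniq four_ne_zero ZMod.χ₄.toMonoidHom fun η hη =>
    hcond 2 ZMod.χ₄.toMonoidHom (1 + 2 ^ 1 * θ) 3 two_ne_zero hθv ?_ ?_ (by decide) η hη, ?_⟩
  · rw [add_sub_cancel_left]
    exact Ideal.mul_mem_right _ _ (Ideal.pow_mem_pow h2v 1)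
  · rw [hN2]
    push_cast
    lia
  obtain ⟨η₁, hs₁, h₁, hb₁⟩ := H.exists_isBaseChange hodd (M := 8) (by norm_num) ZMod.χ₈.toMonoidHom
  obtain ⟨η₂, hs₂, h₂, hb₂⟩ := H.exists_isBaseChange hodd (M := 8) (by norm_num) ZMod.χ₈'.toMonoidHom
  have hN45 : ((2 ^ 3 : ℕ) : ℤ) ∣ Algebra.norm ℤ (1 + 2 ^ 2 * θ) - 5 := by
    rw [hN4]
    push_cast
    lia
  have hm₁ := mem_quadraticOfConductor (pow_ne_top v three_ne_zero) hs₁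
    (hcond 3 ZMod.χ₈.toMonoidHom (1 + 2 ^ 2 * θ) 5 three_ne_zero h4v h4v1 hN45 (by decide) _ h₁)
  have hm₂ := mem_quadraticOfConductor (pow_ne_top v three_ne_zero) hs₂
    (hcond 3 ZMod.χ₈'.toMonoidHom (1 + 2 ^ 2 * θ) 5 three_ne_zero h4v h4v1 hN45 (by decide) _ h₂)
  have hne12 : η₁ ≠ η₂ := by
    have hN7 : ((8 : ℕ) : ℤ) ∣ Algebra.norm ℤ (1 + 2 ^ 1 * θ) - 7 := by
      rw [hN2]
      push_cast
      lia
    refine (ne_of_apply h₂ h₁ (v := v) (a := 1 + 2 ^ 1 * θ) hθv (fun w hw => intValuation_le_of_notMem (fun h => hw (hunique 3 w ?_)) _) ?_ ?_).symm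
    · exact h
    · rw [apply_norm_eq _ hN7]
      decide
    · rw [apply_norm_eq _ hN7]
      decide
  have hpair := eq_pair_of_sign (fun η : ideleClassCharacters K => localValue η v ((1 + 2 ^ 1 * θ : 𝓞 K) : K))
    (fun η hη => localValue_eq_one_or (sq_eq_one_of_orderOf hη.1) hθv) hinj hm₁ hm₂ hne12
  refine ⟨by rw [hpair, Set.ncard_pair hne12], fun η hη => ?_⟩
  rw [hpair] at hη
  rcases hη with rfl | rfl
  · exact hb₁
  · exact hb₂

end IsSqrtGenerator
end QuadIdele

/-! ### A congruence character of conductor exponent five -/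

namespace QuadIdele
variable {K : Type*} [Field K] [NumberField K]

/-- The character modulo `8` of `ℤ[√-2]` with values `1`, `1`, `-1` at `-1`, `1 + √-2` and `5`. -/
def sqrtNegTwoSign (a b : ZMod 8) : ℤ :=
  ZMod.χ₈ a * if b.val % 2 = 0 then 1 else ZMod.χ₄ ((a * b).val : ZMod 4)

/-- The arguments on the left are the coordinates of the product of a + b√−2 and a' + b'√−2, so this
is multiplicativity, verified on finitely many residues. -/
theorem sqrtNegTwoSign_mul (a b a' b' : ZMod 8) :
    sqrtNegTwoSign (a * a' - 2 * (b * b')) (a * b' + a' * b) = sqrtNegTwoSign a b * sqrtNegTwoSign a' b' := by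
  revert a b a' b'
  decide +kernel

theorem IsSqrtGenerator.exists_sqrtNegTwoSign {s : K} (H : IsSqrtGenerator 2 s) :
    ∃ κ : 𝓞 K →* ℤ, ∀ m n : ℤ, κ (m + n * H.root) = sqrtNegTwoSign m n := by
  choose f g hfg using H.exists_eq_add_mul_root
  have huniq : ∀ x : 𝓞 K, ∀ m n : ℤ, x = m + n * H.root → f x = m ∧ g x = n := by
    intro x m n h
    have h1 := H.eq_zero_int (a := f x - m) (b := g x - n) (by
      push_cast
      linear_combination h - hfg x)
    lia
  refine ⟨⟨⟨fun x => sqrtNegTwoSign (f x) (g x), ?_⟩, fun x y => ?_⟩, fun m n => ?_⟩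
  · obtain ⟨h1, h2⟩ := huniq 1 1 0 (by simp)
    rw [h1, h2]
    decide
  · obtain ⟨h1, h2⟩ := huniq (x * y) (f x * f y - 2 * (g x * g y)) (f x * g y + f y * g x) (by
      have h3 := H.root_sq
      push_cast at h3 ⊢
      linear_combination (y : 𝓞 K) * hfg x + (f x + g x * H.root) * hfg y + g x * g y * h3)
    change sqrtNegTwoSign (f (x * y) : ℤ) (g (x * y) : ℤ) = _
    rw [h1, h2, ← sqrtNegTwoSign_mul]
    push_cast
    rfl
  · obtain ⟨h1, h2⟩ := huniq _ m n rfl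
    change sqrtNegTwoSign (f _ : ℤ) (g _ : ℤ) = _
    rw [h1, h2]

/-- As v is the only place above p, the local norm of a at v is its global norm 1. Every base change
must be trivial on such an idele. -/
theorem ideleNorm_localIdele_eq_one {d : ℕ} {s : K} (H : IsSqrtGenerator d s) {v : FinPlace K} {p : ℕ} (hp : (p : 𝓞 K) ∈ v.asIdeal)
    (huniq : ∀ w : FinPlace K, (p : 𝓞 K) ∈ w.asIdeal → w = v) {a : K} (ha : Algebra.norm ℚ a = 1)
    (ha0 : algebraMap K (v.adicCompletion K) a ≠ 0) : ideleNorm ℚ K (localIdele v (Units.mk0 _ ha0)) = 1 := by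
  refine ideles_ext ?_ fun q => Units.ext ?_
  · change infiniteAdeleNorm ℚ K (localIdele v (Units.mk0 _ ha0) : AdeleRing (𝓞 K) K).1 = 1
    rw [localIdele_fst, map_one]
  · rw [component_ideleNorm]
    by_cases hv : v.asIdeal.LiesOver q.asIdeal
    · rw [map_one, Units.val_one]
      have h1 := H.prod_localNorm q a
      rw [ha, Rat.cast_one] at h1
      rw [← h1]
      refine Finset.prod_congr rfl fun w _ => ?_
      have := w.2
      have hw : w.1 = v := by
        refine huniq w.1 ?_
        have h2 : (p : 𝓞 ℚ) ∈ q.asIdeal := by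
          rw [hv.over]
          change algebraMap (𝓞 ℚ) (𝓞 K) p ∈ v.asIdeal
          rwa [map_natCast]
        rw [w.2.over] at h2
        change algebraMap (𝓞 ℚ) (𝓞 K) p ∈ w.1.asIdeal at h2
        rwa [map_natCast] at h2
      obtain ⟨w, hw'⟩ := w
      subst hw
      rw [component_localIdele_same, Units.val_mk0]
    · rw [map_one, Units.val_one]
      refine Finset.prod_eq_one fun w _ => ?_
      have := w.2
      rw [component_localIdele_of_ne (fun h : w.1 = v => hv (h ▸ w.2)), Units.val_one, map_one]

end QuadIdele

/-! ### The prime two, ramified -/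

namespace QuadIdele
variable {K : Type*} [Field K] [NumberField K]

namespace IsSqrtGenerator

theorem eq_span_root_of_two {s : K} (H : IsSqrtGenerator 2 s) {v : FinPlace K} (hv : LiesAbove 2 v) : v.asIdeal = Ideal.span {H.root} :=
  H.eq_span_root Nat.prime_two (H.root_mem_of_natCast_mem hv)

section
variable {s : K} (H : IsSqrtGenerator 2 s) {v : FinPlace K} (hv : v.asIdeal = Ideal.span {H.root})
include hv

theorem root_mem_of_eq_span : H.root ∈ v.asIdeal := hv ▸ Ideal.mem_span_singleton_self _

theorem two_mem_of_eq_span : (2 : 𝓞 K) ∈ v.asIdeal := by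
  have h := Ideal.pow_mem_of_mem _ (H.root_mem_of_eq_span hv) 2 two_pos
  rw [root_sq, neg_mem_iff] at h
  exact_mod_cast h

theorem absNorm_eq_two : Ideal.absNorm v.asIdeal = 2 := by rw [hv, H.absNorm_span_root]

theorem eq_of_pow_mem {n : ℕ} {w : FinPlace K} (hw : ((2 ^ n : ℕ) : 𝓞 K) ∈ w.asIdeal) : w = v := by
  rw [Nat.cast_pow] at hw
  have h := H.root_mem_of_natCast_mem (w.isPrime.mem_of_pow_mem n hw)
  refine (eq_of_asIdeal_le ?_).symm
  rwa [hv, Ideal.span_singleton_le_iff_mem]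

theorem mem_pow_iff {n : ℕ} {a : 𝓞 K} : a ∈ v.asIdeal ^ n ↔ H.root ^ n ∣ a := by
  rw [hv, Ideal.span_singleton_pow, Ideal.mem_span_singleton]

theorem one_add_pow_notMem {i : ℕ} (hi : i ≠ 0) : 1 + H.root ^ i ∉ v.asIdeal := notMem_of_sub_one_mem (by
  rw [add_sub_cancel_left]
  exact Ideal.pow_mem_of_mem _ (H.root_mem_of_eq_span hv) i (Nat.pos_of_ne_zero hi))

/-- Residue field 𝔽₂ gives uniqueness. An integer congruent to 1 modulo v² = (2) has norm 1 modulo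
4, while 1 + √−2 has norm 3, where `ZMod.χ₄` is −1. -/
theorem ramified_two (hodd : Odd (classNumber K)) :
    (∃! η, η ∈ quadraticOfConductor K (v.asIdeal ^ 2)) ∧ ∀ η ∈ quadraticOfConductor K (v.asIdeal ^ 2), IsBaseChange η := by
  have hrt := H.root_mem_of_eq_span hv
  have hn := H.absNorm_eq_two hv
  have hsq := H.root_sq
  push_cast at hsq
  refine H.existsUnique_of_conductor hodd (pow_ne_top v two_ne_zero) (fun η₁ h₁ η₂ h₂ => ?_) four_ne_zero ZMod.χ₄.toMonoidHom fun η hη => ?_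
  · exact quadraticOfConductor_pow_eq hodd H.isSquare_infinite h₁ h₂ (trivial_zero_of_absNorm_eq_two hn
      (mul_inv_trivial_of_succ (sq_eq_one_of_orderOf h₁.1) (sq_eq_one_of_orderOf h₂.1) hn hrt (notMem_sq_of_eq_span hv) one_ne_zero
        h₁.2.eq_one_pow (h₁.2.not_eq_one_pow one_lt_two) h₂.2.eq_one_pow (h₂.2.not_eq_one_pow one_lt_two)))
  · refine hasConductor_pow_of_apply four_ne_zero hη (fun a ha => H.apply_norm_eq_one _ ha) ?_ (fun w hw => H.eq_of_pow_mem hv (n := 2) hw)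
      (fun a _ ha => ?_) ⟨1 + H.root, ?_, ?_, ?_⟩
    · rw [H.mem_pow_iff hv]
      exact ⟨-2, by push_cast; linear_combination 2 * hsq⟩
    · obtain ⟨z, hz⟩ := (H.mem_pow_iff hv).1 ha
      obtain ⟨m, n, rfl⟩ := H.exists_eq_add_mul_root z
      have h1 : a = ((1 - 2 * m : ℤ) : 𝓞 K) + (-2 * n : ℤ) * H.root := by
        push_cast
        linear_combination hz + (m + n * H.root) * hsq
      have hN : ((4 : ℕ) : ℤ) ∣ Algebra.norm ℤ a - 1 := by
        rw [h1, norm_add_mul_root]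
        exact ⟨m ^ 2 - m + 2 * n ^ 2, by push_cast; ring⟩
      rw [apply_norm_eq _ hN]
      decide
    · simpa using H.one_add_pow_notMem hv one_ne_zero
    · rw [add_sub_cancel_left]
      simpa using hrt
    · have hN := H.norm_add_mul_root 1 1
      rw [Int.cast_one, one_mul] at hN
      rw [hN]
      decide

/-- Since π² = −2, one has 1 + π³ = −(1 + π)², and −1 has local value 1 because v is the only place
that can ramify. -/
theorem one_add_root_cube (a : ideleClassCharacters K) {n : ℕ} (ha : a ∈ quadraticOfConductor K (v.asIdeal ^ n)) :
    localValue a v ((1 + H.root ^ 3 : 𝓞 K) : K) = 1 := by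
  have hsq := H.root_sq
  push_cast at hsq
  have h1 : 1 + H.root ^ 3 = -1 * (1 + H.root ^ 1) ^ 2 := by linear_combination (H.root + 1) * hsq
  rw [h1, localValue_mul_int, localValue_neg_one H.isSquare_infinite ha,
    localValue_sq (sq_eq_one_of_orderOf ha.1) (H.one_add_pow_notMem hv one_ne_zero), one_mul]

/-- Exponent 4 would force the value −1 at 1 + π³. -/
theorem conductor_four_eq_empty : quadraticOfConductor K (v.asIdeal ^ 4) = ∅ := by
  refine Set.eq_empty_iff_forall_notMem.2 fun η h => ?_
  have h1 := localValue_one_add_pow (sq_eq_one_of_orderOf h.1) (H.absNorm_eq_two hv) (H.root_mem_of_eq_span hv)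
    (notMem_sq_of_eq_span hv) three_ne_zero h.2.eq_one_pow (h.2.not_eq_one_pow (Nat.lt_succ_self 3))
  rw [H.one_add_root_cube hv η h] at h1
  norm_num at h1

theorem one_add_root_four {η : ideleClassCharacters K} (h : η ∈ quadraticOfConductor K (v.asIdeal ^ 5)) :
    localValue η v ((1 + H.root ^ 4 : 𝓞 K) : K) = -1 :=
  localValue_one_add_pow (sq_eq_one_of_orderOf h.1) (H.absNorm_eq_two hv) (H.root_mem_of_eq_span hv)
    (notMem_sq_of_eq_span hv) four_ne_zero h.2.eq_one_pow (h.2.not_eq_one_pow (Nat.lt_succ_self 4))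

/-- The values at 1 + π⁴, at 1 + π³ and at 1 + π² = −1 are all forced, so the two characters agree
down to the second step. -/
theorem trivial_two_of_conductor_five {η₁ η₂ : ideleClassCharacters K} (h₁ : η₁ ∈ quadraticOfConductor K (v.asIdeal ^ 5))
    (h₂ : η₂ ∈ quadraticOfConductor K (v.asIdeal ^ 5)) : ∀ u ∈ unitFiltration v 2, localComponent (η₁ * η₂⁻¹) v u = 1 := by
  have hrt := H.root_mem_of_eq_span hv
  have hrt2 : H.root ∉ v.asIdeal ^ 2 := notMem_sq_of_eq_span hv
  have hn := H.absNorm_eq_two hv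
  have hs₁ := sq_eq_one_of_orderOf h₁.1
  have hs₂ := sq_eq_one_of_orderOf h₂.1
  have h4 := mul_inv_trivial_of_succ hs₁ hs₂ hn hrt hrt2 four_ne_zero h₁.2.eq_one_pow (h₁.2.not_eq_one_pow (Nat.lt_succ_self 4))
    h₂.2.eq_one_pow (h₂.2.not_eq_one_pow (Nat.lt_succ_self 4))
  have h3 := trivial_of_absNorm_eq_two hn hrt hrt2 h4 (localValue_mul_inv_eq_one hs₁ (H.one_add_pow_notMem hv three_ne_zero)
    ((H.one_add_root_cube hv η₁ h₁).trans (H.one_add_root_cube hv η₂ h₂).symm))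
  refine trivial_of_absNorm_eq_two hn hrt hrt2 h3 ?_
  have hsq := H.root_sq
  push_cast at hsq
  rw [show 1 + H.root ^ 2 = -1 by linear_combination hsq]
  exact localValue_mul_inv_eq_one hs₁ neg_one_notMem
    ((localValue_neg_one H.isSquare_infinite h₁).trans (localValue_neg_one H.isSquare_infinite h₂).symm)

theorem eq_of_conductor_five (hodd : Odd (classNumber K)) {η₁ η₂ : ideleClassCharacters K}
    (h₁ : η₁ ∈ quadraticOfConductor K (v.asIdeal ^ 5)) (h₂ : η₂ ∈ quadraticOfConductor K (v.asIdeal ^ 5))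
    (h : localValue η₁ v ((1 + H.root ^ 1 : 𝓞 K) : K) = localValue η₂ v ((1 + H.root ^ 1 : 𝓞 K) : K)) : η₁ = η₂ :=
  quadraticOfConductor_pow_eq hodd H.isSquare_infinite h₁ h₂ (trivial_zero_of_absNorm_eq_two (H.absNorm_eq_two hv)
    (trivial_of_absNorm_eq_two (H.absNorm_eq_two hv) (H.root_mem_of_eq_span hv) (notMem_sq_of_eq_span hv)
      (H.trivial_two_of_conductor_five hv h₁ h₂)
      (localValue_mul_inv_eq_one (sq_eq_one_of_orderOf h₁.1) (H.one_add_pow_notMem hv one_ne_zero) h)))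

theorem mul_inv_mem_of_conductor_five (hodd : Odd (classNumber K)) {η₁ η₂ : ideleClassCharacters K}
    (h₁ : η₁ ∈ quadraticOfConductor K (v.asIdeal ^ 5)) (h₂ : η₂ ∈ quadraticOfConductor K (v.asIdeal ^ 5)) (hne : η₁ ≠ η₂) :
    η₁ * η₂⁻¹ ∈ quadraticOfConductor K (v.asIdeal ^ 2) := by
  refine mem_quadraticOfConductor (pow_ne_top v two_ne_zero) (sq_mul_inv (sq_eq_one_of_orderOf h₁.1) (sq_eq_one_of_orderOf h₂.1))
    ⟨pow_ne_zero _ v.ne_bot, fun u => ?_⟩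
  rcases multiplicity_pow_self_or u v 2 with rfl | hm
  · rw [multiplicity_pow_self]
    refine ⟨H.trivial_two_of_conductor_five hv h₁ h₂, fun m hm => ?_⟩
    by_contra! hlt
    have h1 : ∀ x ∈ unitFiltration u 1, localComponent (η₁ * η₂⁻¹) u x = 1 := fun x hx => hm x (unitFiltration_anti (by lia) hx)
    exact hne (quadraticOfConductor_pow_eq hodd H.isSquare_infinite h₁ h₂ (trivial_zero_of_absNorm_eq_two (H.absNorm_eq_two hv) h1))
  · rw [hm]
    refine ⟨?_, fun m _ => Nat.zero_le m⟩
    have hm5 : multiplicity u.asIdeal (v.asIdeal ^ 5) = 0 := by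
      refine multiplicity_pow_of_ne (fun h => ?_) 5
      rw [h, multiplicity_pow_self] at hm
      norm_num at hm
    exact mul_inv_trivial (h₁.2.eq_one hm5) (h₂.2.eq_one hm5)

/-- A base change is trivial at (1 + π) / (1 − π), of norm 1, so it has equal values at 1 + π and 1
− π, hence value 1 at their product 3 and at −3. But −3 ≡ 1 + π⁴ modulo π⁵, where the value is −1.
-/
theorem not_isBaseChange_of_conductor_five {η : ideleClassCharacters K} (h : η ∈ quadraticOfConductor K (v.asIdeal ^ 5)) :
    ¬ IsBaseChange η := by
  rintro ⟨ν, hν⟩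
  have hsq := H.root_sq
  push_cast at hsq
  have h1 : 1 + H.root ∉ v.asIdeal := by simpa using H.one_add_pow_notMem hv one_ne_zero
  have h2 : 1 - H.root ∉ v.asIdeal := notMem_of_sub_one_mem (by simpa using H.root_mem_of_eq_span hv)
  have hne : ((1 - H.root : 𝓞 K) : K) ≠ 0 := int_ne_zero_of_notMem h2
  set a : K := ((1 + H.root : 𝓞 K) : K) / ((1 - H.root : 𝓞 K) : K) with ha
  have hN1 : Algebra.norm ℤ (1 + H.root) = 3 := by
    have hN := H.norm_add_mul_root 1 1
    rw [Int.cast_one, one_mul] at hN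
    rw [hN]
    norm_num
  have hN2 : Algebra.norm ℤ (1 - H.root) = 3 := by
    have hN := H.norm_add_mul_root 1 (-1)
    rw [Int.cast_neg, Int.cast_one, neg_one_mul, ← sub_eq_add_neg] at hN
    rw [hN]
    norm_num
  have hNa : Algebra.norm ℚ a = 1 := by
    have h3 : a * ((1 - H.root : 𝓞 K) : K) = ((1 + H.root : 𝓞 K) : K) := div_mul_cancel₀ _ hne
    have h4 := congrArg (Algebra.norm ℚ) h3
    rw [map_mul, ← Algebra.coe_norm_int, ← Algebra.coe_norm_int, hN1, hN2, Int.cast_ofNat] at h4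
    linarith
  have ha0 : algebraMap K (v.adicCompletion K) a ≠ 0 :=
    (map_ne_zero _).2 (div_ne_zero (int_ne_zero_of_notMem h1) hne)
  have hva : localValue η v a = 1 := by
    rw [localValue_of_ne_zero η ha0]
    have h3 := hν (localIdele v (Units.mk0 _ ha0))
    rw [ideleNorm_localIdele_eq_one H (p := 2) (by exact_mod_cast H.two_mem_of_eq_span hv)
      (fun w hw => H.eq_of_pow_mem hv (n := 1) (by rwa [pow_one])) hNa ha0, map_one] at h3
    exact congrArg Subtype.val h3
  have h4 : localValue η v ((1 + H.root : 𝓞 K) : K) = localValue η v ((1 - H.root : 𝓞 K) : K) := by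
    have h5 := localValue_mul (v := v) η a ((1 - H.root : 𝓞 K) : K)
    rwa [hva, one_mul, ha, div_mul_cancel₀ _ hne] at h5
  have hs := sq_eq_one_of_orderOf h.1
  have h5 : localValue η v (((1 + H.root) * (1 - H.root) : 𝓞 K) : K) = 1 := by
    rw [localValue_mul_int, h4, ← localValue_mul_int, ← pow_two]
    exact localValue_sq hs h2
  have h6 : localValue η v ((-1 * ((1 + H.root) * (1 - H.root)) : 𝓞 K) : K) = localValue η v ((1 + H.root ^ 4 : 𝓞 K) : K) := by
    refine localValue_congr h.2.eq_one_pow (v.isPrime.mul_notMem neg_one_notMem (v.isPrime.mul_notMem h1 h2))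
      (H.one_add_pow_notMem hv four_ne_zero) ?_
    rw [H.mem_pow_iff hv]
    exact ⟨H.root, by linear_combination (1 + 2 - H.root ^ 2 - H.root ^ 4 + 2 * H.root ^ 2 - 4) * hsq⟩
  rw [localValue_mul_int, localValue_neg_one H.isSquare_infinite h, h5, H.one_add_root_four hv h] at h6
  norm_num at h6

/-- As 8 = −π⁶ lies in v⁵, a character modulo v⁵ may be given modulo 8. Multiplying κ by ρ = χ₄ ∘ N
changes the sign at 1 + π and keeps those at −1 and 5. -/
theorem exists_conductor_five (hodd : Odd (classNumber K)) :
    ∃ η₁ ∈ quadraticOfConductor K (v.asIdeal ^ 5), ∃ η₂ ∈ quadraticOfConductor K (v.asIdeal ^ 5),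
      localValue η₁ v ((1 + H.root ^ 1 : 𝓞 K) : K) = 1 ∧ localValue η₂ v ((1 + H.root ^ 1 : 𝓞 K) : K) = -1 := by
  have hrt := H.root_mem_of_eq_span hv
  have hsq := H.root_sq
  push_cast at hsq
  have h2v := H.two_mem_of_eq_span hv
  obtain ⟨κ, hκ⟩ := H.exists_sqrtNegTwoSign
  have hκp : ∀ a b, ((8 : ℕ) : 𝓞 K) ∣ a - b → κ a = κ b := by
    rintro a b ⟨e, he⟩
    obtain ⟨m, n, rfl⟩ := H.exists_eq_add_mul_root b
    obtain ⟨m', n', rfl⟩ := H.exists_eq_add_mul_root e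
    have h1 : a = ((m + 8 * m' : ℤ) : 𝓞 K) + (n + 8 * n' : ℤ) * H.root := by
      push_cast at he ⊢
      linear_combination he
    rw [h1, hκ, hκ]
    have h8 : (8 : ZMod 8) = 0 := by decide
    push_cast
    rw [h8, zero_mul, add_zero, zero_mul, add_zero]
  let ρ : 𝓞 K →* ℤ := ZMod.χ₄.toMonoidHom.comp ((Int.castRingHom (ZMod 4)).toMonoidHom.comp (Algebra.norm ℤ))
  have hρ (a : 𝓞 K) : ρ a = ZMod.χ₄.toMonoidHom ((Algebra.norm ℤ a : ℤ) : ZMod 4) := rfl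
  have hρp : ∀ a b, ((8 : ℕ) : 𝓞 K) ∣ a - b → ρ a = ρ b := by
    rintro a b h
    rw [hρ, hρ]
    exact apply_norm_eq _ (Dvd.dvd.trans (by norm_num) (H.dvd_norm_sub h))
  have hκr : κ (1 + H.root) = 1 := by
    have h := hκ 1 1
    rw [Int.cast_one, one_mul] at h
    rw [h]
    decide
  have hκn : κ (-1) = 1 := by
    have h := hκ (-1) 0
    rw [Int.cast_zero, zero_mul, add_zero, Int.cast_neg, Int.cast_one] at h
    rw [h]
    decide
  have hκ5 : κ 5 = -1 := by
    have h := hκ 5 0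
    rw [Int.cast_zero, zero_mul, add_zero] at h
    exact_mod_cast h
  have hκv : ∀ a, a - 1 ∈ v.asIdeal ^ 5 → κ a = 1 ∧ ρ a = 1 := by
    intro a ha
    -- Since π⁵ = 4π, the integers in question are 1 − 8n + 4mπ.
    obtain ⟨z, hz⟩ := (H.mem_pow_iff hv).1 ha
    obtain ⟨m, n, rfl⟩ := H.exists_eq_add_mul_root z
    have h1 : a = ((1 - 8 * n : ℤ) : 𝓞 K) + (4 * m : ℤ) * H.root := by
      push_cast
      linear_combination hz + (m * (H.root ^ 3 - 2 * H.root) + n * (H.root ^ 4 - 2 * H.root ^ 2 + 4)) * hsq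
    constructor
    · rw [h1, hκ]
      have h8 : (8 : ZMod 8) = 0 := by decide
      push_cast
      rw [h8, zero_mul, sub_zero]
      generalize (m : ZMod 8) = m
      revert m
      decide
    · have hN : ((4 : ℕ) : ℤ) ∣ Algebra.norm ℤ a - 1 := by
        rw [h1, norm_add_mul_root]
        exact ⟨-4 * n + 16 * n ^ 2 + 8 * m ^ 2, by push_cast; ring⟩
      rw [hρ, apply_norm_eq _ hN]
      decide
  have hρ5 : ρ 5 = 1 := by
    have hN := H.norm_natCast 5
    push_cast at hN
    rw [hρ, hN]
    decide
  have hρr : ρ (1 + H.root) = -1 := by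
    have hN := H.norm_add_mul_root 1 1
    rw [Int.cast_one, one_mul] at hN
    rw [hρ, hN]
    decide
  have hρu : ∀ u : (𝓞 K)ˣ, ρ u = 1 := fun u => by
    rw [hρ, H.norm_unit u, Int.cast_one, map_one]
  have key : ∀ τ : 𝓞 K →* ℤ, (∀ a b, ((8 : ℕ) : 𝓞 K) ∣ a - b → τ a = τ b) → (∀ a, a - 1 ∈ v.asIdeal ^ 5 → τ a = 1) → τ (-1) = 1 →
      τ 5 = -1 → ∃ η ∈ quadraticOfConductor K (v.asIdeal ^ 5), localValue η v ((1 + H.root ^ 1 : 𝓞 K) : K) = circleSign (τ (1 + H.root)) := by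
    intro τ hτ hτv hτn hτ5
    obtain ⟨η, hsη, hη⟩ := exists_ideleClassCharacter hodd (M := 8) (by norm_num) τ hτ 1 (by simp) (by simp) fun u => by
      have h : τ u = 1 := by
        rcases H.unit_eq_one_or (Or.inl rfl) u with rfl | rfl
        · rw [Units.val_one, map_one]
        · rw [Units.val_neg, Units.val_one, hτn]
      rw [h, circleSign_one, one_mul]
      rfl
    have hη' : ∀ x ∈ unitIdeles K, ∀ a, CongrMod 8 x a → η.1 x = circleSign (τ a) := fun x hx a ha => by
      rw [hη x hx a ha, MonoidHom.one_apply, mul_one]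
    refine ⟨η, mem_quadraticOfConductor (pow_ne_top v (by norm_num)) hsη ?_, ?_⟩
    -- The witness 5 = 1 + π⁴ shows that the exponent is not smaller than 5.
    · refine hasConductor_pow_of_apply (by norm_num) hη' (fun a ha => ?_) ?_ (fun w hw => H.eq_of_pow_mem hv (n := 3) hw)
        (fun a _ ha => hτv a ha) ⟨5, ?_, ?_, ?_⟩
      · rw [hτ a 1 ha, map_one]
      · rw [H.mem_pow_iff hv]
        exact ⟨-H.root, by push_cast; linear_combination (H.root ^ 4 - 2 * H.root ^ 2 + 4) * hsq⟩
      · refine notMem_of_sub_one_mem ?_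
        have := Ideal.mul_mem_left _ (2 : 𝓞 K) h2v
        norm_num at this ⊢
        exact this
      · rw [H.mem_pow_iff hv]
        exact ⟨1, by linear_combination (2 - H.root ^ 2) * hsq⟩
      · rw [hτ5]
        norm_num
    · rw [pow_one]
      refine localValue_eq_circleSign hη' (by simpa using H.one_add_pow_notMem hv one_ne_zero) fun w hw =>
        intValuation_le_of_notMem (fun h => hw (H.eq_of_pow_mem hv (n := 3) h)) _
  obtain ⟨η₁, h₁, e₁⟩ := key κ hκp (fun a ha => (hκv a ha).1) hκn hκ5
  obtain ⟨η₂, h₂, e₂⟩ := key (κ * ρ) (fun a b h => by rw [MonoidHom.mul_apply, MonoidHom.mul_apply, hκp a b h, hρp a b h])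
    (fun a ha => by rw [MonoidHom.mul_apply, (hκv a ha).1, (hκv a ha).2, one_mul])
    (by rw [MonoidHom.mul_apply, hκn, one_mul]; exact hρu (-1)) (by rw [MonoidHom.mul_apply, hκ5, hρ5, mul_one])
  refine ⟨η₁, h₁, η₂, h₂, ?_, ?_⟩
  · rw [e₁, hκr, circleSign_one, Circle.coe_one]
  · rw [e₂, MonoidHom.mul_apply, hκr, hρr, one_mul]
    simp [circleSign]

end

theorem sqrt_neg_two {s : K} (H : IsSqrtGenerator 2 s) (hodd : Odd (classNumber K)) {v : FinPlace K} (hv2 : LiesAbove 2 v) :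
    quadraticOfConductor K (v.asIdeal ^ 4) = ∅ ∧
      (quadraticOfConductor K (v.asIdeal ^ 5)).ncard = 2 ∧
      (∀ η ∈ quadraticOfConductor K (v.asIdeal ^ 5), localValue η v (1 + s ^ 3) = 1 ∧ localValue η v (1 + s ^ 4) = -1) ∧
      (∀ ε : ℂ, ε = 1 ∨ ε = -1 → ∃! η, η ∈ quadraticOfConductor K (v.asIdeal ^ 5) ∧ localValue η v (1 + s) = ε) ∧
      (∀ η₁ ∈ quadraticOfConductor K (v.asIdeal ^ 5), ∀ η₂ ∈ quadraticOfConductor K (v.asIdeal ^ 5), η₁ ≠ η₂ →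
        η₁ * η₂⁻¹ ∈ quadraticOfConductor K (v.asIdeal ^ 2)) ∧
      ∀ η ∈ quadraticOfConductor K (v.asIdeal ^ 5), ¬ IsBaseChange η := by
  have hv := H.eq_span_root_of_two hv2
  have e (i : ℕ) : ((1 + H.root ^ i : 𝓞 K) : K) = 1 + s ^ i := by
    change algebraMap (𝓞 K) K _ = _
    rw [map_add, map_one, map_pow]
    rfl
  have e1 : ((1 + H.root ^ 1 : 𝓞 K) : K) = 1 + s := by rw [e, pow_one]
  obtain ⟨η₁, h₁, η₂, h₂, hv₁, hv₂⟩ := H.exists_conductor_five hv hodd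
  have hinj : ∀ η₁ ∈ quadraticOfConductor K (v.asIdeal ^ 5), ∀ η₂ ∈ quadraticOfConductor K (v.asIdeal ^ 5),
      localValue η₁ v (1 + s) = localValue η₂ v (1 + s) → η₁ = η₂ := fun η₁ h₁ η₂ h₂ h =>
    H.eq_of_conductor_five hv hodd h₁ h₂ (by rwa [e1])
  rw [e1] at hv₁ hv₂
  refine ⟨H.conductor_four_eq_empty hv, ?_, fun η h => ?_, ?_, fun η₁ h₁ η₂ h₂ hne => H.mul_inv_mem_of_conductor_five hv hodd h₁ h₂ hne,
    fun η h => H.not_isBaseChange_of_conductor_five hv h⟩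
  · have hne : η₁ ≠ η₂ := by
      rintro rfl
      rw [hv₁] at hv₂
      norm_num at hv₂
    rw [eq_pair_of_sign (fun η : ideleClassCharacters K => localValue η v (1 + s)) (fun η hη => ?_) hinj h₁ h₂ hne, Set.ncard_pair hne]
    rw [← e1]
    exact localValue_eq_one_or (sq_eq_one_of_orderOf hη.1) (H.one_add_pow_notMem hv one_ne_zero)
  · rw [← e, ← e]
    exact ⟨H.one_add_root_cube hv η h, H.one_add_root_four hv h⟩
  · rintro ε (rfl | rfl)
    · exact ⟨η₁, ⟨h₁, hv₁⟩, fun η ⟨h, hη⟩ => hinj _ h _ h₁ (hη.trans hv₁.symm)⟩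
    · exact ⟨η₂, ⟨h₂, hv₂⟩, fun η ⟨h, hη⟩ => hinj _ h _ h₂ (hη.trans hv₂.symm)⟩

end IsSqrtGenerator
end QuadIdele

/-! ### The odd ramified prime -/

namespace QuadIdele
variable {K : Type*} [Field K] [NumberField K]

/-- A quadratic character is tamely ramified at the places of odd residue characteristic. -/
theorem trivial_one_of_two_notMem {χ : ideleClassCharacters K} (hχ : ∀ x, χ.1 x ^ 2 = 1) {v : FinPlace K} {e : 𝓞 K}
    (he : 2 * e - 1 ∈ v.asIdeal) : ∀ u ∈ unitFiltration v 1, localComponent χ v u = 1 := by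
  have step : ∀ n : ℕ, (∀ u ∈ unitFiltration v (n + 2), localComponent χ v u = 1) →
      ∀ u ∈ unitFiltration v (n + 1), localComponent χ v u = 1 := by
    intro n hn
    -- As e inverts 2 modulo v, the square of 1 + e (a − 1) is congruent to a modulo the next power
    -- of v.
    refine trivial_on_unitFiltration_of_succ hn fun a _ ha => ⟨(1 + e * (a - 1)) ^ 2, ?_, localValue_sq hχ (notMem_of_sub_one_mem ?_)⟩
    · have h1 : (a - 1) ^ 2 ∈ v.asIdeal ^ (n + 2) := by
        have h2 := Ideal.pow_mem_pow ha 2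
        rw [← pow_mul] at h2
        exact Ideal.pow_le_pow_right (by lia) h2
      have h3 : (2 * e - 1) * (a - 1) ∈ v.asIdeal ^ (n + 2) := by
        rw [pow_succ']
        exact Ideal.mul_mem_mul he ha
      have h4 := neg_mem (add_mem h3 (Ideal.mul_mem_left _ (e ^ 2) h1))
      convert h4 using 1
      ring
    · rw [add_sub_cancel_left]
      exact Ideal.mul_mem_left _ _ (Ideal.pow_le_self n.succ_ne_zero ha)
  obtain ⟨n, hn⟩ := exists_trivial_on_unitFiltration χ hχ v
  have h : ∀ m : ℕ, (∀ u ∈ unitFiltration v (m + 1), localComponent χ v u = 1) → ∀ u ∈ unitFiltration v 1, localComponent χ v u = 1 := by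
    intro m
    induction m with
    | zero => exact id
    | succ m ih => exact fun h => ih (step m h)
  exact h n fun u hu => hn u (unitFiltration_anti n.le_succ hu)

/-- Such a character is tame at v, so it is the quadratic character modulo d. The product formula
gives it the value 1 at −1, making −1 a square modulo d. -/
theorem IsSqrtGenerator.not_ramified_only {d : ℕ} {s : K} (H : IsSqrtGenerator d s) (hd : d.Prime) (hd4 : d % 4 = 3) {v : FinPlace K}
    (hv : LiesAbove d v) : ¬ ∃ η : ideleClassCharacters K, orderOf η = 2 ∧ ∀ w : FinPlace K, IsRamifiedAt η w ↔ w = v := by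
  have : Fact d.Prime := ⟨hd⟩
  rintro ⟨η, hη2, hη⟩
  have hsq := sq_eq_one_of_orderOf hη2
  have hn : Ideal.absNorm v.asIdeal = d := by
    rw [H.eq_span_root hd (H.root_mem_of_natCast_mem hv), H.absNorm_span_root]
  have h1 : localValue η v ((-1 : 𝓞 K) : K) = 1 := by
    have h := localValue_neg_one_prod H.isSquare_infinite hsq {v} fun u hu x hx => by
      by_contra hne
      exact hu (Finset.mem_singleton.2 ((hη u).1 ⟨x, hx, hne⟩))
    rwa [Finset.prod_singleton] at h
  -- (d + 1) / 2 is an inverse of 2 modulo d.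
  obtain ⟨k, hk⟩ : ∃ k, d + 1 = 2 * k := ⟨(d + 1) / 2, by lia⟩
  have ht := trivial_one_of_two_notMem hsq (v := v) (e := (k : 𝓞 K)) (by
    have hk' : (d : 𝓞 K) + 1 = 2 * k := by exact_mod_cast congrArg (Nat.cast (R := 𝓞 K)) hk
    rw [← hk', add_sub_cancel_right]
    exact hv)
  have h0 : ¬ ∀ u ∈ unitFiltration v 0, localComponent η v u = 1 := by
    obtain ⟨u, hu, hne⟩ := (hη v).2 rfl
    exact fun h => hne (h u hu)
  obtain ⟨b, hb⟩ := (localValue_eq_one_iff hsq ht h0 neg_one_notMem).1 h1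
  obtain ⟨n, hnb⟩ := exists_sub_natCast_mem hd hn b
  have h2 : ((n ^ 2 + 1 : ℕ) : 𝓞 K) ∈ v.asIdeal := by
    have h3 := neg_mem (add_mem hb (Ideal.mul_mem_left _ (b + n) hnb))
    convert h3 using 1
    push_cast
    ring
  have h3 : d ∣ n ^ 2 + 1 := by
    by_contra hnd
    obtain ⟨e, f, hef⟩ := Nat.isCoprime_iff_coprime.2 ((Nat.Prime.coprime_iff_not_dvd hd).2 hnd)
    have h4 := add_mem (Ideal.mul_mem_left _ (e : 𝓞 K) hv) (Ideal.mul_mem_left _ (f : 𝓞 K) h2)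
    have h5 : (e : 𝓞 K) * d + f * (n ^ 2 + 1 : ℕ) = 1 := by exact_mod_cast congrArg (Int.cast (R := 𝓞 K)) hef
    rw [h5] at h4
    exact one_notMem h4
  have h4 : ((n : ZMod d)) ^ 2 = -1 := by
    rw [← ZMod.natCast_eq_zero_iff] at h3
    push_cast at h3
    exact eq_neg_of_add_eq_zero_left h3
  exact ZMod.mod_four_ne_three_of_sq_eq_neg_one h4 hd4

end QuadIdele

end

/-! ### The proposition. -/

open QuadIdele in
theorem proposition4p1 {K : Type*} [Field K] [NumberField K] (d : ℕ) (hd : Squarefree d)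
    (s : K) (hs : s ^ 2 = -(d : K)) (hK : IntermediateField.adjoin ℚ {s} = ⊤) :
    -- which fields satisfy the assumptions
    (OddClassNumberSmallUnits K ↔ d = 2 ∨ (d.Prime ∧ d % 4 = 3)) ∧
    (OddClassNumberSmallUnits K →
      -- a single prime ramifies
      (∃! p : ℕ, p.Prime ∧ ∃ v : FinPlace K, IsRamified p v) ∧
      -- inert odd primes
      (∀ p : ℕ, p.Prime → p ≠ 2 → ∀ v : FinPlace K, IsInert p v →
        (∃! η, η ∈ quadraticOfConductor K v.asIdeal) ∧
        ∀ η ∈ quadraticOfConductor K v.asIdeal, IsBaseChange η) ∧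
      -- split odd primes; the two distinct places above `p` are `v` and `w = v^c`
      (∀ p : ℕ, p.Prime → p ≠ 2 → ∀ v w : FinPlace K, v ≠ w → LiesAbove p v → LiesAbove p w →
        (∃! η, η ∈ quadraticOfConductor K (v.asIdeal * w.asIdeal)) ∧
        ∀ η ∈ quadraticOfConductor K (v.asIdeal * w.asIdeal), IsBaseChange η) ∧
      -- `2` split
      (∀ v w : FinPlace K, v ≠ w → LiesAbove 2 v → LiesAbove 2 w →
        (∃! η, η ∈ quadraticOfConductor K ((v.asIdeal * w.asIdeal) ^ 2)) ∧
        (∀ η ∈ quadraticOfConductor K ((v.asIdeal * w.asIdeal) ^ 2), IsBaseChange η) ∧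
        (quadraticOfConductor K ((v.asIdeal * w.asIdeal) ^ 3)).ncard = 2 ∧
        (∀ η₁ ∈ quadraticOfConductor K ((v.asIdeal * w.asIdeal) ^ 3),
          ∀ η₂ ∈ quadraticOfConductor K ((v.asIdeal * w.asIdeal) ^ 3),
          (∀ u ∈ unitFiltration v 0, localComponent η₁ v u = localComponent η₂ v u) → η₁ = η₂) ∧
        ∀ η ∈ quadraticOfConductor K ((v.asIdeal * w.asIdeal) ^ 3), IsBaseChange η) ∧
      -- `2` inert or ramified
      (∀ v : FinPlace K, IsInert 2 v ∨ IsRamified 2 v →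
        (∃! η, η ∈ quadraticOfConductor K (v.asIdeal ^ 2)) ∧
        ∀ η ∈ quadraticOfConductor K (v.asIdeal ^ 2), IsBaseChange η) ∧
      (∀ v : FinPlace K, IsInert 2 v →
        (quadraticOfConductor K (v.asIdeal ^ 3)).ncard = 2 ∧
        ∀ η ∈ quadraticOfConductor K (v.asIdeal ^ 3), IsBaseChange η) ∧
      -- the place above `2` of `ℚ(√-2)`, with `π = s`
      (d = 2 → ∀ v : FinPlace K, LiesAbove 2 v →
        quadraticOfConductor K (v.asIdeal ^ 4) = ∅ ∧
        (quadraticOfConductor K (v.asIdeal ^ 5)).ncard = 2 ∧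
        (∀ η ∈ quadraticOfConductor K (v.asIdeal ^ 5),
          localValue η v (1 + s ^ 3) = 1 ∧ localValue η v (1 + s ^ 4) = -1) ∧
        (∀ ε : ℂ, ε = 1 ∨ ε = -1 →
          ∃! η, η ∈ quadraticOfConductor K (v.asIdeal ^ 5) ∧ localValue η v (1 + s) = ε) ∧
        (∀ η₁ ∈ quadraticOfConductor K (v.asIdeal ^ 5),
          ∀ η₂ ∈ quadraticOfConductor K (v.asIdeal ^ 5), η₁ ≠ η₂ →
            η₁ * η₂⁻¹ ∈ quadraticOfConductor K (v.asIdeal ^ 2)) ∧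
        ∀ η ∈ quadraticOfConductor K (v.asIdeal ^ 5), ¬ IsBaseChange η) ∧
      -- the ramified odd prime
      (d.Prime → d % 4 = 3 → ∀ v : FinPlace K, LiesAbove d v →
        ¬ ∃ η : ideleClassCharacters K, orderOf η = 2 ∧
          ∀ w : FinPlace K, IsRamifiedAt η w ↔ w = v)) := by
  have H : IsSqrtGenerator d s := ⟨hd, hs, hK⟩
  refine ⟨H.oddClassNumberSmallUnits_iff, fun h => ?_⟩
  have hodd := h.1
  have hd2 := H.oddClassNumberSmallUnits_iff.1 h
  have hp : d.Prime := by
    rcases hd2 with rfl | h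
    · exact Nat.prime_two
    · exact h.1
  have hd' : d = 2 ∨ d % 4 = 3 := hd2.imp_right And.right
  refine ⟨H.existsUnique_ramified hp hd', fun p hp hp2 v hv => H.inert_odd hodd hp hp2 hv,
    fun p hp' hp2 v w hvw hv hw => H.split_odd hp hd' hodd hp' hp2 hvw hv hw,
    fun v w hvw hv hw => H.split_two hp hd' hodd hvw hv hw, fun v hv => ?_, fun v hv => (H.inert_two hd' hodd hv).2, ?_,
    fun hp hd4 v hv => H.not_ramified_only hp hd4 hv⟩
  · rcases hv with hv | hv
    · exact (H.inert_two hd' hodd hv).1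
    · obtain ⟨rfl, hv⟩ := (H.isRamified_iff hp hd' Nat.prime_two).1 hv
      exact H.ramified_two hv hodd
  · rintro rfl v hv
    exact H.sqrt_neg_two hodd hv
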